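/- Let $H,C$ be complex $2\times2$ matrices with $H$ Hermitian. Put $\mathcal J(\rho)=C\rho C^\star$, $L(\rho)=-i[H,\rho]-\frac12\{C^\star C,\rho\}+C\rho C^\star$ and $f(\rho)=L(\rho)+\mathrm{Tr}[\mathcal J(\rho)]\rho-\mathcal J(\rho)$. A state is a positive semidefinite matrix of trace one; let $K$ be a constant with $\mathrm{Tr}[\mathcal J(\rho)]\le K$ for all states $\rho$, and let $\rho_0$ be a state. Let $(\Omega,\mathcal F,(\mathcal F_t)_{t\ge0},P)$ be a filtered probability space carrying an $(\mathcal F_t)$-Poisson random measure $N(ds,dx)$ with intensity $ds\otimes dx$, and let $(\mu_t)_{t\ge 0}$ be the (unique) adapted càdlàg solution of the jump-Belavkin equation: almost surely, for all $t\ge0$, $$\mu_t=\rho_0+\int_0^tf(\mu_{s-})\,ds+\int_0^t\int_{[0,K]}\left[\frac{\mathcal J(\mu_{s-})}{\mathrm{Tr}[\mathcal J(\mu_{s-})]}-\mu_{s-}\right]\mathbf 1_{0\le x\le \mathrm{Tr}[\mathcal J(\mu_{s-})]}\,N(ds,dx).$$ There exist globally Lipschitz functions $F,q$ on the space of all complex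 $2\times 2$ matrices such that $F(\rho)=f(\rho)$ for every state $\rho$, and $q(\rho)=\mathcal J(\rho)/\mathrm{Tr}[\mathcal J(\rho)]-\rho$ for every state $\rho$ with $\mathrm{Tr}[\mathcal J(\rho)]>0$. Fix any such $F$ and $q$. For $n\ge1$ let $(\theta_k)$ be the Euler scheme $\theta_0=\rho_0$, $$\theta_{k+1}=\theta_k+\frac1nF(\theta_k)+\int_{]k/n,(k+1)/n]}\int_{[0,K]}q(\theta_k)\mathbf 1_{0\le x\le \mathrm{Re}\,\mathrm{Tr}[\mathcal J(\theta_k)]}\,N(ds,dx),$$ and let $\tilde\theta_t(n)$ be its interpolation: for $t\in[k/n,(k+1)/n[$, $$\tilde\theta_t(n)=\theta_k+\int_{k/n}^tF(\theta_k)\,ds+\int_{]k/n,t]}\int_{[0,K]}q(\theta_k)\mathbf 1_{0\le x\le \mathrm{Re}\,\mathrm{Tr}[\mathcal J(\theta_k)]}\,N(ds,dx).$$ Then for every $T>0$ there is a constant $\Gamma$, independent of $n$ and $u$, such that for all $n\ge1$ and all $0\le u<T$ $$Z_u(n)=\mathbf E\Big[\sup_{0\le t\le u}\|\tilde\theta_t(n)-\mu_t\|\Big]\le\frac{\Gamma}{n}.$$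 Moreover, for every $T>0$, the process $\tilde\theta(n)$ restricted to $[0,T]$ is almost surely càdlàg, and as $n\to\infty$ it converges in distribution to $(\mu_t)_{0\le t\le T}$ in the space $\mathcal D([0,T])$ of càdlàg matrix-valued functions with the Skorokhod topology. -/

import Mathlib

open MeasureTheory ProbabilityTheory Filter Set Topology
open scoped NNReal ENNReal Matrix ComplexOrder Matrix.Norms.L2Operator

/-! ## Càdlàg paths and the Skorokhod space `D([0,T])` -/

/-- A path is càdlàg: right-continuous with left limits. -/
def IsCadlag {ι E : Type*} [Preorder ι] [TopologicalSpace ι] [TopologicalSpace E]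
    (x : ι → E) : Prop :=
  ∀ t, ContinuousWithinAt x (Ici t) t ∧ ∃ l, Tendsto x (𝓝[<] t) (𝓝 l)

theorem isCadlag_const {ι E : Type*} [Preorder ι] [TopologicalSpace ι] [TopologicalSpace E]
    (c : E) : IsCadlag (fun _ : ι => c) :=
  fun _ => ⟨continuousWithinAt_const, c, tendsto_const_nhds⟩

/-- The space `D([0,T])` of càdlàg functions on `[0,T]` with values in `E`. -/
def Skorokhod (T : ℝ) (E : Type*) [TopologicalSpace E] : Type _ :=
  {x : Icc (0 : ℝ) T → E // IsCadlag x}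

namespace Skorokhod

variable {T : ℝ} {E : Type*} [PseudoEMetricSpace E]

/-- Cost of a time change `r` (an increasing bijection of `[0,T]`) for comparing `x` and `y`:
`max (sup_t |r t - t|) (sup_t d(x (r t), y t))`. -/
noncomputable def cost (x y : Skorokhod T E) (r : Icc (0 : ℝ) T ≃o Icc (0 : ℝ) T) : ℝ≥0∞ :=
  max (⨆ t, edist (r t) t) (⨆ t, edist (x.1 (r t)) (y.1 t))

theorem cost_refl (x : Skorokhod T E) : cost x x (OrderIso.refl _) = 0 := by
  simp [cost]

theorem cost_symm (x y : Skorokhod T E) (r : Icc (0 : ℝ) T ≃o Icc (0 : ℝ) T) :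
    cost y x r.symm = cost x y r := by
  unfold cost
  congr 1
  · rw [← r.toEquiv.iSup_comp]
    simp [edist_comm]
  · rw [← r.toEquiv.iSup_comp]
    simp [edist_comm]

theorem cost_trans (x y z : Skorokhod T E) (r s : Icc (0 : ℝ) T ≃o Icc (0 : ℝ) T) :
    cost x z (s.trans r) ≤ cost x y r + cost y z s := by
  refine max_le (iSup_le fun t => ?_) (iSup_le fun t => ?_)
  · refine (edist_triangle _ (s t) _).trans (add_le_add ?_ ?_)
    · exact (le_iSup (fun t => edist (r t) t) (s t)).trans (le_max_left _ _)
    · exact (le_iSup (fun t => edist (s t) t) t).trans (le_max_left _ _)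
  · refine (edist_triangle _ (y.1 (s t)) _).trans (add_le_add ?_ ?_)
    · exact (le_iSup (fun t => edist (x.1 (r t)) (y.1 t)) (s t)).trans (le_max_right _ _)
    · exact (le_iSup (fun t => edist (y.1 (s t)) (z.1 t)) t).trans (le_max_right _ _)

/-- The Skorokhod (J1) distance `inf_r max (sup_t |r t - t|) (sup_t d(x (r t), y t))`, the infimum
being over the increasing bijections `r` of `[0,T]`. Its topology is the Skorokhod topology. -/
noncomputable instance : PseudoEMetricSpace (Skorokhod T E) where
  edist x y := ⨅ r, cost x y r
  edist_self x := le_antisymm ((iInf_le _ (OrderIso.refl _)).trans (cost_refl x).le) bot_le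
  edist_comm x y := by
    refine le_antisymm (le_iInf fun r => ?_) (le_iInf fun r => ?_)
    · exact (iInf_le _ r.symm).trans (cost_symm y x r).le
    · exact (iInf_le _ r.symm).trans (cost_symm x y r).le
  edist_triangle x y z :=
    ENNReal.le_iInf_add_iInf fun r s => (iInf_le _ (s.trans r)).trans (cost_trans x y z r s)

/-- `D([0,T])` carries the Borel `σ`-algebra of the Skorokhod topology. -/
noncomputable instance : MeasurableSpace (Skorokhod T E) := borel _

instance : BorelSpace (Skorokhod T E) := ⟨rfl⟩

open Classical in
/-- The restriction to `[0,T]` of a path `x`, as an element of `D([0,T])`; the default value (a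
constant path) is used if the restriction is not càdlàg. -/
noncomputable def ofPath (T : ℝ) {E : Type*} [PseudoEMetricSpace E] [Zero E] (x : ℝ → E) :
    Skorokhod T E :=
  if h : IsCadlag (fun t : Icc (0 : ℝ) T => x t) then ⟨_, h⟩ else ⟨fun _ => 0, isCadlag_const 0⟩

end Skorokhod

/-! ## The coefficients of the jump-Belavkin equation of a qubit -/

/-- Operators on the qubit space `ℂ²`, with the operator norm. -/
abbrev QMat : Type := Matrix (Fin 2) (Fin 2) ℂ

/-- States: positive operators of trace one. -/
def IsState (ρ : QMat) : Prop := ρ.PosSemidef ∧ ρ.trace = 1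

/-- `𝒥(ρ) = C ρ C*`. -/
def jumpOp (C ρ : QMat) : QMat := C * ρ * Cᴴ

/-- The Lindbladian `L(ρ) = -i[H,ρ] - ½{C*C,ρ} + CρC*`. -/
noncomputable def lindblad (H C ρ : QMat) : QMat :=
  -(Complex.I • (H * ρ - ρ * H)) - (1 / 2 : ℂ) • (Cᴴ * C * ρ + ρ * (Cᴴ * C)) + C * ρ * Cᴴ

/-- The drift `f(ρ) = L(ρ) + Tr[𝒥(ρ)]ρ - 𝒥(ρ)`. -/
noncomputable def belavkinDrift (H C ρ : QMat) : QMat :=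
  lindblad H C ρ + (jumpOp C ρ).trace • ρ - jumpOp C ρ

/-- The jump `𝒥(ρ)/Tr[𝒥(ρ)] - ρ`. -/
noncomputable def belavkinJump (C ρ : QMat) : QMat :=
  ((jumpOp C ρ).trace)⁻¹ • jumpOp C ρ - ρ

/-- A globally Lipschitz function on all matrices, equal to the drift `f` on states (such as `f`
composed with a truncation of the entries). -/
def IsLipschitzDrift (H C : QMat) (F : QMat → QMat) : Prop :=
  (∃ c : ℝ≥0, LipschitzWith c F) ∧ ∀ ρ, IsState ρ → F ρ = belavkinDrift H C ρ

/-- A globally Lipschitz function on all matrices, equal to the jump `𝒥(ρ)/Tr[𝒥(ρ)] - ρ` on those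
states with `Tr[𝒥(ρ)] > 0`. -/
def IsLipschitzJump (C : QMat) (q : QMat → QMat) : Prop :=
  (∃ c : ℝ≥0, LipschitzWith c q) ∧
    ∀ ρ, IsState ρ → 0 < (jumpOp C ρ).trace.re → q ρ = belavkinJump C ρ

/-! ## Poisson random measures and the jump-Belavkin equation -/

/-- `N` is a Poisson random measure on `ℝ₊ × ℝ` with intensity `dt ⊗ dx`, relative to the
filtration `𝓕`. The random measure is defined on `ℝ × ℝ` (time is the first coordinate), but only
its restriction to nonnegative times matters. -/
structure IsPoissonRandomMeasure {Ω : Type*} [mΩ : MeasurableSpace Ω] (P : Measure Ω)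
    (𝓕 : Filtration ℝ≥0 mΩ) (N : Ω → Measure (ℝ × ℝ)) : Prop where
  /-- each `N(A)` is a random variable -/
  measurable : ∀ A, MeasurableSet A → Measurable fun ω => N ω A
  /-- `N` is integer valued -/
  integer_valued : ∀ᵐ ω ∂P, ∀ A, MeasurableSet A → A ⊆ Ici 0 ×ˢ univ →
    N ω A = ∞ ∨ ∃ k : ℕ, N ω A = k
  /-- there is at most one point at each time -/
  simple : ∀ᵐ ω ∂P, ∀ t : ℝ, 0 ≤ t → N ω ({t} ×ˢ univ) ≤ 1
  /-- `N(A)` has the Poisson law with parameter `(dt ⊗ dx)(A)` -/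
  law : ∀ A, MeasurableSet A → A ⊆ Ici 0 ×ˢ univ → volume A < ∞ →
    P.map (fun ω => N ω A) = (poissonMeasure (volume A).toNNReal).map (fun k : ℕ => (k : ℝ≥0∞))
  /-- `N` is adapted -/
  adapted : ∀ (t : ℝ≥0) (A), MeasurableSet A → A ⊆ Icc 0 (t : ℝ) ×ˢ univ →
    Measurable[𝓕 t] fun ω => N ω A
  /-- after time `t`, the masses of disjoint sets are mutually independent -/
  indep : ∀ (t : ℝ≥0) (l : ℕ) (A : Fin l → Set (ℝ × ℝ)), (∀ i, MeasurableSet (A i)) →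
    (∀ i, A i ⊆ Ioi (t : ℝ) ×ˢ univ) → (∀ i, volume (A i) < ∞) →
    Pairwise (fun i j => Disjoint (A i) (A j)) → iIndepFun (fun i ω => N ω (A i)) P
  /-- after time `t`, the masses of disjoint sets are jointly independent of `𝓕 t` -/
  indep_past : ∀ (t : ℝ≥0) (l : ℕ) (A : Fin l → Set (ℝ × ℝ)), (∀ i, MeasurableSet (A i)) →
    (∀ i, A i ⊆ Ioi (t : ℝ) ×ˢ univ) → (∀ i, volume (A i) < ∞) →
    Pairwise (fun i j => Disjoint (A i) (A j)) →
    Indep (MeasurableSpace.comap (fun ω i => N ω (A i)) inferInstance) (𝓕 t) P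

/-- `m` is a solution of the jump-Belavkin equation driven by `N`, started from `ρ₀`: an adapted
càdlàg process such that almost surely, for all `t ≥ 0`,
`m_t = ρ₀ + ∫_0^t f(m_{s-}) ds
    + ∫_0^t ∫_{[0,K]} (𝒥(m_{s-})/Tr[𝒥(m_{s-})] - m_{s-}) 1_{0 ≤ x ≤ Tr[𝒥(m_{s-})]} N(ds,dx)`.
The values of `m` at negative times are irrelevant. -/
structure IsJumpBelavkinSolution {Ω : Type*} [mΩ : MeasurableSpace Ω] (P : Measure Ω)
    (𝓕 : Filtration ℝ≥0 mΩ) (N : Ω → Measure (ℝ × ℝ)) (H C : QMat) (K : ℝ) (ρ₀ : QMat)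
    (m : ℝ → Ω → QMat) : Prop where
  adapted : StronglyAdapted 𝓕 fun (t : ℝ≥0) ω => m t ω
  cadlag : ∀ ω, IsCadlag fun t : ℝ≥0 => m t ω
  equation : ∀ᵐ ω ∂P, ∀ t : ℝ, 0 ≤ t → m t ω = ρ₀
    + (∫ s in 0..t, belavkinDrift H C (Function.leftLim (fun r => m r ω) s))
    + ∫ z in Ioc 0 t ×ˢ Icc 0 K,
        (Icc 0 (jumpOp C (Function.leftLim (fun r => m r ω) z.1)).trace.re).indicator
          (fun _ => belavkinJump C (Function.leftLim (fun r => m r ω) z.1)) z.2 ∂(N ω)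

/-! ## The Euler scheme -/

/-- One (possibly partial) step of the scheme over the time interval `(a,t]` with the coefficients
frozen at `θ`:
`θ + ∫_a^t F(θ) ds + ∫_{(a,t]} ∫_{[0,K]} q(θ) 1_{0 ≤ x ≤ Re Tr[𝒥(θ)]} N(ds,dx)`. -/
noncomputable def eulerStep (C : QMat) (F q : QMat → QMat) (K : ℝ) (N : Measure (ℝ × ℝ))
    (a t : ℝ) (θ : QMat) : QMat :=
  θ + (∫ _s in a..t, F θ)
    + ∫ z in Ioc a t ×ˢ Icc 0 K,
        (Icc 0 (jumpOp C θ).trace.re).indicator (fun _ => q θ) z.2 ∂N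

/-- The Euler scheme `θ_k` with time step `1/n`, started from `ρ₀`. -/
noncomputable def eulerScheme (C : QMat) (F q : QMat → QMat) (K : ℝ) (ρ₀ : QMat)
    (N : Measure (ℝ × ℝ)) (n : ℕ) : ℕ → QMat
  | 0 => ρ₀
  | k + 1 => eulerStep C F q K N ((k : ℝ) / n) (((k + 1 : ℕ) : ℝ) / n)
      (eulerScheme C F q K ρ₀ N n k)

/-- The interpolated Euler scheme: for `t ≥ 0`, with `k = ⌊nt⌋` the largest integer such that
`k/n ≤ t`, a partial step from `θ_k` over `(k/n,t]`. -/
noncomputable def eulerPath (C : QMat) (F q : QMat → QMat) (K : ℝ) (ρ₀ : QMat)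
    (N : Measure (ℝ × ℝ)) (n : ℕ) (t : ℝ) : QMat :=
  eulerStep C F q K N ((⌊(n : ℝ) * t⌋₊ : ℝ) / n) t (eulerScheme C F q K ρ₀ N n ⌊(n : ℝ) * t⌋₊)

/-! ## States and the coefficients of the equation -/

/-! The rate 1/n comes from an L¹ estimate on one step (a,b] of length h. Let e be the error at time
a and M the number of points of N in the step. The drift contributes O(h(e + h + M)). At a point of
N the scheme jumps by q(θ), the solution by q(μ_{s-}), and both are compared with μ_a. The
acceptance indicator is discontinuous in the state, but two indicators whose rates differ by r
disagree only for marks in a band of width O(r), so in the mean it behaves like a Lipschitz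
function. If the point is alone in the step, μ_{s-} differs from μ_a only by the drift, hence by
O(h): the jumps differ by O(e + h), plus a constant when the mark falls in a band of half-width O(e
+ h) around the rate at μ_a. If it is not alone, a constant is paid for each point; these costs
total O(M(M-1)), with mean O(h²). This is `IsSolutionPath.norm_eulerStep_sub_le`.

The band is known at time a and N on (a,b] is independent of the past, so the mean number of marks
in it is O(h(E e + h)) (`lintegral_band_le`). Hence the mean error grows by at most c h(E e + h) per
step (`exists_stepError_bound`), and iteration gives O(h). No martingale part is split off, so no
square root is lost. The bound of a step is a nonnegative increment valid at all times of the step,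
so its partial sums dominate the running supremum and no maximal inequality is needed
(`exists_error_bound`).

Since F and q agree with the true coefficients on states only, the solution must be shown to stay
among states. A jump leads to the state 𝒥(ρ)/Tr 𝒥(ρ). Between jumps the solution is the
normalisation of a linear flow W ↦ U W U*, which preserves positivity
(`isState_of_hasDerivWithinAt`). An induction along the real line joins the two facts
(`IsSolutionPath.isState`).

The Skorokhod distance is at most the uniform one, so the L¹ bound gives convergence in probability
and hence in distribution. What remains is measurability of the path-valued maps for the Borel
σ-algebra, obtained by approximating a càdlàg path in the Skorokhod topology by step paths with
finitely many sampled values (`Skorokhod.tendsto_stepPath`). -/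

theorem contDiff_matrix_trace {n : WithTop ℕ∞} : ContDiff ℝ n fun X : QMat => X.trace :=
  (LinearMap.toContinuousLinearMap (Matrix.traceLinearMap (Fin 2) ℝ ℂ)).contDiff

theorem contDiff_jumpOp (C : QMat) {n : WithTop ℕ∞} : ContDiff ℝ n (jumpOp C) := by
  unfold jumpOp; fun_prop

theorem contDiff_trace_jumpOp (C : QMat) {n : WithTop ℕ∞} :
    ContDiff ℝ n fun X => (jumpOp C X).trace :=
  contDiff_matrix_trace.comp (contDiff_jumpOp C)

theorem contDiff_belavkinDrift (H C : QMat) {n : WithTop ℕ∞} :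
    ContDiff ℝ n (belavkinDrift H C) := by
  have h1 := contDiff_jumpOp C (n := n)
  have h2 := contDiff_trace_jumpOp C (n := n)
  unfold belavkinDrift lindblad
  fun_prop

theorem continuous_belavkinDrift (H C : QMat) : Continuous (belavkinDrift H C) :=
  (contDiff_belavkinDrift H C (n := 0)).continuous

/-- The rate of jumps. -/
noncomputable def jumpRate (C ρ : QMat) : ℝ := (jumpOp C ρ).trace.re

theorem continuous_jumpRate (C : QMat) : Continuous (jumpRate C) :=
  Complex.continuous_re.comp (contDiff_trace_jumpOp C (n := 0)).continuous

theorem exists_lipschitz_jumpRate (C : QMat) : ∃ c : ℝ≥0, LipschitzWith c (jumpRate C) := by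
  let l : QMat →ₗ[ℝ] ℝ :=
    { toFun := jumpRate C
      map_add' := fun x y => by
        simp [jumpRate, jumpOp, mul_add, add_mul, Matrix.trace_add]
      map_smul' := fun c x => by
        simp [jumpRate, jumpOp, Matrix.trace_smul] }
  exact ⟨_, (LinearMap.toContinuousLinearMap l).lipschitz⟩

theorem convex_setOf_isState : Convex ℝ {ρ : QMat | IsState ρ} := by
  rintro x ⟨hx, hx'⟩ y ⟨hy, hy'⟩ a b ha hb hab
  refine ⟨(hx.smul ha).add (hy.smul hb), ?_⟩
  rw [Matrix.trace_add, Matrix.trace_smul, Matrix.trace_smul, hx', hy', ← add_smul, hab, one_smul]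

theorem isClosed_setOf_isState : IsClosed {ρ : QMat | IsState ρ} := by
  have h : {ρ : QMat | IsState ρ} = {ρ : QMat | ρᴴ = ρ} ∩
      (⋂ x : Fin 2 → ℂ, {ρ : QMat | 0 ≤ star x ⬝ᵥ ρ *ᵥ x}) ∩ {ρ : QMat | ρ.trace = 1} := by
    ext ρ
    simp [IsState, Matrix.posSemidef_iff_dotProduct_mulVec, Matrix.IsHermitian]
  rw [h]
  refine ((isClosed_eq (by fun_prop) continuous_id).inter (isClosed_iInter fun x => ?_)).inter
    (isClosed_eq (contDiff_matrix_trace (n := 0)).continuous continuous_const)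
  exact isClosed_le continuous_const (by fun_prop)

/-- The diagonal entries are nonnegative with sum one, and nonnegativity of the determinant bounds
|ρ₀₁|² by their product. This gives the boundedness behind compactness of the set of states. -/
theorem IsState.norm_apply_le {ρ : QMat} (h : IsState ρ) (i j : Fin 2) : ‖ρ i j‖ ≤ 1 := by
  obtain ⟨hp, ht⟩ := h
  have h0 := Complex.nonneg_iff.1 (hp.diag_nonneg (i := 0))
  have h1 := Complex.nonneg_iff.1 (hp.diag_nonneg (i := 1))
  have hd := Complex.nonneg_iff.1 hp.det_nonneg
  have hs : ρ 1 0 = star (ρ 0 1) := (hp.1.apply 1 0).symm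
  rw [Matrix.trace_fin_two] at ht
  have ht' := congrArg Complex.re ht
  simp only [Complex.add_re, Complex.one_re] at ht'
  rw [Matrix.det_fin_two, hs] at hd
  have hn : ‖ρ 1 0‖ = ‖ρ 0 1‖ := by rw [hs, norm_star]
  have hd' := hd.1
  simp only [Complex.sub_re, Complex.mul_re, Complex.star_def, Complex.conj_re,
    Complex.conj_im, ← h0.2, ← h1.2] at hd'
  have hsq : ‖ρ 0 1‖ ^ 2 = (ρ 0 1).re ^ 2 + (ρ 0 1).im ^ 2 := by
    rw [Complex.sq_norm, Complex.normSq_apply]; ring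
  have e0 : ‖ρ 0 0‖ = (ρ 0 0).re := by
    simpa using congrArg Complex.re (Complex.norm_of_nonneg' (hp.diag_nonneg (i := 0)))
  have e1 : ‖ρ 1 1‖ = (ρ 1 1).re := by
    simpa using congrArg Complex.re (Complex.norm_of_nonneg' (hp.diag_nonneg (i := 1)))
  have hoff : ‖ρ 0 1‖ ≤ 1 := by
    have : 0 ≤ ‖ρ 0 1‖ := norm_nonneg _
    nlinarith [h0.1, h1.1]
  fin_cases i <;> fin_cases j <;> simp only [Fin.zero_eta, Fin.mk_one]
  · rw [e0]; linarith [h1.1]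
  · exact hoff
  · rw [hn]; exact hoff
  · rw [e1]; linarith [h0.1]

theorem isCompact_setOf_isState : IsCompact {ρ : QMat | IsState ρ} := by
  have hc : IsCompact (Set.pi univ fun _ : Fin 2 => Set.pi univ fun _ : Fin 2 =>
      Metric.closedBall (0 : ℂ) 1) :=
    isCompact_univ_pi fun _ => isCompact_univ_pi fun _ => isCompact_closedBall _ _
  refine IsCompact.of_isClosed_subset (X := QMat) hc isClosed_setOf_isState fun ρ hρ => ?_
  exact fun i _ j _ => mem_closedBall_zero_iff.2 (hρ.norm_apply_le i j)

theorem IsState.posSemidef_jumpOp {ρ : QMat} (h : IsState ρ) (C : QMat) :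
    (jumpOp C ρ).PosSemidef :=
  h.1.mul_mul_conjTranspose_same C

theorem IsState.trace_jumpOp {ρ : QMat} (h : IsState ρ) (C : QMat) :
    (jumpOp C ρ).trace = (jumpRate C ρ : ℂ) := by
  have := Complex.nonneg_iff.1 (h.posSemidef_jumpOp C).trace_nonneg
  apply Complex.ext <;> simp [jumpRate, ← this.2]

theorem IsState.jumpRate_nonneg {ρ : QMat} (h : IsState ρ) (C : QMat) : 0 ≤ jumpRate C ρ :=
  (Complex.nonneg_iff.1 (h.posSemidef_jumpOp C).trace_nonneg).1

/-- The state after a jump is a state. -/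
theorem IsState.add_belavkinJump {ρ : QMat} (h : IsState ρ) {C : QMat} (hC : 0 < jumpRate C ρ) :
    IsState (ρ + belavkinJump C ρ) := by
  have he : ρ + belavkinJump C ρ = ((jumpRate C ρ)⁻¹ : ℝ) • jumpOp C ρ := by
    rw [belavkinJump, h.trace_jumpOp C, add_sub_cancel, ← Complex.ofReal_inv]
    rfl
  rw [he]
  refine ⟨(h.posSemidef_jumpOp C).smul (inv_nonneg.2 hC.le), ?_⟩
  rw [Matrix.trace_smul, h.trace_jumpOp C, Complex.real_smul, ← Complex.ofReal_mul,
    inv_mul_cancel₀ hC.ne', Complex.ofReal_one]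

/-! ### Lipschitz extensions of the drift and of the jump -/

theorem exists_isLipschitzDrift (H C : QMat) : ∃ F, IsLipschitzDrift H C F := by
  obtain ⟨c, hc⟩ := LocallyLipschitzOn.exists_lipschitzOnWith_of_compact isCompact_setOf_isState
    ((contDiff_belavkinDrift H C (n := 1)).contDiffOn.locallyLipschitzOn convex_setOf_isState)
  obtain ⟨g, hg, hgs⟩ := hc.extend_finite_dimension
  exact ⟨g, ⟨_, hg⟩, fun ρ hρ => (hgs hρ).symm⟩

theorem Matrix.exists_eq_vecMulVec_of_det_eq_zero {C : QMat} (h : C.det = 0) :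
    ∃ a b : Fin 2 → ℂ, C = Matrix.vecMulVec a b := by
  rw [Matrix.det_fin_two] at h
  by_cases h0 : C 0 0 = 0
  · rw [h0, zero_mul, zero_sub, neg_eq_zero, mul_eq_zero] at h
    rcases h with h | h
    · refine ⟨![0, 1], ![C 1 0, C 1 1], ?_⟩
      ext i j; fin_cases i <;> fin_cases j <;> simp [Matrix.vecMulVec_apply, h0, h]
    · refine ⟨![C 0 1, C 1 1], ![0, 1], ?_⟩
      ext i j; fin_cases i <;> fin_cases j <;> simp [Matrix.vecMulVec_apply, h0, h]
  · refine ⟨![C 0 0, C 1 0], ![1, C 0 1 / C 0 0], ?_⟩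
    ext i j; fin_cases i <;> fin_cases j <;> simp [Matrix.vecMulVec_apply]
    · field_simp
    · field_simp
      linear_combination h

/-- A singular C is a dyad a bᵀ, so every C τ C* is a multiple of a a*. The normalised post-jump
state therefore does not depend on the state before the jump. -/
theorem trace_jumpOp_smul_jumpOp_comm {C : QMat} (h : C.det = 0) (ρ σ : QMat) :
    (jumpOp C ρ).trace • jumpOp C σ = (jumpOp C σ).trace • jumpOp C ρ := by
  obtain ⟨a, b, rfl⟩ := Matrix.exists_eq_vecMulVec_of_det_eq_zero h
  have key : ∀ τ : QMat, jumpOp (Matrix.vecMulVec a b) τ =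
      ((b ᵥ* τ) ⬝ᵥ star b) • Matrix.vecMulVec a (star a) := fun τ => by
    rw [jumpOp, Matrix.conjTranspose_vecMulVec, Matrix.vecMulVec_mul, Matrix.vecMulVec_mul_vecMulVec]
    rw [Matrix.vecMulVec_smul]
  rw [key, key, Matrix.trace_smul, Matrix.trace_smul, smul_smul, smul_smul]
  congr 1
  simp only [smul_eq_mul]
  ring

/-- The quotient 𝒥(ρ)/Tr 𝒥(ρ) could only be irregular where the trace vanishes. If C is singular,
the quotient is constant wherever it is defined. If C is invertible, the trace has no zero on the
compact convex set of states, and the quotient is C¹ there. -/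
theorem exists_isLipschitzJump (C : QMat) : ∃ q, IsLipschitzJump C q := by
  by_cases hdet : C.det = 0
  · by_cases hs : ∃ σ, IsState σ ∧ 0 < jumpRate C σ
    · obtain ⟨σ, hσ, hσp⟩ := hs
      refine ⟨fun ρ => ((jumpOp C σ).trace)⁻¹ • jumpOp C σ - ρ,
        ⟨0 + 1, (LipschitzWith.const _).sub LipschitzWith.id⟩, fun ρ hρ hρp => ?_⟩
      have h1 := trace_jumpOp_smul_jumpOp_comm hdet ρ σ
      have hσ0 : (jumpOp C σ).trace ≠ 0 := by
        rw [hσ.trace_jumpOp]; exact_mod_cast hσp.ne'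
      have hρ0 : (jumpOp C ρ).trace ≠ 0 := by
        rw [hρ.trace_jumpOp]; exact_mod_cast (show 0 < jumpRate C ρ from hρp).ne'
      rw [belavkinJump]
      refine congrArg (· - ρ) ?_
      rw [inv_smul_eq_iff₀ hσ0, smul_comm, ← h1, inv_smul_smul₀ hρ0]
    -- No state has a positive jump rate, so any Lipschitz function will do.
    · exact ⟨fun _ => 0, ⟨0, LipschitzWith.const _⟩, fun ρ hρ hp => (hs ⟨ρ, hρ, hp⟩).elim⟩
  · have hpos : ∀ ρ, IsState ρ → (jumpOp C ρ).trace ≠ 0 := fun ρ hρ h0 => by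
      rw [(hρ.posSemidef_jumpOp C).trace_eq_zero_iff] at h0
      have hu : IsUnit C := (Matrix.isUnit_iff_isUnit_det C).2 (isUnit_iff_ne_zero.2 hdet)
      have hu' : IsUnit Cᴴ := hu.star
      rw [jumpOp, hu'.mul_left_eq_zero, hu.mul_right_eq_zero] at h0
      have := hρ.2
      rw [h0] at this
      simp at this
    have hd : ContDiffOn ℝ 1 (belavkinJump C) {ρ | IsState ρ} := by
      unfold belavkinJump
      have h1 : ContDiffOn ℝ 1 (fun ρ => (jumpOp C ρ).trace⁻¹) {ρ | IsState ρ} :=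
        (contDiff_trace_jumpOp C).contDiffOn.inv hpos
      exact (h1.smul (contDiff_jumpOp C).contDiffOn).sub contDiffOn_id
    obtain ⟨c, hc⟩ := LocallyLipschitzOn.exists_lipschitzOnWith_of_compact isCompact_setOf_isState
      (hd.locallyLipschitzOn convex_setOf_isState)
    obtain ⟨g, hg, hgs⟩ := hc.extend_finite_dimension
    exact ⟨g, ⟨_, hg⟩, fun ρ hρ _ => (hgs hρ).symm⟩

/-! ## The flow between jumps preserves states -/

/-- The non-Hermitian generator of the evolution between jumps. -/
noncomputable def effectiveGenerator (H C : QMat) : QMat :=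
  -(Complex.I • H) - (1 / 2 : ℂ) • (Cᴴ * C)

theorem conjTranspose_effectiveGenerator {H : QMat} (hH : H.IsHermitian) (C : QMat) :
    (effectiveGenerator H C)ᴴ = Complex.I • H - (1 / 2 : ℂ) • (Cᴴ * C) := by
  rw [effectiveGenerator, Matrix.conjTranspose_sub, Matrix.conjTranspose_neg,
    Matrix.conjTranspose_smul, Matrix.conjTranspose_smul, hH.eq, Matrix.conjTranspose_mul,
    Matrix.conjTranspose_conjTranspose]
  simp

/-- The two terms CρC* cancel. What is left is a linear part generating a positivity-preserving
flow, and a scalar multiple of ρ which only renormalises. -/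
theorem belavkinDrift_eq {H : QMat} (hH : H.IsHermitian) (C ρ : QMat) :
    belavkinDrift H C ρ = effectiveGenerator H C * ρ + ρ * (effectiveGenerator H C)ᴴ
      + (jumpOp C ρ).trace • ρ := by
  rw [conjTranspose_effectiveGenerator hH, belavkinDrift, lindblad, effectiveGenerator]
  set τ := (jumpOp C ρ).trace
  simp only [jumpOp, sub_mul, mul_sub, neg_mul, smul_mul_assoc, mul_smul_comm, smul_sub, smul_add]
  abel

theorem trace_effectiveGenerator {H : QMat} (hH : H.IsHermitian) (C ρ : QMat) :
    (effectiveGenerator H C * ρ + ρ * (effectiveGenerator H C)ᴴ).trace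
      = -(jumpOp C ρ).trace := by
  rw [Matrix.trace_add, Matrix.trace_mul_comm ρ, ← Matrix.trace_add, ← add_mul,
    conjTranspose_effectiveGenerator hH, effectiveGenerator, jumpOp, Matrix.trace_mul_comm (C * ρ),
    ← Matrix.mul_assoc, ← Matrix.trace_neg, ← neg_mul]
  congr 2
  have : (1 / 2 : ℂ) • (Cᴴ * C) + (1 / 2 : ℂ) • (Cᴴ * C) = Cᴴ * C := by
    rw [← add_smul]; norm_num
  conv_rhs => rw [← this]
  abel

/-- The conjugated flow W started from x(a) is positive semidefinite, and W/Tr W solves the same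
nonlinear equation. Identifying x with it by Grönwall gives positivity and trace one together, with
no prior knowledge of the trace of x. -/
theorem isState_of_hasDerivWithinAt {H : QMat} (hH : H.IsHermitian) (C : QMat) {x : ℝ → QMat}
    {a b : ℝ} (hx : ContinuousOn x (Icc a b))
    (hd : ∀ t ∈ Ico a b, HasDerivWithinAt x (belavkinDrift H C (x t)) (Ici t) t)
    (ha : IsState (x a)) : ∀ t ∈ Icc a b, IsState (x t) := by
  set A := effectiveGenerator H C with hA
  let U : ℝ → QMat := fun t => NormedSpace.exp ((t - a) • A)
  let V : ℝ → QMat := fun t => NormedSpace.exp ((t - a) • Aᴴ)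
  have hU : ∀ t, HasDerivAt U (A * U t) t := fun t =>
    (hasDerivAt_exp_smul_const' (𝕂 := ℝ) A (t - a)).comp_sub_const t a
  have hV : ∀ t, HasDerivAt V (V t * Aᴴ) t := fun t =>
    (hasDerivAt_exp_smul_const (𝕂 := ℝ) Aᴴ (t - a)).comp_sub_const t a
  have hVU : ∀ t, V t = (U t)ᴴ := fun t => by
    simp only [U, V]
    rw [← Matrix.exp_conjTranspose, Matrix.conjTranspose_smul, star_trivial]
  let W : ℝ → QMat := fun t => U t * x a * V t
  have hW : ∀ t, HasDerivAt W (A * W t + W t * Aᴴ) t := fun t => by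
    have := ((hU t).mul_const (x a)).mul (hV t)
    refine this.congr_deriv ?_
    simp only [W, Matrix.mul_assoc]
  have hWp : ∀ t, (W t).PosSemidef := fun t => by
    simp only [W, hVU]
    exact ha.1.mul_mul_conjTranspose_same _
  let T : QMat →L[ℝ] ℂ := LinearMap.toContinuousLinearMap (Matrix.traceLinearMap (Fin 2) ℝ ℂ)
  have hT : ∀ X, T X = X.trace := fun X => rfl
  have hw : ∀ t, HasDerivAt (fun t => (W t).trace) (-(jumpOp C (W t)).trace) t := fun t => by
    have := T.hasFDerivAt.comp_hasDerivAt t (hW t)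
    rwa [hT, hA, trace_effectiveGenerator hH] at this
  -- Working with Tr(W) x - W rather than x - W/Tr W avoids dividing by a trace not yet known to be
  -- nonzero, and makes the equation for D linear and homogeneous.
  let D : ℝ → QMat := fun t => (W t).trace • x t - W t
  let D' : ℝ → QMat := fun t => A * D t + D t * Aᴴ + (jumpOp C (D t)).trace • x t
  have hD : ∀ t ∈ Ico a b, HasDerivWithinAt D (D' t) (Ici t) t := fun t ht => by
    have := ((hw t).hasDerivWithinAt.smul (hd t ht)).sub (hW t).hasDerivWithinAt
    refine this.congr_deriv ?_
    simp only [D', D, belavkinDrift_eq hH, ← hA]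
    have hJ : jumpOp C ((W t).trace • x t - W t) = (W t).trace • jumpOp C (x t) - jumpOp C (W t) := by
      simp [jumpOp, mul_sub, sub_mul]
    rw [hJ, Matrix.trace_sub, Matrix.trace_smul]
    simp only [smul_add, sub_mul, mul_sub, smul_mul_assoc, mul_smul_comm, sub_smul, neg_smul,
      smul_eq_mul, mul_smul]
    abel
  have hWc : Continuous W := continuous_iff_continuousAt.2 fun t => (hW t).continuousAt
  have hDc : ContinuousOn D (Icc a b) :=
    (((contDiff_matrix_trace (n := 0)).continuous.comp hWc).continuousOn.smul hx).sub
      hWc.continuousOn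
  obtain ⟨M, hM⟩ := (isCompact_Icc.image_of_continuousOn hx).isBounded.exists_norm_le
  let TJ : QMat →L[ℝ] ℂ := LinearMap.toContinuousLinearMap
    ((Matrix.traceLinearMap (Fin 2) ℝ ℂ) ∘ₗ
      (LinearMap.mulRight ℝ Cᴴ) ∘ₗ (LinearMap.mulLeft ℝ C))
  have hTJ : ∀ X, TJ X = (jumpOp C X).trace := fun X => rfl
  -- Grönwall: D vanishes at a because x(a) has trace one, and |D'| is at most a constant times |D|
  -- because x is bounded on the compact interval.
  have h0 := eq_zero_of_abs_deriv_le_mul_abs_self_of_eq_zero_right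
    (K := ‖A‖ + ‖Aᴴ‖ + ‖TJ‖ * M) hDc hD
    (by simp [D, W, U, V, ha.2]) (fun t ht => by
      have h1 : ‖(jumpOp C (D t)).trace • x t‖ ≤ (‖TJ‖ * ‖D t‖) * M := by
        rw [norm_smul, ← hTJ]
        exact mul_le_mul (TJ.le_opNorm _) (hM _ ⟨t, Ico_subset_Icc_self ht, rfl⟩)
          (norm_nonneg _) (by positivity)
      calc ‖D' t‖ ≤ ‖A * D t‖ + ‖D t * Aᴴ‖ + ‖(jumpOp C (D t)).trace • x t‖ := norm_add₃_le
        _ ≤ ‖A‖ * ‖D t‖ + ‖D t‖ * ‖Aᴴ‖ + (‖TJ‖ * ‖D t‖) * M := by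
          gcongr <;> exact norm_mul_le _ _
        _ = _ := by ring)
  intro t ht
  have hDt : (W t).trace • x t = W t := sub_eq_zero.1 (h0 t ht)
  -- A positive semidefinite matrix of trace zero is zero; since both exponentials are invertible,
  -- this would force x(a) = 0.
  have hW0 : (W t).trace ≠ 0 := fun h => by
    rw [(hWp t).trace_eq_zero_iff] at h
    have hUu : IsUnit (U t) := Matrix.isUnit_exp _
    have hVu : IsUnit (V t) := Matrix.isUnit_exp _
    simp only [W] at h
    rw [hVu.mul_left_eq_zero, hUu.mul_right_eq_zero] at h
    have := ha.2
    rw [h] at this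
    simp at this
  have hnn := Complex.nonneg_iff.1 (hWp t).trace_nonneg
  have hxt : x t = ((W t).trace.re)⁻¹ • W t := by
    have hre : (W t).trace = ((W t).trace.re : ℂ) := by
      apply Complex.ext <;> simp [← hnn.2]
    have h2 : ((W t).trace.re)⁻¹ • W t = ((W t).trace)⁻¹ • W t := by
      conv_rhs => rw [hre, ← Complex.ofReal_inv]
      rfl
    rw [h2, eq_inv_smul_iff₀ hW0, hDt]
  refine ⟨?_, ?_⟩
  · rw [hxt]
    exact (hWp t).smul (inv_nonneg.2 hnn.1)
  · have := congrArg Matrix.trace hDt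
    rw [Matrix.trace_smul, smul_eq_mul] at this
    exact mul_left_cancel₀ hW0 (this.trans (mul_one _).symm)

/-! ## Integer-valued measures and Poisson random measures -/

/-- Atoms have mass one, and finite total mass leaves finitely many. A point which is not an atom
has a neighbourhood of mass less than one, hence of mass zero by integrality; second countability
then makes the complement of the atoms null. -/
theorem exists_eq_sum_dirac_of_integer_valued {α : Type*} [TopologicalSpace α]
    [SecondCountableTopology α] [T1Space α] [MeasurableSpace α]
    [BorelSpace α] {μ : Measure α} [IsFiniteMeasure μ]
    (hint : ∀ A, MeasurableSet A → ∃ k : ℕ, μ A = k) (hone : ∀ a, μ {a} ≤ 1) :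
    ∃ S : Finset α, μ = ∑ z ∈ S, Measure.dirac z := by
  have hsing : ∀ a, μ {a} ≠ 0 → μ {a} = 1 := fun a ha => by
    obtain ⟨k, hk⟩ := hint {a} (measurableSet_singleton a)
    have h1 := hone a
    rw [hk] at ha h1 ⊢
    have h2 : k ≤ 1 := by exact_mod_cast h1
    have h3 : k ≠ 0 := by exact_mod_cast ha
    have : k = 1 := by omega
    simp [this]
  have hfin : {a | μ {a} ≠ 0}.Finite := by
    by_contra hinf
    obtain ⟨k, hk⟩ := hint univ MeasurableSet.univ
    obtain ⟨F, hF, hcard⟩ := Set.Infinite.exists_subset_card_eq hinf (k + 1)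
    have h1 : μ F = (k + 1 : ℕ) := by
      rw [← hcard, ← sum_measure_singleton, Finset.sum_congr rfl fun a ha => hsing a (hF ha)]
      simp
    have h2 := measure_mono (μ := μ) (subset_univ (F : Set α))
    rw [h1, hk] at h2
    have : k + 1 ≤ k := by exact_mod_cast h2
    omega
  refine ⟨hfin.toFinset, ?_⟩
  have hnull : μ {a | μ {a} ≠ 0}ᶜ = 0 := by
    refine measure_null_of_locally_null _ fun a ha => ?_
    have ha0 : μ {a} = 0 := by simpa using ha
    obtain ⟨U, hU, hUb⟩ := (nhds_basis_opens a).exists_antitone_subbasis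
    have hinter : ⋂ n, U n = {a} := by
      refine subset_antisymm (fun y hy => ?_)
        (singleton_subset_iff.2 (mem_iInter.2 fun n => (hU n).1))
      by_contra hya
      have : ({y}ᶜ : Set α) ∈ 𝓝 a := isOpen_compl_singleton.mem_nhds (fun h => hya h.symm)
      obtain ⟨n, hn⟩ := hUb.mem_iff.1 this
      exact hn (mem_iInter.1 hy n) rfl
    have hlim := tendsto_measure_iInter_atTop (μ := μ) (s := U)
      (fun n => (hU n).2.measurableSet.nullMeasurableSet) hUb.antitone ⟨0, measure_ne_top _ _⟩
    rw [hinter, ha0] at hlim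
    obtain ⟨n, hn⟩ := (hlim.eventually (gt_mem_nhds one_pos)).exists
    refine ⟨U n, mem_nhdsWithin_of_mem_nhds ((hU n).2.mem_nhds (hU n).1), ?_⟩
    obtain ⟨k, hk⟩ := hint (U n) (hU n).2.measurableSet
    rw [Function.comp_apply, hk] at hn
    rw [hk]
    have : k < 1 := by exact_mod_cast hn
    have : k = 0 := by omega
    simp [this]
  have hZ : MeasurableSet {a | μ {a} ≠ 0} := hfin.measurableSet
  ext A hA
  rw [← measure_inter_add_sdiff A hZ, measure_mono_null (Set.sdiff_subset_compl _ _) hnull, add_zero,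
    Measure.finsetSum_apply]
  classical
  have hAZ : A ∩ {a | μ {a} ≠ 0} = (hfin.toFinset.filter (· ∈ A) : Finset α) := by
    ext a; simp [and_comm]
  rw [hAZ, ← sum_measure_singleton, Finset.sum_filter]
  refine Finset.sum_congr rfl fun a ha => ?_
  rw [Measure.dirac_apply' _ hA, Set.indicator_apply]
  rw [Set.Finite.mem_toFinset] at ha
  simp only [hsing a ha, Pi.one_apply]

/-! ### Moments of Poisson counts -/

theorem lintegral_poissonMeasure (r : ℝ≥0) (g : ℕ → ℝ≥0∞) :
    ∫⁻ k, g k ∂poissonMeasure r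
      = ∑' k : ℕ, ENNReal.ofReal (Real.exp (-r) * r ^ k / k.factorial) * g k := by
  rw [poissonMeasure, lintegral_sum_measure]
  simp [lintegral_smul_measure]

/-- The identity k · r^k/k! = r · r^(k-1)/(k-1)! shifts the sum by one. Used once it gives the mean,
used twice the second factorial moment. -/
theorem lintegral_natCast_mul_poissonMeasure (r : ℝ≥0) (g : ℕ → ℝ≥0∞) :
    ∫⁻ k, (k : ℝ≥0∞) * g k ∂poissonMeasure r = r * ∫⁻ k, g (k + 1) ∂poissonMeasure r := by
  rw [lintegral_poissonMeasure, lintegral_poissonMeasure, tsum_eq_zero_add' ENNReal.summable,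
    ← ENNReal.tsum_mul_left]
  simp only [Nat.cast_zero, zero_mul, mul_zero, zero_add]
  refine tsum_congr fun k => ?_
  have h1 : ((k + 1 : ℕ) : ℝ≥0∞) = ENNReal.ofReal ((k + 1 : ℕ) : ℝ) := by
    rw [ENNReal.ofReal_natCast]
  have h2 : (r : ℝ≥0∞) = ENNReal.ofReal r := (ENNReal.ofReal_coe_nnreal).symm
  rw [h1, h2, ← mul_assoc, ← mul_assoc, ← ENNReal.ofReal_mul (by positivity),
    ← ENNReal.ofReal_mul (by positivity)]
  congr 2
  rw [Nat.factorial_succ]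
  push_cast
  field_simp
  ring

namespace IsPoissonRandomMeasure

variable {Ω : Type*} [mΩ : MeasurableSpace Ω] {P : Measure Ω}
  {𝓕 : Filtration ℝ≥0 mΩ} {N : Ω → Measure (ℝ × ℝ)}

theorem lintegral_comp (hN : IsPoissonRandomMeasure P 𝓕 N) {A : Set (ℝ × ℝ)}
    (hA : MeasurableSet A) (hA' : A ⊆ Ici 0 ×ˢ univ) (hfin : volume A < ∞)
    {φ : ℝ≥0∞ → ℝ≥0∞} (hφ : Measurable φ) :
    ∫⁻ ω, φ (N ω A) ∂P = ∫⁻ k, φ k ∂poissonMeasure (volume A).toNNReal := by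
  rw [← lintegral_map hφ (hN.measurable A hA), hN.law A hA hA' hfin,
    lintegral_map hφ (measurable_of_countable _)]

theorem lintegral_apply (hN : IsPoissonRandomMeasure P 𝓕 N) {A : Set (ℝ × ℝ)}
    (hA : MeasurableSet A) (hA' : A ⊆ Ici 0 ×ˢ univ) (hfin : volume A < ∞) :
    ∫⁻ ω, N ω A ∂P = volume A := by
  have h := hN.lintegral_comp hA hA' hfin measurable_id
  have h2 := lintegral_natCast_mul_poissonMeasure (volume A).toNNReal fun _ => 1
  simp only [mul_one, lintegral_one, measure_univ, ENNReal.coe_toNNReal hfin.ne] at h2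
  simpa using h.trans h2

/-- On a strip of length h this is O(h²): it controls the steps which contain two or more points. -/
theorem lintegral_apply_mul_sub_one (hN : IsPoissonRandomMeasure P 𝓕 N) {A : Set (ℝ × ℝ)}
    (hA : MeasurableSet A) (hA' : A ⊆ Ici 0 ×ˢ univ) (hfin : volume A < ∞) :
    ∫⁻ ω, N ω A * (N ω A - 1) ∂P = volume A * volume A := by
  have h := hN.lintegral_comp (φ := fun x => x * (x - 1)) hA hA' hfin (by fun_prop)
  rw [h, lintegral_natCast_mul_poissonMeasure _ fun k => (k : ℝ≥0∞) - 1]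
  have h2 := lintegral_natCast_mul_poissonMeasure (volume A).toNNReal fun _ => 1
  simp only [mul_one, lintegral_one, measure_univ, ENNReal.coe_toNNReal hfin.ne] at h2
  simp [h2, ENNReal.coe_toNNReal hfin.ne]

theorem ae_lt_top (hN : IsPoissonRandomMeasure P 𝓕 N) {A : Set (ℝ × ℝ)}
    (hA : MeasurableSet A) (hA' : A ⊆ Ici 0 ×ˢ univ) (hfin : volume A < ∞) :
    ∀ᵐ ω ∂P, N ω A < ∞ :=
  MeasureTheory.ae_lt_top (hN.measurable A hA) (by rw [hN.lintegral_apply hA hA' hfin]; exact hfin.ne)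

theorem ae_eq_zero (hN : IsPoissonRandomMeasure P 𝓕 N) {A : Set (ℝ × ℝ)}
    (hA : MeasurableSet A) (hA' : A ⊆ Ici 0 ×ˢ univ) (hzero : volume A = 0) :
    ∀ᵐ ω ∂P, N ω A = 0 := by
  have := hN.lintegral_apply hA hA' (by simp [hzero])
  rw [hzero, lintegral_eq_zero_iff (hN.measurable A hA)] at this
  exact this

end IsPoissonRandomMeasure

/-- `S` is the set of the points of `N` in `[0,T] × [0,K]`; no two of them have the same time, none
has time `0` or mark `0`. -/
structure IsPointSet (N : Measure (ℝ × ℝ)) (K T : ℝ) (S : Finset (ℝ × ℝ)) : Prop where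
  time_mem : ∀ z ∈ S, z.1 ∈ Ioc 0 T
  mark_mem : ∀ z ∈ S, z.2 ∈ Ioc 0 K
  injOn : Set.InjOn Prod.fst (S : Set (ℝ × ℝ))
  restrict_eq : N.restrict (Icc 0 T ×ˢ Icc 0 K) = ∑ z ∈ S, Measure.dirac z

open Classical in
-- Stochastic integrals become finite sums, so integrability against N is never an issue on the good
-- event.
theorem IsPointSet.setIntegral {N : Measure (ℝ × ℝ)} {K T : ℝ} {S : Finset (ℝ × ℝ)}
    (h : IsPointSet N K T S) {E : Type*} [NormedAddCommGroup E] [NormedSpace ℝ E] [CompleteSpace E]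
    {A : Set (ℝ × ℝ)} (hA : MeasurableSet A) (hAS : A ⊆ Icc 0 T ×ˢ Icc 0 K) (φ : ℝ × ℝ → E) :
    ∫ z in A, φ z ∂N = ∑ z ∈ S with z ∈ A, φ z := by
  rw [← Set.inter_eq_left.2 hAS, ← Measure.restrict_restrict hA, h.restrict_eq,
    ← integral_indicator hA, integral_finsetSum_measure fun z _ => ?_]
  · rw [Set.inter_eq_left.2 hAS, Finset.sum_filter]
    exact Finset.sum_congr rfl fun z _ => by rw [integral_dirac, Set.indicator_apply]
  · exact integrable_dirac (by simp)

open Classical in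
theorem IsPointSet.apply {N : Measure (ℝ × ℝ)} {K T : ℝ} {S : Finset (ℝ × ℝ)}
    (h : IsPointSet N K T S) {A : Set (ℝ × ℝ)} (hA : MeasurableSet A)
    (hAS : A ⊆ Icc 0 T ×ˢ Icc 0 K) : N A = ((S.filter (· ∈ A)).card : ℝ≥0∞) := by
  conv_lhs => rw [← Set.inter_eq_left.2 hAS]
  rw [← Measure.restrict_apply hA, h.restrict_eq, Measure.finsetSum_apply]
  simp [Measure.dirac_apply' _ hA, Set.indicator_apply]

/-- A box has finite volume, so N is almost surely finite and integer valued on it, hence a sum of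
Dirac masses at distinct times. Excluding the null line of mark 0 matters: such a mark would be
accepted at rate zero, where the normalised jump is meaningless and q need not agree with it. -/
theorem IsPoissonRandomMeasure.ae_exists_isPointSet {Ω : Type*} [mΩ : MeasurableSpace Ω]
    {P : Measure Ω} {𝓕 : Filtration ℝ≥0 mΩ} {N : Ω → Measure (ℝ × ℝ)}
    (hN : IsPoissonRandomMeasure P 𝓕 N) (K : ℝ) :
    ∀ᵐ ω ∂P, ∀ T : ℕ, ∃ S, IsPointSet (N ω) K T S := by
  rw [ae_all_iff]
  intro T
  have hbox : MeasurableSet (Icc (0 : ℝ) T ×ˢ Icc 0 K) := measurableSet_Icc.prod measurableSet_Icc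
  have hsub : ∀ {B : Set (ℝ × ℝ)}, B ⊆ Icc (0 : ℝ) T ×ˢ Icc 0 K → B ⊆ Ici 0 ×ˢ univ :=
    fun hB z hz => ⟨(hB hz).1.1, trivial⟩
  have hfinv : volume (Icc (0 : ℝ) T ×ˢ Icc 0 K) < ∞ := by
    rw [Measure.volume_eq_prod, Measure.prod_prod, Real.volume_Icc, Real.volume_Icc]
    exact ENNReal.mul_lt_top ENNReal.ofReal_lt_top ENNReal.ofReal_lt_top
  have hz1 : volume (Icc (0 : ℝ) T ×ˢ ({0} : Set ℝ)) = 0 := by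
    rw [Measure.volume_eq_prod, Measure.prod_prod, Real.volume_singleton, mul_zero]
  have hz2 : volume (({0} : Set ℝ) ×ˢ Icc 0 K) = 0 := by
    rw [Measure.volume_eq_prod, Measure.prod_prod, Real.volume_singleton, zero_mul]
  filter_upwards [hN.ae_lt_top hbox (hsub subset_rfl) hfinv, hN.integer_valued, hN.simple,
    hN.ae_eq_zero (measurableSet_Icc.prod (measurableSet_singleton 0))
      (fun z hz => ⟨hz.1.1, trivial⟩) hz1,
    hN.ae_eq_zero ((measurableSet_singleton 0).prod measurableSet_Icc)
      (fun z hz => ⟨hz.1.ge, trivial⟩) hz2] with ω hlt hint hsimple h1 h2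
  set μ := (N ω).restrict (Icc (0 : ℝ) T ×ˢ Icc 0 K) with hμ
  have : IsFiniteMeasure μ := ⟨by rw [hμ, Measure.restrict_apply_univ]; exact hlt⟩
  have hμone : ∀ t : ℝ, μ ({t} ×ˢ univ) ≤ 1 := fun t => by
    by_cases ht : 0 ≤ t
    · exact (Measure.restrict_apply_le _ _).trans (hsimple t ht)
    · rw [hμ, Measure.restrict_apply' hbox]
      have : ({t} ×ˢ univ) ∩ Icc (0 : ℝ) T ×ˢ Icc 0 K = ∅ := by
        ext z
        simp only [mem_inter_iff, mem_prod, mem_singleton_iff, mem_Icc, mem_empty_iff_false,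
          iff_false]
        rintro ⟨⟨h, _⟩, ⟨h', _⟩, _⟩
        exact ht (h ▸ h')
      rw [this, measure_empty]
      exact zero_le_one
  obtain ⟨S, hS⟩ := exists_eq_sum_dirac_of_integer_valued (μ := μ) (fun A hA => by
      rw [hμ, Measure.restrict_apply hA]
      rcases hint _ (hA.inter hbox) (hsub inter_subset_right) with h | h
      · exact absurd h (measure_mono inter_subset_right |>.trans_lt hlt).ne
      · exact h)
    fun z => (measure_mono (by rintro y rfl; exact ⟨rfl, trivial⟩)).trans (hμone z.1)
  classical
  have hcount : ∀ A, MeasurableSet A → μ A = ((S.filter (· ∈ A)).card : ℝ≥0∞) := fun A hA => by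
    rw [hS, Measure.finsetSum_apply]
    simp [Measure.dirac_apply' _ hA, Set.indicator_apply]
  have hout : ∀ A, MeasurableSet A → μ A = 0 → ∀ z ∈ S, z ∉ A := fun A hA h0 z hz hzA => by
    rw [hcount A hA, Nat.cast_eq_zero, Finset.card_eq_zero] at h0
    have : z ∈ S.filter (· ∈ A) := Finset.mem_filter.2 ⟨hz, hzA⟩
    rw [h0] at this
    simp at this
  have hin : ∀ z ∈ S, z ∈ Icc (0 : ℝ) T ×ˢ Icc 0 K := fun z hz => by
    by_contra hc
    exact hout _ hbox.compl (by rw [hμ, Measure.restrict_apply hbox.compl]; simp) z hz hc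
  refine ⟨S, ⟨fun z hz => ?_, fun z hz => ?_, fun y hy z hz hyz => ?_, hS⟩⟩
  · refine ⟨lt_of_le_of_ne (hin z hz).1.1 fun h0 => ?_, (hin z hz).1.2⟩
    exact hout _ ((measurableSet_singleton (0 : ℝ)).prod measurableSet_Icc)
      (le_antisymm ((Measure.restrict_apply_le _ _).trans h2.le) bot_le) z hz
      ⟨h0.symm, (hin z hz).2⟩
  · refine ⟨lt_of_le_of_ne (hin z hz).2.1 fun h0 => ?_, (hin z hz).2.2⟩
    exact hout _ (measurableSet_Icc.prod (measurableSet_singleton (0 : ℝ)))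
      (le_antisymm ((Measure.restrict_apply_le _ _).trans h1.le) bot_le) z hz
      ⟨(hin z hz).1, h0.symm⟩
  · have h := hμone y.1
    rw [hcount _ ((measurableSet_singleton _).prod MeasurableSet.univ)] at h
    norm_cast at h
    exact Finset.card_le_one.1 h y (by simpa using hy) z (by simpa [hyz] using hz)

/-! ## Càdlàg paths indexed by the half-line -/

section CadlagPath

variable {E : Type*} [TopologicalSpace E]

theorem IsCadlag.continuousWithinAt_Ici {x : ℝ → E} (hx : IsCadlag fun t : ℝ≥0 => x t) {t : ℝ}
    (ht : 0 ≤ t) : ContinuousWithinAt x (Ici t) t := by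
  have h := (hx t.toNNReal).1
  have h2 : Tendsto Real.toNNReal (𝓝[Ici t] t) (𝓝[Ici t.toNNReal] t.toNNReal) :=
    tendsto_nhdsWithin_of_tendsto_nhds_of_eventually_within _
      ((continuous_real_toNNReal.tendsto t).mono_left nhdsWithin_le_nhds)
      (eventually_mem_nhdsWithin.mono fun s hs => Real.toNNReal_mono hs)
  have h3 := Tendsto.comp h h2
  simp only [Real.coe_toNNReal t ht] at h3
  refine h3.congr' ?_
  filter_upwards [self_mem_nhdsWithin] with s hs
  simp [Real.coe_toNNReal s (ht.trans hs)]

theorem IsCadlag.tendsto_leftLim [T2Space E] {x : ℝ → E} (hx : IsCadlag fun t : ℝ≥0 => x t)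
    {t : ℝ} (ht : 0 < t) : Tendsto x (𝓝[<] t) (𝓝 (Function.leftLim x t)) := by
  obtain ⟨l, hl⟩ := (hx t.toNNReal).2
  have h2 : Tendsto Real.toNNReal (𝓝[<] t) (𝓝[<] t.toNNReal) :=
    tendsto_nhdsWithin_of_tendsto_nhds_of_eventually_within _
      ((continuous_real_toNNReal.tendsto t).mono_left nhdsWithin_le_nhds)
      (eventually_mem_nhdsWithin.mono fun s hs => (Real.toNNReal_lt_toNNReal_iff ht).2 hs)
  have h3 : Tendsto x (𝓝[<] t) (𝓝 l) := by
    refine (Tendsto.comp hl h2).congr' ?_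
    filter_upwards [Ioo_mem_nhdsLT ht] with s hs
    simp [Real.coe_toNNReal s hs.1.le]
  rwa [leftLim_eq_of_tendsto h3]

end CadlagPath

/-- The ceiling minus one, unlike the floor, gives a grid point strictly below s even when s lies on
the grid, so values along the sequence tend to a left limit. -/
theorem tendsto_ceil_sub_one_div {s : ℝ} :
    Tendsto (fun n : ℕ => ((⌈((n : ℝ) + 1) * s⌉ : ℝ) - 1) / ((n : ℝ) + 1)) atTop (𝓝[<] s) := by
  refine tendsto_nhdsWithin_of_tendsto_nhds_of_eventually_within _ ?_ ?_
  · have h1 : Tendsto (fun n : ℕ => s - 1 / ((n : ℝ) + 1)) atTop (𝓝 s) := by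
      simpa using tendsto_const_nhds.sub (tendsto_one_div_add_atTop_nhds_zero_nat (𝕜 := ℝ))
    refine tendsto_of_tendsto_of_tendsto_of_le_of_le h1 tendsto_const_nhds (fun n => ?_)
      fun n => ?_
    · have hn : (0 : ℝ) < (n : ℝ) + 1 := by positivity
      simp only
      rw [le_div_iff₀ hn, sub_mul, one_div, inv_mul_cancel₀ hn.ne']
      linarith [Int.le_ceil (((n : ℝ) + 1) * s)]
    · have hn : (0 : ℝ) < (n : ℝ) + 1 := by positivity
      simp only
      rw [div_le_iff₀ hn]
      linarith [Int.ceil_lt_add_one (((n : ℝ) + 1) * s)]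
  · refine Eventually.of_forall fun n => ?_
    have hn : (0 : ℝ) < (n : ℝ) + 1 := by positivity
    rw [mem_Iio, div_lt_iff₀ hn]
    linarith [Int.ceil_lt_add_one (((n : ℝ) + 1) * s)]

/-- The left limit is a pointwise limit of functions that are constant on grid cells. The indicator
removes times t ≤ 0, where the left limit depends on irrelevant values. -/
theorem IsCadlag.stronglyMeasurable_leftLim {E : Type*} [NormedAddCommGroup E] {x : ℝ → E}
    (hx : IsCadlag fun t : ℝ≥0 => x t) :
    StronglyMeasurable ((Ioi 0).indicator (Function.leftLim x)) := by
  refine stronglyMeasurable_of_tendsto (f := fun (n : ℕ) => (Ioi 0).indicator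
    fun s => x (((⌈((n : ℝ) + 1) * s⌉ : ℝ) - 1) / ((n : ℝ) + 1))) atTop (fun n => ?_) ?_
  · refine StronglyMeasurable.indicator ?_ measurableSet_Ioi
    have : StronglyMeasurable fun k : ℤ => x (((k : ℝ) - 1) / ((n : ℝ) + 1)) :=
      StronglyMeasurable.of_discrete
    exact this.comp_measurable (Int.measurable_ceil.comp (measurable_const_mul _))
  · refine tendsto_pi_nhds.2 fun s => ?_
    by_cases hs : 0 < s
    · simp only [indicator_of_mem (show s ∈ Ioi 0 from hs)]
      exact (hx.tendsto_leftLim hs).comp tendsto_ceil_sub_one_div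
    · simp only [indicator_of_notMem (show s ∉ Ioi 0 from hs)]
      exact tendsto_const_nhds

/-! ## Paths of the solution -/

/-- The jump of a solution path `x` at the point `z` of the random measure. -/
noncomputable def pathJump (C : QMat) (x : ℝ → QMat) (z : ℝ × ℝ) : QMat :=
  (Icc 0 (jumpOp C (Function.leftLim x z.1)).trace.re).indicator
    (fun _ => belavkinJump C (Function.leftLim x z.1)) z.2

/-- `x` is a path of a solution of the jump-Belavkin equation driven by `ν`, whose points are
isolated. -/
structure IsSolutionPath (ν : Measure (ℝ × ℝ)) (H C : QMat) (K : ℝ) (ρ₀ : QMat)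
    (x : ℝ → QMat) : Prop where
  points : ∀ T : ℕ, ∃ S, IsPointSet ν K T S
  cadlag : IsCadlag fun t : ℝ≥0 => x t
  equation : ∀ t : ℝ, 0 ≤ t → x t = ρ₀
    + (∫ s in 0..t, belavkinDrift H C (Function.leftLim x s))
    + ∫ z in Ioc 0 t ×ˢ Icc 0 K, pathJump C x z ∂ν

namespace IsSolutionPath

variable {ν : Measure (ℝ × ℝ)} {H C : QMat} {K : ℝ} {ρ₀ : QMat} {x : ℝ → QMat}

theorem aestronglyMeasurable_drift (hx : IsSolutionPath ν H C K ρ₀ x) {a b : ℝ} (ha : 0 ≤ a) :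
    AEStronglyMeasurable (fun s => belavkinDrift H C (Function.leftLim x s))
      (volume.restrict (Ioc a b)) := by
  have h := (continuous_belavkinDrift H C).comp_stronglyMeasurable
    hx.cadlag.stronglyMeasurable_leftLim
  refine h.aestronglyMeasurable.congr ?_
  filter_upwards [ae_restrict_mem measurableSet_Ioc] with s hs
  simp [indicator_of_mem (show s ∈ Ioi 0 from ha.trans_lt hs.1)]

theorem intervalIntegrable_drift (hx : IsSolutionPath ν H C K ρ₀ x) {a b M : ℝ} (ha : 0 ≤ a)
    (hab : a ≤ b) (hM : ∀ s ∈ Ioc a b, ‖belavkinDrift H C (Function.leftLim x s)‖ ≤ M) :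
    IntervalIntegrable (fun s => belavkinDrift H C (Function.leftLim x s)) volume a b := by
  rw [intervalIntegrable_iff_integrableOn_Ioc_of_le hab]
  refine Integrable.of_bound (hx.aestronglyMeasurable_drift ha) M ?_
  filter_upwards [ae_restrict_mem measurableSet_Ioc] with s hs using hM s hs

theorem eq_zero (hx : IsSolutionPath ν H C K ρ₀ x) : x 0 = ρ₀ := by
  simpa using hx.equation 0 le_rfl

open Classical in
-- Increments over (a,b]. Integrability of the drift is a hypothesis because it is known only once
-- the path is bounded, which is part of what the induction on states has to establish.
theorem eq_add (hx : IsSolutionPath ν H C K ρ₀ x) {T : ℕ} {S : Finset (ℝ × ℝ)}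
    (hS : IsPointSet ν K T S) {a b : ℝ} (ha : 0 ≤ a) (hab : a ≤ b) (hb : b ≤ T)
    (hint : IntervalIntegrable (fun s => belavkinDrift H C (Function.leftLim x s)) volume 0 b) :
    x b = x a + (∫ s in a..b, belavkinDrift H C (Function.leftLim x s))
      + ∑ z ∈ S with z.1 ∈ Ioc a b, pathJump C x z := by
  have hsum : ∀ t : ℝ, 0 ≤ t → t ≤ T → ∫ z in Ioc 0 t ×ˢ Icc 0 K, pathJump C x z ∂ν
      = ∑ z ∈ S with z.1 ≤ t, pathJump C x z := fun t ht htT => by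
    rw [hS.setIntegral (measurableSet_Ioc.prod measurableSet_Icc)
      (prod_mono (fun s hs => ⟨hs.1.le, hs.2.trans htT⟩) subset_rfl)]
    refine Finset.sum_congr ?_ fun _ _ => rfl
    ext z
    simp only [Finset.mem_filter]
    exact ⟨fun h => ⟨h.1, h.2.1.2⟩, fun h => ⟨h.1, ⟨(hS.time_mem z h.1).1, h.2⟩,
      (hS.mark_mem z h.1).1.le, (hS.mark_mem z h.1).2⟩⟩
  rw [hx.equation b (ha.trans hab), hx.equation a ha, hsum b (ha.trans hab) hb,
    hsum a ha (hab.trans hb), ← intervalIntegral.integral_add_adjacent_intervals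
      (b := a) (hint.mono_set ?_) (hint.mono_set ?_)]
  · have : ∑ z ∈ S with z.1 ≤ b, pathJump C x z = ∑ z ∈ S with z.1 ≤ a, pathJump C x z
        + ∑ z ∈ S with z.1 ∈ Ioc a b, pathJump C x z := by
      rw [← Finset.sum_union]
      · refine Finset.sum_congr ?_ fun _ _ => rfl
        ext z
        simp only [Finset.mem_filter, Finset.mem_union, mem_Ioc]
        constructor
        · rintro ⟨h, h'⟩
          by_cases hz : z.1 ≤ a
          · exact Or.inl ⟨h, hz⟩
          · exact Or.inr ⟨h, not_le.1 hz, h'⟩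
        · rintro (⟨h, h'⟩ | ⟨h, h'⟩)
          · exact ⟨h, h'.trans hab⟩
          · exact ⟨h, h'.2⟩
      · rw [Finset.disjoint_filter]
        exact fun z _ h h' => (h'.1.trans_le h).false
    rw [this]
    abel
  · rw [uIcc_of_le ha, uIcc_of_le (ha.trans hab)]; exact Icc_subset_Icc le_rfl hab
  · rw [uIcc_of_le hab, uIcc_of_le (ha.trans hab)]; exact Icc_subset_Icc ha le_rfl

theorem isState_leftLim (hx : IsSolutionPath ν H C K ρ₀ x) {t : ℝ} (ht : 0 < t)
    (h : ∀ s ∈ Ico 0 t, IsState (x s)) : IsState (Function.leftLim x t) := by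
  refine isClosed_setOf_isState.mem_of_tendsto (hx.cadlag.tendsto_leftLim ht) ?_
  filter_upwards [Ioo_mem_nhdsLT ht] with s hs using h s ⟨hs.1.le, hs.2⟩

theorem exists_bound_drift (H C : QMat) : ∃ B, ∀ ρ, IsState ρ → ‖belavkinDrift H C ρ‖ ≤ B := by
  obtain ⟨B, hB⟩ := (isCompact_setOf_isState.image (continuous_belavkinDrift H C)).isBounded.exists_norm_le
  exact ⟨B, fun ρ hρ => hB _ ⟨ρ, hρ, rfl⟩⟩

/-- The jumps of a state-valued path lead to states. -/
theorem isState_of_forall_lt (hx : IsSolutionPath ν H C K ρ₀ x) {t : ℝ} (ht : 0 < t)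
    (h : ∀ s ∈ Ico 0 t, IsState (x s)) : IsState (x t) := by
  obtain ⟨T, hT⟩ := exists_nat_ge t
  obtain ⟨S, hS⟩ := hx.points T
  obtain ⟨B, hB⟩ := exists_bound_drift H C
  have hy := hx.isState_leftLim ht h
  have hint : IntervalIntegrable (fun s => belavkinDrift H C (Function.leftLim x s)) volume 0 t :=
    hx.intervalIntegrable_drift le_rfl ht.le fun s hs =>
      hB _ (hx.isState_leftLim hs.1 fun r hr => h r ⟨hr.1, hr.2.trans_le hs.2⟩)
  classical
  -- Letting a increase to t removes the drift from the increment over (a,t], which leaves the jump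
  -- at t.
  have hlim : Tendsto (fun a => x a + (∫ s in a..t, belavkinDrift H C (Function.leftLim x s)))
      (𝓝[<] t) (𝓝 (Function.leftLim x t + 0)) := by
    refine (hx.cadlag.tendsto_leftLim ht).add ?_
    have hc := intervalIntegral.continuousOn_primitive_interval_left (a := 0) (b := t)
      (f := fun s => belavkinDrift H C (Function.leftLim x s)) (μ := volume)
      (by rw [uIcc_of_le ht.le]; exact (intervalIntegrable_iff_integrableOn_Icc_of_le ht.le).1 hint)
    rw [uIcc_of_le ht.le] at hc
    have := hc t ⟨ht.le, le_rfl⟩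
    rw [ContinuousWithinAt, intervalIntegral.integral_same] at this
    refine this.mono_left ?_
    rw [← nhdsWithin_Ico_eq_nhdsLT ht]
    exact nhdsWithin_mono _ Ico_subset_Icc_self
  have hev : ∀ᶠ a in 𝓝[<] t, ∀ z ∈ S, z.1 ∈ Ioc a t ↔ z.1 = t := by
    rw [Filter.eventually_all_finset]
    intro z hz
    rcases lt_trichotomy z.1 t with hzt | hzt | hzt
    · filter_upwards [Ioo_mem_nhdsLT hzt] with a ha
      exact ⟨fun h => absurd h.1 (not_lt.2 ha.1.le), fun h => absurd h hzt.ne⟩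
    · filter_upwards [self_mem_nhdsWithin] with a ha
      exact ⟨fun _ => hzt, fun h => ⟨h ▸ ha, h.le⟩⟩
    · exact Eventually.of_forall fun a =>
        ⟨fun h => absurd h.2 (not_le.2 hzt), fun h => absurd h hzt.ne'⟩
  have hconst : ∀ᶠ a in 𝓝[<] t,
      x a + (∫ s in a..t, belavkinDrift H C (Function.leftLim x s))
        = x t - ∑ z ∈ S with z.1 = t, pathJump C x z := by
    filter_upwards [hev, Ioo_mem_nhdsLT ht] with a ha ha'
    rw [hx.eq_add hS ha'.1.le ha'.2.le hT hint, Finset.filter_congr ha]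
    abel
  have hjump : x t = Function.leftLim x t + ∑ z ∈ S with z.1 = t, pathJump C x z := by
    have := tendsto_nhds_unique (tendsto_const_nhds.congr' (hconst.mono fun _ h => h.symm)) hlim
    rw [add_zero, sub_eq_iff_eq_add] at this
    exact this
  rw [hjump]
  -- At most one point has time t, so two jumps are never added to the same left limit.
  have hcard : (S.filter (·.1 = t)).card ≤ 1 := Finset.card_le_one.2 fun y hy z hz => by
    rw [Finset.mem_filter] at hy hz
    exact hS.injOn hy.1 hz.1 (hy.2.trans hz.2.symm)
  rcases Nat.le_one_iff_eq_zero_or_eq_one.1 hcard with h0 | h1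
  · rw [Finset.card_eq_zero.1 h0, Finset.sum_empty, add_zero]
    exact hy
  · obtain ⟨z, hz⟩ := Finset.card_eq_one.1 h1
    have hzS : z ∈ S.filter (·.1 = t) := by rw [hz]; exact Finset.mem_singleton_self z
    rw [Finset.mem_filter] at hzS
    rw [hz, Finset.sum_singleton, pathJump, hzS.2]
    by_cases hmem : z.2 ∈ Icc 0 (jumpOp C (Function.leftLim x t)).trace.re
    · rw [indicator_of_mem hmem]
      -- An accepted mark is positive and at most the rate, so the rate is positive and the
      -- normalised jump is defined.
      exact hy.add_belavkinJump ((hS.mark_mem z hzS.1).1.trans_le hmem.2)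
    · rw [indicator_of_notMem hmem, add_zero]
      exact hy

/-- A solution path that has taken values in states so far does so for a while. -/
theorem eventually_isState (hx : IsSolutionPath ν H C K ρ₀ x) (hH : H.IsHermitian) {a : ℝ}
    (ha : 0 ≤ a) (h : ∀ s ∈ Icc 0 a, IsState (x s)) :
    ∃ c > a, ∀ s ∈ Icc a c, IsState (x s) := by
  obtain ⟨T, hT⟩ := exists_nat_gt a
  obtain ⟨S, hS⟩ := hx.points T
  -- The endpoint c is chosen before the next point of N.
  have hev : ∀ᶠ d in 𝓝[>] a, ∀ z ∈ S, a < z.1 → d < z.1 := by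
    rw [Filter.eventually_all_finset]
    intro z hz
    by_cases hza : a < z.1
    · filter_upwards [Ioo_mem_nhdsGT hza] with d hd _ using hd.2
    · exact Eventually.of_forall fun d h => absurd h hza
  -- Values after a are not yet known to be states; right-continuity alone bounds the path, and thus
  -- the drift, on a short interval.
  have hball : ∀ᶠ d in 𝓝[≥] a, x d ∈ Metric.closedBall (x a) 1 :=
    (hx.cadlag.continuousWithinAt_Ici ha).eventually (Metric.closedBall_mem_nhds _ one_pos)
  obtain ⟨d, had, hd⟩ := mem_nhdsGE_iff_exists_Ico_subset.1 hball
  rw [mem_Ioi] at had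
  obtain ⟨c, hcS, hcd, hcT⟩ := (hev.and
    ((eventually_mem_set.2 (Ioo_mem_nhdsGT had)).and
      (eventually_mem_set.2 (Ioo_mem_nhdsGT hT)))).exists
  have hac : a < c := hcd.1
  refine ⟨c, hac, ?_⟩
  obtain ⟨B, hB⟩ := exists_bound_drift H C
  obtain ⟨B', hB'⟩ := ((isCompact_closedBall (x a) 1).image
    (continuous_belavkinDrift H C)).isBounded.exists_norm_le
  have hint : IntervalIntegrable (fun s => belavkinDrift H C (Function.leftLim x s)) volume 0 c := by
    refine hx.intervalIntegrable_drift (M := max B B') le_rfl (ha.trans hac.le) fun s hs => ?_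
    by_cases hsa : s ≤ a
    · exact (hB _ (hx.isState_leftLim hs.1 fun r hr => h r ⟨hr.1, hr.2.le.trans hsa⟩)).trans
        (le_max_left _ _)
    · refine (hB' _ ⟨_, ?_, rfl⟩).trans (le_max_right _ _)
      refine Metric.isClosed_closedBall.mem_of_tendsto (hx.cadlag.tendsto_leftLim hs.1) ?_
      filter_upwards [Ioo_mem_nhdsLT (not_le.1 hsa)] with r hr
      exact hd ⟨hr.1.le, hr.2.trans (hs.2.trans_lt hcd.2)⟩
  classical
  have hxr : ∀ r ∈ Icc a c, x r = x a + ∫ s in a..r, belavkinDrift H C (Function.leftLim x s) :=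
    fun r hr => by
    have hsub : uIcc 0 r ⊆ uIcc 0 c := by
      rw [uIcc_of_le (ha.trans hr.1), uIcc_of_le (ha.trans hac.le)]
      exact Icc_subset_Icc le_rfl hr.2
    have he := hx.eq_add hS ha hr.1 (hr.2.trans hcT.2.le) (hint.mono_set hsub)
    rwa [Finset.filter_false_of_mem, Finset.sum_empty, add_zero] at he
    exact fun z hz hz' => (hcS z hz hz'.1).not_ge (hz'.2.trans hr.2)
  have hcont : ContinuousOn x (Icc a c) := by
    have hc := intervalIntegral.continuousOn_primitive_interval (a := a) (b := c)
      (f := fun s => belavkinDrift H C (Function.leftLim x s)) (μ := volume)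
      (by
        rw [uIcc_of_le hac.le, ← intervalIntegrable_iff_integrableOn_Icc_of_le hac.le]
        refine hint.mono_set ?_
        rw [uIcc_of_le hac.le, uIcc_of_le (ha.trans hac.le)]
        exact Icc_subset_Icc ha le_rfl)
    rw [uIcc_of_le hac.le] at hc
    exact (continuousOn_const.add hc).congr hxr
  -- Without points the path is continuous, so left limits are values and the equation becomes an
  -- ordinary differential equation.
  have hleft : ∀ s ∈ Ioc a c, Function.leftLim x s = x s := fun s hs => by
    refine tendsto_nhds_unique (hx.cadlag.tendsto_leftLim (ha.trans_lt hs.1)) ?_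
    refine (hcont s ⟨hs.1.le, hs.2⟩).mono_left ?_
    rw [← nhdsWithin_Ico_eq_nhdsLT hs.1]
    exact nhdsWithin_mono _ fun r hr => ⟨hr.1, hr.2.le.trans hs.2⟩
  have hxr' : ∀ r ∈ Icc a c, x r = x a + ∫ s in a..r, belavkinDrift H C (x s) := fun r hr => by
    rw [hxr r hr]
    congr 1
    refine intervalIntegral.integral_congr_ae (Eventually.of_forall fun s hs => ?_)
    rw [uIoc_of_le hr.1] at hs
    rw [hleft s ⟨hs.1, hs.2.trans hr.2⟩]
  have hfc : ContinuousOn (fun s => belavkinDrift H C (x s)) (Icc a c) :=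
    (continuous_belavkinDrift H C).comp_continuousOn hcont
  refine isState_of_hasDerivWithinAt hH C hcont (fun t ht => ?_) (h a ⟨ha, le_rfl⟩)
  have hmem : Icc a c ∈ 𝓝[>] t := by
    filter_upwards [Ioo_mem_nhdsGT ht.2] with s hs using ⟨ht.1.trans hs.1.le, hs.2.le⟩
  have hmem' : Icc a c ∈ 𝓝[≥] t := by
    filter_upwards [Ico_mem_nhdsGE ht.2] with s hs using ⟨ht.1.trans hs.1, hs.2.le⟩
  have hder := intervalIntegral.integral_hasDerivWithinAt_right (a := a) (b := t)
    (f := fun s => belavkinDrift H C (x s)) (s := Ici t) (t := Ioi t)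
    ((hfc.mono (Icc_subset_Icc le_rfl ht.2.le)).intervalIntegrable_of_Icc ht.1)
    ⟨Icc a c, hmem, hfc.aestronglyMeasurable measurableSet_Icc⟩
    ((hfc t ⟨ht.1, ht.2.le⟩).mono_of_mem_nhdsWithin hmem)
  refine (hder.const_add (x a)).congr_of_eventuallyEq ?_ (hxr' t ⟨ht.1, ht.2.le⟩)
  filter_upwards [hmem'] with r hr using hxr' r hr

/-- A solution path starting from a state consists of states. -/
theorem isState (hx : IsSolutionPath ν H C K ρ₀ x) (hH : H.IsHermitian) (hρ₀ : IsState ρ₀)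
    {t : ℝ} (ht : 0 ≤ t) : IsState (x t) := by
  -- Real induction: closedness is the passage through a possible jump time, extension to the right
  -- is the flow between jumps.
  have hclosed : IsClosed ({t | ∀ s ∈ Icc 0 t, IsState (x s)} ∩ Icc 0 t) := by
    refine isClosed_of_closure_subset fun u hu => ?_
    have hu' : u ∈ Icc 0 t :=
      closure_minimal inter_subset_right isClosed_Icc hu
    have hlt : ∀ s ∈ Ico 0 u, IsState (x s) := fun s hs => by
      obtain ⟨v, hv, hv'⟩ := mem_closure_iff.1 hu (Ioi s) isOpen_Ioi hs.2
      exact hv'.1 s ⟨hs.1, (le_of_lt hv)⟩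
    refine ⟨fun s hs => ?_, hu'⟩
    rcases hs.2.lt_or_eq with h | h
    · exact hlt s ⟨hs.1, h⟩
    · subst h
      rcases hs.1.lt_or_eq with h0 | h0
      · exact hx.isState_of_forall_lt h0 hlt
      · rw [← h0, hx.eq_zero]; exact hρ₀
  have := hclosed.Icc_subset_of_forall_exists_gt (a := 0) (b := t)
    (fun s hs => by rw [le_antisymm hs.2 hs.1, hx.eq_zero]; exact hρ₀)
    (fun u hu v hv => by
      obtain ⟨c, hc, hcs⟩ := hx.eventually_isState hH hu.2.1 hu.1
      refine ⟨min c v, fun s hs => ?_, lt_min hc hv, min_le_right _ _⟩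
      rcases le_total s u with h | h
      · exact hu.1 s ⟨hs.1, h⟩
      · exact hcs s ⟨h, hs.2.trans (min_le_left _ _)⟩)
  exact this ⟨ht, le_rfl⟩ t ⟨ht, le_rfl⟩

end IsSolutionPath

/-! ## Compensation with a random set of marks known at the start of the time interval -/

namespace IsPoissonRandomMeasure

variable {Ω : Type*} [mΩ : MeasurableSpace Ω] {P : Measure Ω}
  {𝓕 : Filtration ℝ≥0 mΩ} {N : Ω → Measure (ℝ × ℝ)}

theorem indep_apply (hN : IsPoissonRandomMeasure P 𝓕 N) {a : ℝ≥0} {A : Set (ℝ × ℝ)}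
    (hA : MeasurableSet A) (hA' : A ⊆ Ioi (a : ℝ) ×ˢ univ) (hfin : volume A < ∞) :
    Indep (MeasurableSpace.comap (fun ω => N ω A) inferInstance) (𝓕 a) P := by
  refine indep_of_indep_of_le_left (hN.indep_past a 1 (fun _ => A) (fun _ => hA) (fun _ => hA')
    (fun _ => hfin) fun i j hij => (hij (Subsingleton.elim i j)).elim) ?_
  rw [← measurable_iff_comap_le]
  exact (measurable_pi_apply (X := fun _ : Fin 1 => ℝ≥0∞) 0).comp (comap_measurable _)

theorem lintegral_mul_apply (hN : IsPoissonRandomMeasure P 𝓕 N) {a : ℝ≥0} {A : Set (ℝ × ℝ)}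
    (hA : MeasurableSet A) (hA' : A ⊆ Ioi (a : ℝ) ×ˢ univ) (hfin : volume A < ∞)
    {f : Ω → ℝ≥0∞} (hf : Measurable[𝓕 a] f) :
    ∫⁻ ω, f ω * N ω A ∂P = (∫⁻ ω, f ω ∂P) * volume A := by
  rw [lintegral_mul_eq_lintegral_mul_lintegral_of_independent_measurableSpace (𝓕.le a)
    (measurable_iff_comap_le.1 (hN.measurable A hA)) (hN.indep_apply hA hA' hfin).symm hf
    (comap_measurable _), hN.lintegral_apply hA
    (hA'.trans (prod_mono (fun t ht => (NNReal.coe_nonneg a).trans (le_of_lt ht)) subset_rfl)) hfin]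

theorem volume_strip (a b K : ℝ) (B : Set ℝ) :
    volume (Ioc a b ×ˢ (B ∩ Icc 0 K)) = ENNReal.ofReal (b - a) * volume (B ∩ Icc 0 K) := by
  rw [Measure.volume_eq_prod, Measure.prod_prod, Real.volume_Ioc]

theorem volume_inter_Icc_lt_top (K : ℝ) (B : Set ℝ) : volume (B ∩ Icc 0 K) < ∞ :=
  (measure_mono inter_subset_right).trans_lt (by simp [Real.volume_Icc])

theorem volume_strip_lt_top (a b K : ℝ) (B : Set ℝ) : volume (Ioc a b ×ˢ (B ∩ Icc 0 K)) < ∞ := by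
  rw [volume_strip]
  exact ENNReal.mul_lt_top ENNReal.ofReal_lt_top (volume_inter_Icc_lt_top K B)

variable [IsProbabilityMeasure P]

/-- A compensation formula for a random set of marks frozen at time a, by a π-λ argument from
rectangles G × B with G in 𝓕 a. Freezing the set makes independence from the past sufficient, with
no theory of predictable integrands. -/
theorem aemeasurable_and_lintegral_section (hN : IsPoissonRandomMeasure P 𝓕 N) (a : ℝ≥0)
    (b K : ℝ) {S : Set (Ω × ℝ)} (hS : MeasurableSet[(𝓕 a).prod inferInstance] S) :
    AEMeasurable (fun ω => N ω (Ioc (a : ℝ) b ×ˢ (Prod.mk ω ⁻¹' S ∩ Icc 0 K))) P ∧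
    ∫⁻ ω, N ω (Ioc (a : ℝ) b ×ˢ (Prod.mk ω ⁻¹' S ∩ Icc 0 K)) ∂P
      = ∫⁻ ω, ENNReal.ofReal (b - a) * volume (Prod.mk ω ⁻¹' S ∩ Icc 0 K) ∂P := by
  have hle : (𝓕 a).prod inferInstance ≤ mΩ.prod (inferInstance : MeasurableSpace ℝ) :=
    sup_le_sup (MeasurableSpace.comap_mono (𝓕.le a)) le_rfl
  have hsec : ∀ {S : Set (Ω × ℝ)}, MeasurableSet[(𝓕 a).prod inferInstance] S → ∀ ω,
      MeasurableSet (Prod.mk ω ⁻¹' S ∩ Icc 0 K) := fun hS ω =>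
    (measurable_prodMk_left (hle _ hS)).inter measurableSet_Icc
  have hstrip : ∀ {B : Set ℝ}, MeasurableSet B → MeasurableSet (Ioc (a : ℝ) b ×ˢ B) := fun hB =>
    measurableSet_Ioc.prod hB
  have hsub : ∀ {B : Set ℝ}, Ioc (a : ℝ) b ×ˢ B ⊆ Ioi (a : ℝ) ×ˢ univ := fun {B} =>
    prod_mono (fun t ht => ht.1) (subset_univ _)
  have hsub' : ∀ {B : Set ℝ}, Ioc (a : ℝ) b ×ˢ B ⊆ Ici 0 ×ˢ univ := fun {B} =>
    prod_mono (fun t ht => (NNReal.coe_nonneg a).trans ht.1.le) (subset_univ _)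
  have hvol : ∀ {S : Set (Ω × ℝ)}, MeasurableSet[(𝓕 a).prod inferInstance] S →
      Measurable fun ω => volume (Prod.mk ω ⁻¹' S ∩ Icc 0 K) := fun {S} hS => by
    have := measurable_measure_prodMk_left (ν := volume.restrict (Icc 0 K)) (hle _ hS)
    simpa only [Measure.restrict_apply' measurableSet_Icc] using this
  have hgen : (𝓕 a).prod (inferInstance : MeasurableSpace ℝ)
      = MeasurableSpace.generateFrom
        (image2 (· ×ˢ ·) {s : Set Ω | MeasurableSet[𝓕 a] s} {t : Set ℝ | MeasurableSet t}) :=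
    (@generateFrom_prod Ω ℝ (𝓕 a) _).symm
  refine MeasurableSpace.induction_on_inter
    (C := fun S _ => AEMeasurable (fun ω => N ω (Ioc (a : ℝ) b ×ˢ (Prod.mk ω ⁻¹' S ∩ Icc 0 K))) P ∧
      ∫⁻ ω, N ω (Ioc (a : ℝ) b ×ˢ (Prod.mk ω ⁻¹' S ∩ Icc 0 K)) ∂P
        = ∫⁻ ω, ENNReal.ofReal (b - a) * volume (Prod.mk ω ⁻¹' S ∩ Icc 0 K) ∂P)
    hgen (@isPiSystem_prod Ω ℝ (𝓕 a) _) ?_ ?_ ?_ ?_ S hS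
  · simp
  -- On a rectangle the count is the indicator of G times N of a fixed strip, and these factors are
  -- independent.
  · rintro _ ⟨G, hG, B, hB, rfl⟩
    have hG' : MeasurableSet[mΩ] G := 𝓕.le a _ hG
    have hind : ∀ ω, N ω (Ioc (a : ℝ) b ×ˢ (Prod.mk ω ⁻¹' (G ×ˢ B) ∩ Icc 0 K))
        = G.indicator 1 ω * N ω (Ioc (a : ℝ) b ×ˢ (B ∩ Icc 0 K)) := fun ω => by
      by_cases hω : ω ∈ G
      · simp [mk_preimage_prod_right hω, hω]
      · simp [mk_preimage_prod_right_eq_empty hω, hω]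
    have hind' : ∀ ω, volume (Prod.mk ω ⁻¹' (G ×ˢ B) ∩ Icc 0 K)
        = G.indicator 1 ω * volume (B ∩ Icc 0 K) := fun ω => by
      by_cases hω : ω ∈ G
      · simp [mk_preimage_prod_right hω, hω]
      · simp [mk_preimage_prod_right_eq_empty hω, hω]
    have hBm := hstrip ((show MeasurableSet B from hB).inter (measurableSet_Icc (a := (0 : ℝ)) (b := K)))
    simp only [hind, hind']
    refine ⟨((measurable_one.indicator hG').mul (hN.measurable _ hBm)).aemeasurable, ?_⟩
    have hGm : Measurable[𝓕 a] (G.indicator (1 : Ω → ℝ≥0∞)) :=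
      Measurable.indicator (m := 𝓕 a) (@measurable_const _ _ _ (𝓕 a) 1) hG
    rw [hN.lintegral_mul_apply hBm hsub (volume_strip_lt_top _ _ _ _) hGm, volume_strip]
    simp only [mul_left_comm (ENNReal.ofReal (b - a))]
    rw [lintegral_mul_const _ (measurable_one.indicator hG')]
  · intro S hS ⟨hm, hi⟩
    have hS' : MeasurableSet[(𝓕 a).prod inferInstance] S := hS
    have hsc := hsec hS'
    have hboxm := hstrip (measurableSet_Icc (a := (0 : ℝ)) (b := K))
    have hvolbox : volume (Ioc (a : ℝ) b ×ˢ Icc 0 K) = ENNReal.ofReal (b - a) * volume (Icc 0 K) := by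
      simpa using volume_strip a b K univ
    have hfinbox : volume (Ioc (a : ℝ) b ×ˢ Icc 0 K) < ∞ := by
      simpa using volume_strip_lt_top a b K univ
    have hsplit : ∀ (μ : Measure (ℝ × ℝ)) ω, μ (Ioc (a : ℝ) b ×ˢ (Prod.mk ω ⁻¹' S ∩ Icc 0 K))
        + μ (Ioc (a : ℝ) b ×ˢ (Prod.mk ω ⁻¹' Sᶜ ∩ Icc 0 K)) = μ (Ioc (a : ℝ) b ×ˢ Icc 0 K) := by
      intro μ ω
      rw [← measure_union _ (hstrip (hsec hS'.compl ω)), ← prod_union, ← union_inter_distrib_right,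
        ← preimage_union, union_compl_self, preimage_univ, univ_inter]
      refine Disjoint.set_prod_right ?_ _ _
      exact (disjoint_compl_right.preimage _).mono inter_subset_left inter_subset_left
    have hsplit' : ∀ ω, volume (Prod.mk ω ⁻¹' S ∩ Icc 0 K)
        + volume (Prod.mk ω ⁻¹' Sᶜ ∩ Icc 0 K) = volume (Icc 0 K) := by
      intro ω
      rw [← measure_union _ (hsec hS'.compl ω), ← union_inter_distrib_right,
        ← preimage_union, union_compl_self, preimage_univ, univ_inter]
      exact (disjoint_compl_right.preimage _).mono inter_subset_left inter_subset_left
    have hmc : AEMeasurable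
        (fun ω => N ω (Ioc (a : ℝ) b ×ˢ (Prod.mk ω ⁻¹' Sᶜ ∩ Icc 0 K))) P := by
      refine ((hN.measurable _ hboxm).aemeasurable.sub hm).congr ?_
      -- Subtraction of counts is legitimate only where the count of the box is finite, so only
      -- almost everywhere measurability passes to complements.
      filter_upwards [hN.ae_lt_top hboxm hsub' hfinbox] with ω hω
      rw [Pi.sub_apply, ← hsplit (N ω) ω, ENNReal.add_sub_cancel_left]
      exact ((measure_mono (prod_mono subset_rfl inter_subset_right)).trans_lt hω).ne
    refine ⟨hmc, ?_⟩
    have h1 := lintegral_add_left' hm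
      fun ω => N ω (Ioc (a : ℝ) b ×ˢ (Prod.mk ω ⁻¹' Sᶜ ∩ Icc 0 K))
    simp only [hsplit] at h1
    rw [hN.lintegral_apply hboxm hsub' hfinbox, hi] at h1
    have h2 := lintegral_add_left (μ := P) ((hvol hS').const_mul (ENNReal.ofReal (b - a)))
      fun ω => ENNReal.ofReal (b - a) * volume (Prod.mk ω ⁻¹' Sᶜ ∩ Icc 0 K)
    simp only [← mul_add, hsplit', ← hvolbox, lintegral_const, measure_univ, mul_one] at h2
    rw [h2] at h1
    refine ((ENNReal.add_right_inj ?_).1 h1).symm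
    refine (lt_of_le_of_lt ?_ hfinbox).ne
    calc ∫⁻ ω, ENNReal.ofReal (b - a) * volume (Prod.mk ω ⁻¹' S ∩ Icc 0 K) ∂P
        ≤ ∫⁻ _, ENNReal.ofReal (b - a) * volume (Icc 0 K) ∂P := by
          gcongr; exact inter_subset_right
      _ = _ := by rw [lintegral_const, measure_univ, mul_one, hvolbox]
  · intro S hd hS hSi
    have hS' : ∀ i, MeasurableSet[(𝓕 a).prod inferInstance] (S i) := hS
    have hdω : ∀ ω, Pairwise (Function.onFun Disjoint fun i => Prod.mk ω ⁻¹' S i ∩ Icc 0 K) :=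
      fun ω i j hij => ((hd hij).preimage _).mono inter_subset_left inter_subset_left
    have h1 : ∀ ω, N ω (Ioc (a : ℝ) b ×ˢ (Prod.mk ω ⁻¹' (⋃ i, S i) ∩ Icc 0 K))
        = ∑' i, N ω (Ioc (a : ℝ) b ×ˢ (Prod.mk ω ⁻¹' S i ∩ Icc 0 K)) := fun ω => by
      rw [preimage_iUnion, iUnion_inter, prod_iUnion, measure_iUnion]
      · exact fun i j hij => (hdω ω hij).set_prod_right _ _
      · exact fun i => hstrip (hsec (hS' i) ω)
    have h2 : ∀ ω, volume (Prod.mk ω ⁻¹' (⋃ i, S i) ∩ Icc 0 K)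
        = ∑' i, volume (Prod.mk ω ⁻¹' S i ∩ Icc 0 K) := fun ω => by
      rw [preimage_iUnion, iUnion_inter, measure_iUnion (hdω ω)]
      exact fun i => hsec (hS' i) ω
    simp only [h1, h2, ← ENNReal.tsum_mul_left]
    refine ⟨AEMeasurable.tsum fun i => (hSi i).1, ?_⟩
    rw [lintegral_tsum fun i => (hSi i).1,
      lintegral_tsum fun i => ((hvol (hS' i)).const_mul _).aemeasurable]
    exact tsum_congr fun i => (hSi i).2

theorem _root_.measurableSet_setOf_abs_sub_le {Ω : Type*} [MeasurableSpace Ω] {c r : Ω → ℝ}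
    (hc : Measurable c) (hr : Measurable r) :
    MeasurableSet {p : Ω × ℝ | |p.2 - c p.1| ≤ r p.1} :=
  measurableSet_le (by fun_prop) (by fun_prop)

/-- The expected number of points with mark in a random interval known at time `a`. -/
theorem lintegral_band_le (hN : IsPoissonRandomMeasure P 𝓕 N) (a : ℝ≥0) (b K : ℝ)
    {c r : Ω → ℝ} (hc : Measurable[𝓕 a] c) (hr : Measurable[𝓕 a] r) :
    AEMeasurable (fun ω => N ω (Ioc (a : ℝ) b ×ˢ ({x | |x - c ω| ≤ r ω} ∩ Icc 0 K))) P ∧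
    ∫⁻ ω, N ω (Ioc (a : ℝ) b ×ˢ ({x | |x - c ω| ≤ r ω} ∩ Icc 0 K)) ∂P
      ≤ ENNReal.ofReal (b - a) * ∫⁻ ω, ENNReal.ofReal (2 * r ω) ∂P := by
  have h := hN.aemeasurable_and_lintegral_section a b K
    (@measurableSet_setOf_abs_sub_le Ω (𝓕 a) c r hc hr)
  refine ⟨h.1, h.2.le.trans ?_⟩
  rw [← lintegral_const_mul' _ _ ENNReal.ofReal_ne_top]
  refine lintegral_mono fun ω => ?_
  gcongr
  calc volume (Prod.mk ω ⁻¹' {p : Ω × ℝ | |p.2 - c p.1| ≤ r p.1} ∩ Icc 0 K)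
      ≤ volume (Icc (c ω - r ω) (c ω + r ω)) := by
        refine measure_mono fun x hx => ?_
        have := abs_le.1 (show |x - c ω| ≤ r ω from hx.1)
        exact ⟨by linarith, by linarith⟩
    _ = ENNReal.ofReal (2 * r ω) := by rw [Real.volume_Icc]; congr 1; ring

end IsPoissonRandomMeasure

/-! ## The error of one step of the scheme -/

/-- `L` is a Lipschitz constant for `F`, `q` and the rate of jumps, and bounds the drift, the jumps
and the distances on the set of states. -/
structure IsCoefBound (H C : QMat) (F q : QMat → QMat) (L : ℝ) : Prop where
  nonneg : 0 ≤ L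
  drift_lipschitz : ∀ X Y, ‖F X - F Y‖ ≤ L * ‖X - Y‖
  jump_lipschitz : ∀ X Y, ‖q X - q Y‖ ≤ L * ‖X - Y‖
  rate_lipschitz : ∀ X Y, |jumpRate C X - jumpRate C Y| ≤ L * ‖X - Y‖
  norm_drift_le : ∀ ρ, IsState ρ → ‖belavkinDrift H C ρ‖ ≤ L
  norm_jump_le : ∀ ρ, IsState ρ → ‖q ρ‖ ≤ L

theorem exists_isCoefBound {H C : QMat} {F q : QMat → QMat} (hF : IsLipschitzDrift H C F)
    (hq : IsLipschitzJump C q) : ∃ L, IsCoefBound H C F q L := by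
  obtain ⟨⟨c₁, h₁⟩, -⟩ := hF
  obtain ⟨⟨c₂, h₂⟩, -⟩ := hq
  obtain ⟨c₃, h₃⟩ := exists_lipschitz_jumpRate C
  obtain ⟨B₁, hB₁⟩ := IsSolutionPath.exists_bound_drift H C
  obtain ⟨B₂, hB₂⟩ := (isCompact_setOf_isState.image h₂.continuous).isBounded.exists_norm_le
  refine ⟨max (max (max c₁ c₂) c₃) (max B₁ B₂), ?_, fun X Y => ?_, fun X Y => ?_, fun X Y => ?_,
    fun ρ hρ => ?_, fun ρ hρ => ?_⟩
  · exact le_max_of_le_left (le_max_of_le_right c₃.2)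
  · rw [← dist_eq_norm, ← dist_eq_norm]
    exact (h₁.dist_le_mul X Y).trans (by gcongr; simp)
  · rw [← dist_eq_norm, ← dist_eq_norm]
    exact (h₂.dist_le_mul X Y).trans (by gcongr; simp)
  · rw [← Real.dist_eq, ← dist_eq_norm]
    exact (h₃.dist_le_mul X Y).trans (by gcongr; simp)
  · exact (hB₁ ρ hρ).trans (by simp)
  · exact (hB₂ _ ⟨ρ, hρ, rfl⟩).trans (by simp)

open Classical in
/-- The jump of size `q X` at a point with mark `u`, which takes place if `u ≤ Re Tr[𝒥(X)]`. -/
noncomputable def markJump (C : QMat) (q : QMat → QMat) (X : QMat) (u : ℝ) : QMat :=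
  if u ≤ jumpRate C X then q X else 0

theorem indicator_eq_markJump (C : QMat) (q : QMat → QMat) (X : QMat) {u : ℝ} (hu : 0 ≤ u) :
    (Icc 0 (jumpOp C X).trace.re).indicator (fun _ => q X) u = markJump C q X u := by
  rw [Set.indicator_apply, markJump]
  by_cases h : u ≤ jumpRate C X
  · rw [if_pos h, if_pos ⟨hu, h⟩]
  · rw [if_neg h, if_neg fun h' => h h'.2]

open Classical in
-- If both jumps take place, q is Lipschitz. If exactly one does, u lies between the two rates, so
-- it is within L‖X - Y‖ of the rate at Y, and the cost is a single jump.
theorem IsCoefBound.norm_markJump_sub_le {H C : QMat} {F q : QMat → QMat} {L : ℝ}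
    (hL : IsCoefBound H C F q L) {X Y : QMat} (hY : IsState Y) (u : ℝ) :
    ‖markJump C q X u - markJump C q Y u‖
      ≤ L * ‖X - Y‖ + if |u - jumpRate C Y| ≤ L * ‖X - Y‖ then L else 0 := by
  have hL0 := hL.nonneg
  have hr := hL.rate_lipschitz X Y
  have hqY := hL.norm_jump_le Y hY
  have hq := hL.jump_lipschitz X Y
  have hif : 0 ≤ if |u - jumpRate C Y| ≤ L * ‖X - Y‖ then L else 0 := by
    split_ifs <;> simp [hL0]
  have hnn : 0 ≤ L * ‖X - Y‖ := by positivity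
  unfold markJump
  by_cases h1 : u ≤ jumpRate C X <;> by_cases h2 : u ≤ jumpRate C Y
  · rw [if_pos h1, if_pos h2]; linarith
  · have : |u - jumpRate C Y| ≤ L * ‖X - Y‖ := by
      rw [abs_of_pos (by linarith)]
      linarith [le_abs_self (jumpRate C X - jumpRate C Y)]
    rw [if_pos h1, if_neg h2, if_pos this, sub_zero]
    -- Only Y is a state, so the size of q X is controlled through q Y.
    calc ‖q X‖ = ‖(q X - q Y) + q Y‖ := by rw [sub_add_cancel]
      _ ≤ _ := (norm_add_le _ _).trans (add_le_add hq hqY)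
  · have : |u - jumpRate C Y| ≤ L * ‖X - Y‖ := by
      rw [abs_of_nonpos (by linarith)]
      linarith [neg_le_abs (jumpRate C X - jumpRate C Y)]
    rw [if_neg h1, if_pos h2, if_pos this, zero_sub, norm_neg]
    linarith
  · rw [if_neg h1, if_neg h2, sub_self, norm_zero]; linarith

theorem IsPointSet.eulerStep_eq {ν : Measure (ℝ × ℝ)} {K T : ℝ} {S : Finset (ℝ × ℝ)}
    (hS : IsPointSet ν K T S) (C : QMat) (F q : QMat → QMat) {a t : ℝ} (ha : 0 ≤ a) (ht : t ≤ T)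
    (θ : QMat) : eulerStep C F q K ν a t θ
      = θ + (t - a) • F θ + ∑ z ∈ S with z.1 ∈ Ioc a t, markJump C q θ z.2 := by
  classical
  rw [eulerStep, intervalIntegral.integral_const, hS.setIntegral
    (measurableSet_Ioc.prod measurableSet_Icc)
    (prod_mono (fun s hs => ⟨ha.trans hs.1.le, hs.2.trans ht⟩) subset_rfl)]
  congr 1
  refine Finset.sum_congr ?_ fun z hz => ?_
  · ext z
    simp only [Finset.mem_filter]
    exact ⟨fun h => ⟨h.1, h.2.1⟩, fun h => ⟨h.1, h.2, (hS.mark_mem z h.1).1.le,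
      (hS.mark_mem z h.1).2⟩⟩
  · exact indicator_eq_markJump C q θ (hS.mark_mem z (Finset.mem_filter.1 hz).1).1.le

namespace IsSolutionPath

variable {ν : Measure (ℝ × ℝ)} {H C : QMat} {K : ℝ} {ρ₀ : QMat} {x : ℝ → QMat}

theorem isState_leftLim' (hx : IsSolutionPath ν H C K ρ₀ x) (hH : H.IsHermitian)
    (hρ₀ : IsState ρ₀) {t : ℝ} (ht : 0 < t) : IsState (Function.leftLim x t) :=
  hx.isState_leftLim ht fun _ hs => hx.isState hH hρ₀ hs.1

theorem intervalIntegrable (hx : IsSolutionPath ν H C K ρ₀ x) (hH : H.IsHermitian)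
    (hρ₀ : IsState ρ₀) {a b : ℝ} (ha : 0 ≤ a) (hab : a ≤ b) :
    IntervalIntegrable (fun s => belavkinDrift H C (Function.leftLim x s)) volume a b := by
  obtain ⟨B, hB⟩ := exists_bound_drift H C
  exact hx.intervalIntegrable_drift ha hab fun s hs =>
    hB _ (hx.isState_leftLim' hH hρ₀ (ha.trans_lt hs.1))

variable {F q : QMat → QMat} {L : ℝ}

/-- A positive accepted mark forces a positive rate at a state, which is exactly where q is
prescribed. -/
theorem pathJump_eq (hx : IsSolutionPath ν H C K ρ₀ x) (hH : H.IsHermitian) (hρ₀ : IsState ρ₀)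
    (hq : IsLipschitzJump C q) {z : ℝ × ℝ} (hz : 0 < z.1) (hz' : 0 < z.2) :
    pathJump C x z = markJump C q (Function.leftLim x z.1) z.2 := by
  rw [pathJump, markJump, Set.indicator_apply]
  by_cases h : z.2 ≤ jumpRate C (Function.leftLim x z.1)
  · rw [if_pos h, if_pos ⟨hz'.le, h⟩]
    exact (hq.2 _ (hx.isState_leftLim' hH hρ₀ hz) (hz'.trans_le h)).symm
  · rw [if_neg h, if_neg fun h' => h h'.2]

open Classical in
theorem norm_sub_le (hx : IsSolutionPath ν H C K ρ₀ x) (hH : H.IsHermitian) (hρ₀ : IsState ρ₀)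
    (hq : IsLipschitzJump C q) (hL : IsCoefBound H C F q L) {T : ℕ} {S : Finset (ℝ × ℝ)}
    (hS : IsPointSet ν K T S) {a b : ℝ} (ha : 0 ≤ a) (hab : a ≤ b) (hb : b ≤ T) :
    ‖x b - x a‖ ≤ L * (b - a) + L * (S.filter (·.1 ∈ Ioc a b)).card := by
  have h1 : x b - x a = (∫ s in a..b, belavkinDrift H C (Function.leftLim x s))
      + ∑ z ∈ S with z.1 ∈ Ioc a b, pathJump C x z := by
    rw [hx.eq_add hS ha hab hb (hx.intervalIntegrable hH hρ₀ le_rfl (ha.trans hab))]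
    abel
  rw [h1]
  refine (norm_add_le _ _).trans (add_le_add ?_ ?_)
  · refine (intervalIntegral.norm_integral_le_of_norm_le_const fun s hs => ?_).trans
      (by rw [abs_of_nonneg (sub_nonneg.2 hab)])
    rw [uIoc_of_le hab] at hs
    exact hL.norm_drift_le _ (hx.isState_leftLim' hH hρ₀ (ha.trans_lt hs.1))
  · refine (norm_sum_le _ _).trans ((Finset.sum_le_card_nsmul _ _ L fun z hz => ?_).trans
      (by rw [nsmul_eq_mul, mul_comm]))
    rw [Finset.mem_filter] at hz
    rw [hx.pathJump_eq hH hρ₀ hq (hS.time_mem z hz.1).1 (hS.mark_mem z hz.1).1, markJump]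
    split_ifs
    · exact hL.norm_jump_le _ (hx.isState_leftLim' hH hρ₀ (hS.time_mem z hz.1).1)
    · simpa using hL.nonneg

/-- Counting over the open interval is the point: when s is the time of the only point of a step,
the count is zero and the left limit is within L(s - a) of the value at a. -/
theorem norm_leftLim_sub_le (hx : IsSolutionPath ν H C K ρ₀ x) (hH : H.IsHermitian)
    (hρ₀ : IsState ρ₀) (hq : IsLipschitzJump C q) (hL : IsCoefBound H C F q L) {T : ℕ}
    {S : Finset (ℝ × ℝ)} (hS : IsPointSet ν K T S) {a s : ℝ} (ha : 0 ≤ a) (has : a < s)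
    (hs : s ≤ T) :
    ‖Function.leftLim x s - x a‖ ≤ L * (s - a) + L * (S.filter (·.1 ∈ Ioo a s)).card := by
  refine le_of_tendsto ((hx.cadlag.tendsto_leftLim (ha.trans_lt has)).sub_const (x a)).norm ?_
  filter_upwards [Ioo_mem_nhdsLT has] with r hr
  refine (hx.norm_sub_le hH hρ₀ hq hL hS ha hr.1.le (hr.2.le.trans hs)).trans ?_
  have hL0 := hL.nonneg
  gcongr L * (?_ - a) + L * ?_
  · exact hr.2.le
  · exact Nat.cast_le.2 (Finset.card_le_card (Finset.monotone_filter_right S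
      fun z _ h => ⟨h.1, h.2.trans_lt hr.2⟩))

open Classical in
/-- Pathwise error of one step of the scheme over `(a,b]`. -/
theorem norm_eulerStep_sub_le (hx : IsSolutionPath ν H C K ρ₀ x) (hH : H.IsHermitian)
    (hρ₀ : IsState ρ₀) (hF : IsLipschitzDrift H C F) (hq : IsLipschitzJump C q)
    (hL : IsCoefBound H C F q L) {T : ℕ}
    {S : Finset (ℝ × ℝ)} (hS : IsPointSet ν K T S) {a b t : ℝ} (ha : 0 ≤ a) (hat : a ≤ t)
    (htb : t ≤ b) (hb : b ≤ T) (θ : QMat) {M V : ℕ} (hM : M = (S.filter (·.1 ∈ Ioc a b)).card)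
    (hV : V = ((S.filter (·.1 ∈ Ioc a b)).filter
      (fun z => |z.2 - jumpRate C (x a)| ≤ L * (‖θ - x a‖ + L * (b - a)))).card) :
    ‖eulerStep C F q K ν a t θ - x t‖ ≤ ‖θ - x a‖ + (L * (b - a) * ‖θ - x a‖ + (L * (b - a)) ^ 2
      + (L * ‖θ - x a‖ + 2 * L ^ 2 * (b - a)) * M + 2 * L * (M * (M - 1 : ℕ)) + 2 * L * V) := by
  set e := ‖θ - x a‖ with he
  set h := b - a with hh
  have hL0 := hL.nonneg
  have he0 : 0 ≤ e := norm_nonneg _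
  have hab : a ≤ b := hat.trans htb
  have hh0 : 0 ≤ h := sub_nonneg.2 hab
  have hxa : IsState (x a) := hx.isState hH hρ₀ ha
  set Q := S.filter (·.1 ∈ Ioc a b) with hQ
  have hleft : ∀ s ∈ Ioc a b, ‖Function.leftLim x s - x a‖
      ≤ L * h + L * (S.filter (·.1 ∈ Ioo a s)).card := fun s hs => by
    refine (hx.norm_leftLim_sub_le hH hρ₀ hq hL hS ha hs.1 (hs.2.trans hb)).trans ?_
    have : s - a ≤ h := by linarith [hs.2]
    gcongr
  have hleftM : ∀ s ∈ Ioc a b, ‖Function.leftLim x s - x a‖ ≤ L * h + L * M := fun s hs => by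
    refine (hleft s hs).trans ?_
    rw [hM]
    gcongr L * h + L * ?_
    exact Nat.cast_le.2 (Finset.card_le_card (Finset.monotone_filter_right S
      fun z _ h => ⟨h.1, h.2.le.trans hs.2⟩))
  have hdiff : eulerStep C F q K ν a t θ - x t = (θ - x a)
      + (∫ s in a..t, (F θ - belavkinDrift H C (Function.leftLim x s)))
      + ∑ z ∈ S with z.1 ∈ Ioc a t,
          (markJump C q θ z.2 - markJump C q (Function.leftLim x z.1) z.2) := by
    rw [hS.eulerStep_eq C F q ha (htb.trans hb), hx.eq_add hS ha hat (htb.trans hb)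
      (hx.intervalIntegrable hH hρ₀ le_rfl (ha.trans hat)),
      intervalIntegral.integral_sub intervalIntegrable_const
        (hx.intervalIntegrable hH hρ₀ ha hat), intervalIntegral.integral_const,
      Finset.sum_sub_distrib]
    have : ∑ z ∈ S with z.1 ∈ Ioc a t, pathJump C x z
        = ∑ z ∈ S with z.1 ∈ Ioc a t, markJump C q (Function.leftLim x z.1) z.2 :=
      Finset.sum_congr rfl fun z hz => by
        rw [Finset.mem_filter] at hz
        exact hx.pathJump_eq hH hρ₀ hq (hS.time_mem z hz.1).1 (hS.mark_mem z hz.1).1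
    rw [this]
    abel
  have hdrift : ‖∫ s in a..t, (F θ - belavkinDrift H C (Function.leftLim x s))‖
      ≤ L * (e + (L * h + L * M)) * h := by
    refine (intervalIntegral.norm_integral_le_of_norm_le_const
      (C := L * (e + (L * h + L * M))) fun s hs => ?_).trans ?_
    · rw [uIoc_of_le hat] at hs
      have hs' : s ∈ Ioc a b := ⟨hs.1, hs.2.trans htb⟩
      rw [← hF.2 _ (hx.isState_leftLim' hH hρ₀ (ha.trans_lt hs.1))]
      refine (hL.drift_lipschitz _ _).trans (mul_le_mul_of_nonneg_left ?_ hL0)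
      calc ‖θ - Function.leftLim x s‖ = ‖(θ - x a) - (Function.leftLim x s - x a)‖ := by
            congr 1; abel
        _ ≤ e + (L * h + L * M) := (_root_.norm_sub_le _ _).trans (add_le_add le_rfl (hleftM s hs'))
    · rw [abs_of_nonneg (sub_nonneg.2 hat)]
      have : t - a ≤ h := by linarith
      gcongr
  have hpt : ∀ z ∈ Q, ‖markJump C q θ z.2 - markJump C q (Function.leftLim x z.1) z.2‖
      ≤ (L * e + L ^ 2 * h) + (if |z.2 - jumpRate C (x a)| ≤ L * (e + L * h) then 2 * L else 0)
        + 2 * L * (M - 1 : ℕ) := fun z hz => by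
    have hz' := Finset.mem_filter.1 hz
    have hy := hx.isState_leftLim' hH hρ₀ (hS.time_mem z hz'.1).1
    have h1 := hL.norm_markJump_sub_le (X := θ) hxa z.2
    -- The comparison passes through x a because the band around its jump rate is known at time a,
    -- whereas the left limit at z depends on points inside the step.
    have htri : ‖markJump C q θ z.2 - markJump C q (Function.leftLim x z.1) z.2‖
        ≤ ‖markJump C q θ z.2 - markJump C q (x a) z.2‖
          + ‖markJump C q (Function.leftLim x z.1) z.2 - markJump C q (x a) z.2‖ := by
      rw [← norm_neg (markJump C q (Function.leftLim x z.1) z.2 - markJump C q (x a) z.2)]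
      refine le_trans (le_of_eq ?_) (norm_add_le _ _)
      congr 1; abel
    have hle1 : L * e ≤ L * (e + L * h) := by gcongr; linarith [mul_nonneg hL0 hh0]
    have hle2 : L * (L * h) ≤ L * (e + L * h) := by gcongr; linarith
    have hif1 : (if |z.2 - jumpRate C (x a)| ≤ L * e then L else 0)
        ≤ if |z.2 - jumpRate C (x a)| ≤ L * (e + L * h) then L else 0 := by
      split_ifs with h1 h2 h2
      · exact le_rfl
      · exact absurd (h1.trans hle1) h2
      · exact hL0
      · exact le_rfl
    have hif2 : (if |z.2 - jumpRate C (x a)| ≤ L * (L * h) then L else 0)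
        ≤ if |z.2 - jumpRate C (x a)| ≤ L * (e + L * h) then L else 0 := by
      split_ifs with h1 h2 h2
      · exact le_rfl
      · exact absurd (h1.trans hle2) h2
      · exact hL0
      · exact le_rfl
    have hsplit : (if |z.2 - jumpRate C (x a)| ≤ L * (e + L * h) then 2 * L else 0)
        = (if |z.2 - jumpRate C (x a)| ≤ L * (e + L * h) then L else 0)
          + if |z.2 - jumpRate C (x a)| ≤ L * (e + L * h) then L else 0 := by
      split_ifs <;> ring
    have hif0 : 0 ≤ if |z.2 - jumpRate C (x a)| ≤ L * (e + L * h) then L else 0 := by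
      split_ifs <;> simp [hL0]
    have hM1 : 1 ≤ M := by rw [hM]; exact Finset.card_pos.2 ⟨z, hz⟩
    -- With at least two points in the step, the crude bound 2L is absorbed by the term in M - 1;
    -- with exactly one, the left limit at z is within L h of x a.
    rcases hM1.lt_or_eq with hM2 | hM2
    · have hbd : ∀ ρ, IsState ρ → ‖markJump C q ρ z.2‖ ≤ L := fun ρ hρ => by
        rw [markJump]
        split_ifs
        · exact hL.norm_jump_le ρ hρ
        · simpa using hL0
      have h2 : ‖markJump C q (Function.leftLim x z.1) z.2 - markJump C q (x a) z.2‖ ≤ 2 * L :=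
        (_root_.norm_sub_le _ _).trans (by linarith [hbd _ hy, hbd _ hxa])
      have h3 : 2 * L ≤ 2 * L * (M - 1 : ℕ) := by
        have : (1 : ℝ) ≤ (M - 1 : ℕ) := by exact_mod_cast (by omega : 1 ≤ M - 1)
        nlinarith
      have h4 : 0 ≤ L ^ 2 * h := by positivity
      rw [hsplit]
      linarith
    · have hcard : (S.filter (·.1 ∈ Ioo a z.1)).card = 0 := by
        rw [Finset.card_eq_zero, Finset.filter_eq_empty_iff]
        intro w hw hwz
        have hwQ : w ∈ Q := Finset.mem_filter.2 ⟨hw, hwz.1, hwz.2.le.trans hz'.2.2⟩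
        have := Finset.card_le_one.1 (show Q.card ≤ 1 by rw [← hM, ← hM2]) w hwQ z hz
        exact hwz.2.ne (congrArg Prod.fst this)
      have hd := hleft z.1 hz'.2
      rw [hcard, Nat.cast_zero, mul_zero, add_zero] at hd
      have h2 := hL.norm_markJump_sub_le (X := Function.leftLim x z.1) hxa z.2
      have hd2 : L * ‖Function.leftLim x z.1 - x a‖ ≤ L * (L * h) := by gcongr
      have hif3 : (if |z.2 - jumpRate C (x a)| ≤ L * ‖Function.leftLim x z.1 - x a‖ then L else 0)
          ≤ if |z.2 - jumpRate C (x a)| ≤ L * (L * h) then L else 0 := by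
        split_ifs with h1 h2 h2
        · exact le_rfl
        · exact absurd (h1.trans hd2) h2
        · exact hL0
        · exact le_rfl
      have h4 : (0 : ℝ) ≤ 2 * L * (M - 1 : ℕ) := by positivity
      rw [hsplit]
      nlinarith
  -- Enlarging the sum to the whole step makes the bound independent of t, which later yields the
  -- supremum over the step.
  have hsub : S.filter (·.1 ∈ Ioc a t) ⊆ Q := by
    exact Finset.monotone_filter_right S fun z _ h => ⟨h.1, h.2.trans htb⟩
  have hjump : ‖∑ z ∈ S with z.1 ∈ Ioc a t,
      (markJump C q θ z.2 - markJump C q (Function.leftLim x z.1) z.2)‖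
      ≤ (L * e + L ^ 2 * h) * M + 2 * L * V + 2 * L * (M * (M - 1 : ℕ)) := by
    calc _ ≤ ∑ z ∈ S with z.1 ∈ Ioc a t,
        ‖markJump C q θ z.2 - markJump C q (Function.leftLim x z.1) z.2‖ := norm_sum_le _ _
      _ ≤ ∑ z ∈ Q, ‖markJump C q θ z.2 - markJump C q (Function.leftLim x z.1) z.2‖ :=
        Finset.sum_le_sum_of_subset_of_nonneg hsub fun _ _ _ => norm_nonneg _
      _ ≤ _ := Finset.sum_le_sum hpt
      _ = _ := by
        rw [Finset.sum_add_distrib, Finset.sum_add_distrib, Finset.sum_const, Finset.sum_const,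
          ← Finset.sum_filter, Finset.sum_const, ← hM, ← hV]
        simp only [nsmul_eq_mul]
        ring
  rw [hdiff]
  refine (norm_add₃_le.trans (add_le_add (add_le_add le_rfl hdrift) hjump)).trans (le_of_eq ?_)
  ring

end IsSolutionPath

/-! ## Adaptedness of the scheme -/

/-- An open half-line is the directed union of the rational half-lines it contains, so the mass
above a random threshold is a countable supremum. Continuity from below needs no finiteness of the
measure, hence the use of marks above the threshold. -/
theorem measurable_apply_Ioc_prod_inter_Ioi {Ω : Type*} [MeasurableSpace Ω]
    {κ : Ω → Measure (ℝ × ℝ)} {a t : ℝ} {B : Set ℝ} (hB : MeasurableSet B)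
    (hκ : ∀ A, MeasurableSet A → A ⊆ Ioc a t ×ˢ univ → Measurable fun ω => κ ω A)
    {γ : Ω → ℝ} (hγ : Measurable γ) :
    Measurable fun ω => κ ω (Ioc a t ×ˢ (B ∩ Ioi (γ ω))) := by
  have h : ∀ ω, κ ω (Ioc a t ×ˢ (B ∩ Ioi (γ ω)))
      = ⨆ r : ℚ, {ω | γ ω < r}.indicator (fun ω => κ ω (Ioc a t ×ˢ (B ∩ Ioi (r : ℝ)))) ω := by
    intro ω
    refine le_antisymm ?_ (iSup_le fun r => ?_)
    · have hU : Ioc a t ×ˢ (B ∩ Ioi (γ ω))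
          = ⋃ r : {r : ℚ // γ ω < r}, Ioc a t ×ˢ (B ∩ Ioi ((r : ℚ) : ℝ)) := by
        ext z
        simp only [mem_prod, mem_inter_iff, mem_Ioi, mem_iUnion]
        constructor
        · rintro ⟨h1, h2, h3⟩
          obtain ⟨r, hr, hr'⟩ := exists_rat_btwn h3
          exact ⟨⟨r, hr⟩, h1, h2, hr'⟩
        · rintro ⟨r, h1, h2, h3⟩
          exact ⟨h1, h2, r.2.trans h3⟩
      rw [hU, Directed.measure_iUnion]
      · refine iSup_le fun r => ?_
        refine le_trans ?_ (le_iSup _ (r : ℚ))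
        rw [indicator_of_mem (show ω ∈ {ω | γ ω < ((r : ℚ) : ℝ)} from r.2)]
      · intro r s
        rcases le_total (r : ℚ) s with hrs | hrs
        · refine ⟨r, subset_rfl, prod_mono subset_rfl (inter_subset_inter_right _ ?_)⟩
          exact Ioi_subset_Ioi (by exact_mod_cast hrs)
        · refine ⟨s, prod_mono subset_rfl (inter_subset_inter_right _ ?_), subset_rfl⟩
          exact Ioi_subset_Ioi (by exact_mod_cast hrs)
    · by_cases hr : γ ω < r
      · rw [indicator_of_mem (show ω ∈ {ω | γ ω < (r : ℝ)} from hr)]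
        exact measure_mono (prod_mono subset_rfl (inter_subset_inter_right _
          (Ioi_subset_Ioi hr.le)))
      · rw [indicator_of_notMem (show ω ∉ {ω | γ ω < (r : ℝ)} from hr)]
        exact bot_le
  simp only [h]
  refine Measurable.iSup fun r => (hκ _ (measurableSet_Ioc.prod (hB.inter measurableSet_Ioi))
    (prod_mono subset_rfl (subset_univ _))).indicator (measurableSet_lt hγ measurable_const)

/-- A version of `eulerStep` which is measurable also where the random measure is infinite. -/
noncomputable def eulerStepVersion (C : QMat) (F q : QMat → QMat) (K : ℝ) (ν : Measure (ℝ × ℝ))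
    (a t : ℝ) (θ : QMat) : QMat :=
  θ + (t - a) • F θ + (ν (Ioc a t ×ˢ Icc 0 K)
    - ν (Ioc a t ×ˢ (Icc 0 K ∩ Ioi (jumpRate C θ)))).toReal • q θ

theorem eulerStep_eq_eulerStepVersion (C : QMat) (F q : QMat → QMat) {K : ℝ}
    {ν : Measure (ℝ × ℝ)} {a t : ℝ} (hν : ν (Ioc a t ×ˢ Icc 0 K) < ∞) (θ : QMat) :
    eulerStep C F q K ν a t θ = eulerStepVersion C F q K ν a t θ := by
  rw [eulerStep, eulerStepVersion, intervalIntegral.integral_const]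
  congr 1
  have h1 : ∀ z : ℝ × ℝ, (Icc 0 (jumpOp C θ).trace.re).indicator (fun _ => q θ) z.2
      = (univ ×ˢ Icc 0 (jumpRate C θ) : Set (ℝ × ℝ)).indicator (fun _ => q θ) z := fun z => by
    simp [Set.indicator_apply, jumpRate]
  simp only [h1]
  rw [setIntegral_indicator (MeasurableSet.univ.prod measurableSet_Icc), setIntegral_const,
    measureReal_def]
  congr 2
  have h2 : Ioc a t ×ˢ Icc 0 K ∩ univ ×ˢ Icc 0 (jumpRate C θ)
      = Ioc a t ×ˢ Icc 0 K \ Ioc a t ×ˢ (Icc 0 K ∩ Ioi (jumpRate C θ)) := by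
    ext z
    simp only [mem_inter_iff, mem_prod, mem_Icc, mem_univ, true_and, Set.mem_sdiff, mem_Ioi]
    grind
  have h3 : Ioc a t ×ˢ (Icc 0 K ∩ Ioi (jumpRate C θ)) ⊆ Ioc a t ×ˢ Icc 0 K :=
    prod_mono subset_rfl inter_subset_left
  rw [h2, measure_sdiff h3
    (measurableSet_Ioc.prod (measurableSet_Icc.inter measurableSet_Ioi)).nullMeasurableSet
    ((measure_mono h3).trans_lt hν).ne]

theorem stronglyMeasurable_eulerStepVersion {Ω : Type*} [MeasurableSpace Ω] (C : QMat)
    {F q : QMat → QMat} (hF : Continuous F) (hq : Continuous q) (K : ℝ)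
    {κ : Ω → Measure (ℝ × ℝ)} {a t : ℝ}
    (hκ : ∀ A, MeasurableSet A → A ⊆ Ioc a t ×ˢ univ → Measurable fun ω => κ ω A)
    {θ : Ω → QMat} (hθ : StronglyMeasurable θ) :
    StronglyMeasurable fun ω => eulerStepVersion C F q K (κ ω) a t (θ ω) := by
  have hγ : Measurable fun ω => jumpRate C (θ ω) :=
    ((continuous_jumpRate C).comp_stronglyMeasurable hθ).measurable
  have hc : Measurable fun ω => (κ ω (Ioc a t ×ˢ Icc 0 K)
      - κ ω (Ioc a t ×ˢ (Icc 0 K ∩ Ioi (jumpRate C (θ ω))))).toReal :=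
    ((hκ _ (measurableSet_Ioc.prod measurableSet_Icc) (prod_mono subset_rfl (subset_univ _))).sub
      (measurable_apply_Ioc_prod_inter_Ioi measurableSet_Icc hκ hγ)).ennreal_toReal
  exact (hθ.add ((hF.comp_stronglyMeasurable hθ).const_smul (t - a))).add
    (hc.stronglyMeasurable.smul (hq.comp_stronglyMeasurable hθ))

namespace IsPoissonRandomMeasure

variable {Ω : Type*} [mΩ : MeasurableSpace Ω] {P : Measure Ω}
  {𝓕 : Filtration ℝ≥0 mΩ} {N : Ω → Measure (ℝ × ℝ)}

/-- The filtration is not assumed complete, and the step agrees with a measurable expression only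
where N is finite on the strip; adaptedness is therefore carried by a version equal almost surely.
-/
theorem exists_version_eulerStep (hN : IsPoissonRandomMeasure P 𝓕 N) (C : QMat)
    {F q : QMat → QMat} (hF : Continuous F) (hq : Continuous q) (K : ℝ) {a t : ℝ≥0} (hat : a ≤ t)
    {θ θ' : Ω → QMat} (hθ' : StronglyMeasurable[𝓕 a] θ') (hθ : θ =ᵐ[P] θ') :
    ∃ η, StronglyMeasurable[𝓕 t] η ∧
      (fun ω => eulerStep C F q K (N ω) a t (θ ω)) =ᵐ[P] η := by
  refine ⟨fun ω => eulerStepVersion C F q K (N ω) a t (θ' ω),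
    @stronglyMeasurable_eulerStepVersion Ω (𝓕 t) C F q hF hq K N a t (fun A hA hA' =>
      hN.adapted t A hA (hA'.trans (prod_mono (fun s hs =>
        ⟨(NNReal.coe_nonneg a).trans hs.1.le, hs.2⟩) subset_rfl))) θ' (hθ'.mono (𝓕.mono hat)), ?_⟩
  have hvol : volume (Ioc (a : ℝ) t ×ˢ Icc 0 K) < ∞ := by
    simpa using volume_strip_lt_top a t K univ
  filter_upwards [hθ, hN.ae_lt_top (measurableSet_Ioc.prod measurableSet_Icc)
    (prod_mono (fun s hs => (NNReal.coe_nonneg a).trans hs.1.le) (subset_univ _)) hvol]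
    with ω hω hfin
  rw [eulerStep_eq_eulerStepVersion C F q hfin, hω]

theorem exists_version_eulerScheme (hN : IsPoissonRandomMeasure P 𝓕 N) (C : QMat)
    {F q : QMat → QMat} (hF : Continuous F) (hq : Continuous q) (K : ℝ) (ρ₀ : QMat) (n k : ℕ) :
    ∃ η, StronglyMeasurable[𝓕 ((k : ℝ≥0) / n)] η ∧
      (fun ω => eulerScheme C F q K ρ₀ (N ω) n k) =ᵐ[P] η := by
  induction k with
  | zero => exact ⟨fun _ => ρ₀, stronglyMeasurable_const, Eventually.of_forall fun ω => rfl⟩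
  | succ k ih =>
    obtain ⟨η, hη, hη'⟩ := ih
    have hle : (k : ℝ≥0) / n ≤ ((k + 1 : ℕ) : ℝ≥0) / n := by gcongr; simp
    have := hN.exists_version_eulerStep C hF hq K hle hη hη'
    simpa only [eulerScheme, NNReal.coe_div, NNReal.coe_natCast] using this

theorem aestronglyMeasurable_eulerPath (hN : IsPoissonRandomMeasure P 𝓕 N) (C : QMat)
    {F q : QMat → QMat} (hF : Continuous F) (hq : Continuous q) (K : ℝ) (ρ₀ : QMat) {n : ℕ}
    (hn : 1 ≤ n) {t : ℝ} (ht : 0 ≤ t) :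
    AEStronglyMeasurable (fun ω => eulerPath C F q K ρ₀ (N ω) n t) P := by
  lift t to ℝ≥0 using ht
  obtain ⟨η, hη, hη'⟩ := hN.exists_version_eulerScheme C hF hq K ρ₀ n ⌊(n : ℝ) * t⌋₊
  have hn' : (0 : ℝ) < n := by exact_mod_cast hn
  have hle : ((⌊(n : ℝ) * t⌋₊ : ℕ) : ℝ≥0) / n ≤ t := by
    rw [← NNReal.coe_le_coe, NNReal.coe_div, NNReal.coe_natCast, NNReal.coe_natCast,
      div_le_iff₀ hn', mul_comm]
    exact Nat.floor_le (by positivity)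
  obtain ⟨ζ, hζ, hζ'⟩ := hN.exists_version_eulerStep C hF hq K hle hη hη'
  refine ⟨ζ, hζ.mono (𝓕.le t), ?_⟩
  simpa only [eulerPath, NNReal.coe_div, NNReal.coe_natCast] using hζ'

end IsPoissonRandomMeasure

/-! ## The expected error of one step -/

section StepError

variable {Ω : Type*} [mΩ : MeasurableSpace Ω] {P : Measure Ω}
  {𝓕 : Filtration ℝ≥0 mΩ} {N : Ω → Measure (ℝ × ℝ)} {H C : QMat} {K : ℝ} {ρ₀ : QMat}
  {m : ℝ → Ω → QMat}

theorem IsJumpBelavkinSolution.ae_isSolutionPath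
    (hm : IsJumpBelavkinSolution P 𝓕 N H C K ρ₀ m) (hN : IsPoissonRandomMeasure P 𝓕 N) :
    ∀ᵐ ω ∂P, IsSolutionPath (N ω) H C K ρ₀ fun t => m t ω := by
  filter_upwards [hm.equation, hN.ae_exists_isPointSet K] with ω h1 h2
  exact ⟨h2, hm.cadlag ω, h1⟩

/-- The bound for the increase of the error in one step, in terms of the error `e` at the start of
the step, the number `M` of points in the step and the number `V` of those whose mark is close to
the rate of jumps; `l` is the constant of `IsCoefBound` and `h` the length of the step. -/
noncomputable def stepError (l h e M V : ℝ≥0∞) : ℝ≥0∞ :=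
  l * h * e + (l * h) ^ 2 + l * (e * M) + 2 * l ^ 2 * h * M + 2 * l * (M * (M - 1)) + 2 * l * V

/-- The pathwise bound with the cardinalities rewritten as masses of N, so that expectations can be
taken term by term. -/
theorem IsSolutionPath.enorm_eulerStep_sub_le {ν : Measure (ℝ × ℝ)} {x : ℝ → QMat}
    (hx : IsSolutionPath ν H C K ρ₀ x) (hH : H.IsHermitian)
    (hρ₀ : IsState ρ₀) {F q : QMat → QMat} (hF : IsLipschitzDrift H C F) (hq : IsLipschitzJump C q)
    {L : ℝ} (hL : IsCoefBound H C F q L) {a b t : ℝ} (ha : 0 ≤ a) (hat : a ≤ t) (htb : t ≤ b)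
    (θ : QMat) :
    ‖eulerStep C F q K ν a t θ - x t‖ₑ ≤ ‖θ - x a‖ₑ + stepError (ENNReal.ofReal L)
      (ENNReal.ofReal (b - a)) ‖θ - x a‖ₑ (ν (Ioc a b ×ˢ Icc 0 K))
      (ν (Ioc a b ×ˢ ({u | |u - jumpRate C (x a)| ≤ L * (‖θ - x a‖ + L * (b - a))} ∩ Icc 0 K))) := by
  classical
  obtain ⟨T, hT⟩ := exists_nat_ge b
  obtain ⟨S, hS⟩ := hx.points T
  have hh : 0 ≤ b - a := by linarith
  have hsub : ∀ B : Set ℝ, Ioc a b ×ˢ (B ∩ Icc 0 K) ⊆ Icc (0 : ℝ) T ×ˢ Icc 0 K := fun B =>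
    prod_mono (fun s hs => ⟨ha.trans hs.1.le, hs.2.trans hT⟩) inter_subset_right
  have hcount : ∀ B : Set ℝ, MeasurableSet B → ν (Ioc a b ×ˢ (B ∩ Icc 0 K))
      = (((S.filter (·.1 ∈ Ioc a b)).filter (·.2 ∈ B)).card : ℝ≥0∞) := fun B hB => by
    rw [hS.apply (measurableSet_Ioc.prod (hB.inter measurableSet_Icc)) (hsub B)]
    congr 2
    ext z
    simp only [Finset.mem_filter, mem_prod, mem_inter_iff]
    exact ⟨fun h => ⟨⟨h.1, h.2.1⟩, h.2.2.1⟩, fun h => ⟨h.1.1, h.1.2, h.2,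
      (hS.mark_mem z h.1.1).1.le, (hS.mark_mem z h.1.1).2⟩⟩
  have hM : ν (Ioc a b ×ˢ Icc 0 K) = ((S.filter (·.1 ∈ Ioc a b)).card : ℝ≥0∞) := by
    simpa using hcount univ MeasurableSet.univ
  have hb : MeasurableSet {u | |u - jumpRate C (x a)| ≤ L * (‖θ - x a‖ + L * (b - a))} :=
    measurableSet_le (by fun_prop) (by fun_prop)
  have hmain := hx.norm_eulerStep_sub_le hH hρ₀ hF hq hL hS ha hat htb hT θ rfl rfl
  rw [hM, hcount _ hb]
  simp only [Set.mem_ofPred_eq]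
  set M := (S.filter (·.1 ∈ Ioc a b)).card
  set V := ((S.filter (·.1 ∈ Ioc a b)).filter
      (fun z => |z.2 - jumpRate C (x a)| ≤ L * (‖θ - x a‖ + L * (b - a)))).card
  have hL0 := hL.nonneg
  rw [← ofReal_norm]
  refine (ENNReal.ofReal_le_ofReal hmain).trans (le_of_eq ?_)
  rw [← ofReal_norm]
  have e1 : ((M : ℝ≥0∞) - 1) = ENNReal.ofReal ((M - 1 : ℕ) : ℝ) := by
    rw [ENNReal.ofReal_natCast, ENNReal.natCast_sub, Nat.cast_one]
  have e2 : (M : ℝ≥0∞) = ENNReal.ofReal M := (ENNReal.ofReal_natCast _).symm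
  have e3 : (V : ℝ≥0∞) = ENNReal.ofReal V := (ENNReal.ofReal_natCast _).symm
  have e4 : (2 : ℝ≥0∞) = ENNReal.ofReal 2 := by simp
  rw [stepError, e1, e2, e3, e4, ← ENNReal.ofReal_mul hL0, ← ENNReal.ofReal_mul (by positivity),
    ← ENNReal.ofReal_pow (by positivity), ← ENNReal.ofReal_mul (by positivity),
    ← ENNReal.ofReal_mul hL0, ← ENNReal.ofReal_pow hL0, ← ENNReal.ofReal_mul (by positivity),
    ← ENNReal.ofReal_mul (by positivity), ← ENNReal.ofReal_mul (by positivity),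
    ← ENNReal.ofReal_mul (by positivity), ← ENNReal.ofReal_mul (by positivity),
    ← ENNReal.ofReal_mul (by positivity), ← ENNReal.ofReal_mul (by positivity),
    ← ENNReal.ofReal_add (by positivity) (by positivity),
    ← ENNReal.ofReal_add (by positivity) (by positivity),
    ← ENNReal.ofReal_add (by positivity) (by positivity),
    ← ENNReal.ofReal_add (by positivity) (by positivity),
    ← ENNReal.ofReal_add (by positivity) (by positivity),
    ← ENNReal.ofReal_add (by positivity) (by positivity)]
  congr 1
  ring

/-- The rate of growth of the expected error. -/
noncomputable def errorRate (L K : ℝ) : ℝ :=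
  L + L * K + 4 * L ^ 2 + L ^ 2 + 2 * L ^ 2 * K + 2 * L * K ^ 2 + 4 * L ^ 3

/-- The error at time a is independent of the number of points in the step, so their product has
mean E e · hK. The second factorial moment handles M(M - 1), and the band count is integrated with a
width frozen at time a. -/
theorem exists_stepError_bound [IsProbabilityMeasure P] (hN : IsPoissonRandomMeasure P 𝓕 N)
    (hH : H.IsHermitian) (hρ₀ : IsState ρ₀) (hK : 0 ≤ K)
    (hm : IsJumpBelavkinSolution P 𝓕 N H C K ρ₀ m)
    {F q : QMat → QMat} (hF : IsLipschitzDrift H C F) (hq : IsLipschitzJump C q)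
    {L : ℝ} (hL : IsCoefBound H C F q L) {a b : ℝ≥0} (hab : a ≤ b)
    {θ θ' : Ω → QMat} (hθ' : StronglyMeasurable[𝓕 a] θ') (hθ : θ =ᵐ[P] θ') :
    ∃ Q : Ω → ℝ≥0∞, AEMeasurable Q P ∧
      (∀ᵐ ω ∂P, ∀ t ∈ Icc (a : ℝ) b, ‖eulerStep C F q K (N ω) a t (θ ω) - m t ω‖ₑ
        ≤ ‖θ ω - m a ω‖ₑ + Q ω) ∧
      ∫⁻ ω, Q ω ∂P ≤ ENNReal.ofReal (errorRate L K) * ENNReal.ofReal (b - a)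
        * (∫⁻ ω, ‖θ ω - m a ω‖ₑ ∂P + ENNReal.ofReal (b - a)) := by
  have hL0 := hL.nonneg
  have hh : (0 : ℝ) ≤ b - a := sub_nonneg.2 (by exact_mod_cast hab)
  have hma : StronglyMeasurable[𝓕 a] (m a) := hm.adapted a
  have hd : StronglyMeasurable[𝓕 a] fun ω => θ' ω - m a ω := hθ'.sub hma
  have hn : Measurable[𝓕 a] fun ω => ‖θ' ω - m a ω‖ := hd.norm.measurable
  have he : Measurable[𝓕 a] fun ω => ‖θ' ω - m a ω‖ₑ := hd.enorm
  have hc : Measurable[𝓕 a] fun ω => jumpRate C (m a ω) :=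
    ((continuous_jumpRate C).comp_stronglyMeasurable hma).measurable
  have hr : Measurable[𝓕 a] fun ω => L * (‖θ' ω - m a ω‖ + L * (b - a)) :=
    (hn.add_const _).const_mul _
  have hbox : MeasurableSet (Ioc (a : ℝ) b ×ˢ Icc 0 K) := measurableSet_Ioc.prod measurableSet_Icc
  have hsub : Ioc (a : ℝ) b ×ˢ Icc 0 K ⊆ Ioi (a : ℝ) ×ˢ univ :=
    prod_mono (fun t ht => ht.1) (subset_univ _)
  have hsub' : Ioc (a : ℝ) b ×ˢ Icc 0 K ⊆ Ici 0 ×ˢ univ :=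
    prod_mono (fun t ht => (NNReal.coe_nonneg a).trans ht.1.le) (subset_univ _)
  have hvol : volume (Ioc (a : ℝ) b ×ˢ Icc 0 K) = ENNReal.ofReal (b - a) * ENNReal.ofReal K := by
    simpa using IsPoissonRandomMeasure.volume_strip a b K univ
  have hfin : volume (Ioc (a : ℝ) b ×ˢ Icc 0 K) < ∞ := by
    rw [hvol]; exact ENNReal.mul_lt_top ENNReal.ofReal_lt_top ENNReal.ofReal_lt_top
  obtain ⟨hVm, hVi⟩ := hN.lintegral_band_le a b K hc hr
  have hMm := hN.measurable _ hbox
  have hem : Measurable fun ω => ‖θ' ω - m a ω‖ₑ := he.mono (𝓕.le a) le_rfl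
  refine ⟨fun ω => stepError (ENNReal.ofReal L) (ENNReal.ofReal (b - a)) ‖θ' ω - m a ω‖ₑ
    (N ω (Ioc (a : ℝ) b ×ˢ Icc 0 K)) (N ω (Ioc (a : ℝ) b ×ˢ
      ({u | |u - jumpRate C (m a ω)| ≤ L * (‖θ' ω - m a ω‖ + L * (b - a))} ∩ Icc 0 K))), ?_, ?_, ?_⟩
  · unfold stepError
    refine AEMeasurable.add ?_ (hVm.const_mul _)
    exact Measurable.aemeasurable (by fun_prop)
  · filter_upwards [hθ, hm.ae_isSolutionPath hN] with ω hω hx t ht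
    rw [hω]
    exact hx.enorm_eulerStep_sub_le hH hρ₀ hF hq hL (NNReal.coe_nonneg a) ht.1 ht.2 (θ' ω)
  · have hE : ∫⁻ ω, ‖θ ω - m a ω‖ₑ ∂P = ∫⁻ ω, ‖θ' ω - m a ω‖ₑ ∂P :=
      lintegral_congr_ae (hθ.mono fun ω hω => by simp only [hω])
    rw [hE]
    set E := ∫⁻ ω, ‖θ' ω - m a ω‖ₑ ∂P with hEdef
    set l := ENNReal.ofReal L with hl
    set h := ENNReal.ofReal ((b : ℝ) - a) with hhdef
    set κ := ENNReal.ofReal K with hκ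
    have hr' : ∫⁻ ω, ENNReal.ofReal (2 * (L * (‖θ' ω - m a ω‖ + L * (b - a)))) ∂P
        = 2 * l * (E + l * h) := by
      have : ∀ ω, ENNReal.ofReal (2 * (L * (‖θ' ω - m a ω‖ + L * (b - a))))
          = 2 * l * (‖θ' ω - m a ω‖ₑ + l * h) := fun ω => by
        rw [ENNReal.ofReal_mul (by norm_num), ENNReal.ofReal_mul hL0,
          ENNReal.ofReal_add (norm_nonneg _) (by positivity), ENNReal.ofReal_mul hL0,
          ofReal_norm, ENNReal.ofReal_ofNat, mul_assoc]
      simp only [this]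
      rw [lintegral_const_mul _ (hem.add_const _), lintegral_add_right _ measurable_const,
        lintegral_const, measure_univ, mul_one]
    rw [hr'] at hVi
    have hMi : ∫⁻ ω, N ω (Ioc (a : ℝ) b ×ˢ Icc 0 K) ∂P = h * κ := by
      rw [hN.lintegral_apply hbox hsub' hfin, hvol]
    have hMMi : ∫⁻ ω, N ω (Ioc (a : ℝ) b ×ˢ Icc 0 K) * (N ω (Ioc (a : ℝ) b ×ˢ Icc 0 K) - 1) ∂P
        = h * κ * (h * κ) := by
      rw [hN.lintegral_apply_mul_sub_one hbox hsub' hfin, hvol]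
    have heMi : ∫⁻ ω, ‖θ' ω - m a ω‖ₑ * N ω (Ioc (a : ℝ) b ×ˢ Icc 0 K) ∂P = E * (h * κ) := by
      rw [hN.lintegral_mul_apply hbox hsub hfin he, hvol]
    unfold stepError
    rw [lintegral_add_left (by fun_prop), lintegral_add_left (by fun_prop),
      lintegral_add_left (by fun_prop), lintegral_add_left (by fun_prop),
      lintegral_add_left (by fun_prop), lintegral_const_mul _ hem, lintegral_const, measure_univ,
      mul_one, lintegral_const_mul _ (by fun_prop), heMi, lintegral_const_mul _ hMm, hMi,
      lintegral_const_mul _ (by fun_prop), hMMi, lintegral_const_mul'' _ hVm]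
    have hrate : ENNReal.ofReal (errorRate L K) = l + l * κ + 4 * l ^ 2 + l ^ 2 + 2 * l ^ 2 * κ
        + 2 * l * κ ^ 2 + 4 * l ^ 3 := by
      have e4 : (4 : ℝ≥0∞) = ENNReal.ofReal 4 := by simp
      have e2 : (2 : ℝ≥0∞) = ENNReal.ofReal 2 := by simp
      rw [errorRate, e2, e4, hl, hκ, ← ENNReal.ofReal_pow hL0, ← ENNReal.ofReal_pow hL0,
        ← ENNReal.ofReal_pow hK, ← ENNReal.ofReal_mul hL0, ← ENNReal.ofReal_mul (by positivity),
        ← ENNReal.ofReal_mul (by positivity), ← ENNReal.ofReal_mul (by positivity),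
        ← ENNReal.ofReal_mul (by positivity), ← ENNReal.ofReal_mul (by positivity),
        ← ENNReal.ofReal_mul (by positivity),
        ← ENNReal.ofReal_add (by positivity) (by positivity),
        ← ENNReal.ofReal_add (by positivity) (by positivity),
        ← ENNReal.ofReal_add (by positivity) (by positivity),
        ← ENNReal.ofReal_add (by positivity) (by positivity),
        ← ENNReal.ofReal_add (by positivity) (by positivity),
        ← ENNReal.ofReal_add (by positivity) (by positivity)]
    rw [hrate]
    calc _ ≤ l * h * E + (l * h) ^ 2 + l * (E * (h * κ)) + 2 * l ^ 2 * h * (h * κ)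
          + 2 * l * (h * κ * (h * κ)) + 2 * l * (h * (2 * l * (E + l * h))) := by gcongr
      -- The mean consists of terms in h E and terms in h². The terms added here give both the same
      -- coefficient `errorRate`, so that E + h factors out.
      _ ≤ (l * h * E + (l * h) ^ 2 + l * (E * (h * κ)) + 2 * l ^ 2 * h * (h * κ)
          + 2 * l * (h * κ * (h * κ)) + 2 * l * (h * (2 * l * (E + l * h))))
          + (h * h * (l + l * κ + 4 * l ^ 2)
            + h * E * (l ^ 2 + 2 * l ^ 2 * κ + 2 * l * κ ^ 2 + 4 * l ^ 3)) := le_self_add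
      _ = _ := by ring

end StepError

/-! ## Regularity of the interpolated scheme -/

section EulerPath

variable {ν : Measure (ℝ × ℝ)} {K : ℝ}

theorem continuousWithinAt_eulerStep (hν : ∀ T : ℕ, ∃ S, IsPointSet ν K T S) (C : QMat)
    (F q : QMat → QMat) (θ : QMat) {a t : ℝ} (ha : 0 ≤ a) :
    ContinuousWithinAt (fun s => eulerStep C F q K ν a s θ) (Ici t) t := by
  classical
  obtain ⟨T, hT⟩ := exists_nat_gt t
  obtain ⟨S, hS⟩ := hν T
  have hc : ContinuousWithinAt (fun s => θ + (s - a) • F θ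
      + ∑ z ∈ S with z.1 ∈ Ioc a t, markJump C q θ z.2) (Ici t) t :=
    Continuous.continuousWithinAt (by fun_prop)
  refine hc.congr_of_eventuallyEq ?_ (hS.eulerStep_eq C F q ha hT.le θ)
  have hev : ∀ᶠ s in 𝓝[≥] t, ∀ z ∈ S, z.1 ∈ Ioc a s ↔ z.1 ∈ Ioc a t := by
    rw [Filter.eventually_all_finset]
    intro z _
    by_cases hz : z.1 ≤ t
    · filter_upwards [self_mem_nhdsWithin] with s hs
      exact ⟨fun h => ⟨h.1, hz⟩, fun h => ⟨h.1, hz.trans hs⟩⟩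
    · filter_upwards [Ico_mem_nhdsGE (not_le.1 hz)] with s hs
      exact ⟨fun h => absurd h.2 (not_le.2 hs.2), fun h => absurd h.2 hz⟩
  filter_upwards [hev, Ico_mem_nhdsGE hT] with s hs hsT
  rw [hS.eulerStep_eq C F q ha hsT.2.le θ, Finset.filter_congr hs]

/-- Just before t the points counted are those in the open interval (a,t), so the step is affine
there. -/
theorem exists_tendsto_eulerStep (hν : ∀ T : ℕ, ∃ S, IsPointSet ν K T S) (C : QMat)
    (F q : QMat → QMat) (θ : QMat) {a t : ℝ} (ha : 0 ≤ a) :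
    ∃ l, Tendsto (fun s => eulerStep C F q K ν a s θ) (𝓝[<] t) (𝓝 l) := by
  classical
  obtain ⟨T, hT⟩ := exists_nat_ge t
  obtain ⟨S, hS⟩ := hν T
  have hc : Continuous (fun s => θ + (s - a) • F θ
      + ∑ z ∈ S with z.1 ∈ Ioo a t, markJump C q θ z.2) := by fun_prop
  refine ⟨_, ((hc.tendsto t).mono_left nhdsWithin_le_nhds).congr' ?_⟩
  have hev : ∀ᶠ s in 𝓝[<] t, ∀ z ∈ S, z.1 ∈ Ioo a t ↔ z.1 ∈ Ioc a s := by
    rw [Filter.eventually_all_finset]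
    intro z _
    by_cases hz : z.1 < t
    · filter_upwards [Ioo_mem_nhdsLT hz] with s hs
      exact ⟨fun h => ⟨h.1, hs.1.le⟩, fun h => ⟨h.1, hz⟩⟩
    · filter_upwards [self_mem_nhdsWithin] with s hs
      exact ⟨fun h => absurd h.2 hz, fun h => absurd (h.2.trans_lt hs) hz⟩
  filter_upwards [hev, self_mem_nhdsWithin] with s hs hsT
  rw [hS.eulerStep_eq C F q ha ((le_of_lt hsT).trans hT) θ, Finset.filter_congr hs]

theorem eulerPath_eq_eulerStep (C : QMat) (F q : QMat → QMat) (K : ℝ) (ρ₀ : QMat)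
    (ν : Measure (ℝ × ℝ)) {n : ℕ} {k : ℕ} {t : ℝ} (h1 : k ≤ n * t) (h2 : n * t < k + 1) :
    eulerPath C F q K ρ₀ ν n t
      = eulerStep C F q K ν ((k : ℝ) / n) t (eulerScheme C F q K ρ₀ ν n k) := by
  have : ⌊(n : ℝ) * t⌋₊ = k := (Nat.floor_eq_iff ((Nat.cast_nonneg k).trans h1)).2 ⟨h1, h2⟩
  rw [eulerPath, this]

theorem continuousWithinAt_eulerPath (hν : ∀ T : ℕ, ∃ S, IsPointSet ν K T S) (C : QMat)
    (F q : QMat → QMat) (ρ₀ : QMat) {n : ℕ} (hn : 1 ≤ n) {t : ℝ} (ht : 0 ≤ t) :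
    ContinuousWithinAt (eulerPath C F q K ρ₀ ν n) (Ici t) t := by
  have hn' : (0 : ℝ) < n := by exact_mod_cast hn
  have h1 : ((⌊(n : ℝ) * t⌋₊ : ℕ) : ℝ) ≤ n * t := Nat.floor_le (by positivity)
  have h2 : (n : ℝ) * t < (⌊(n : ℝ) * t⌋₊ : ℕ) + 1 := Nat.lt_floor_add_one _
  refine (continuousWithinAt_eulerStep hν C F q
    (eulerScheme C F q K ρ₀ ν n ⌊(n : ℝ) * t⌋₊) (a := (⌊(n : ℝ) * t⌋₊ : ℕ) / n)
      (by positivity)).congr_of_eventuallyEq ?_ rfl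
  have h3 : t < ((⌊(n : ℝ) * t⌋₊ : ℕ) + 1) / n := by rw [lt_div_iff₀ hn', mul_comm]; exact h2
  filter_upwards [Ico_mem_nhdsGE h3] with s hs
  refine eulerPath_eq_eulerStep C F q K ρ₀ ν (h1.trans ?_) ?_
  · gcongr; exact hs.1
  · have := hs.2
    rwa [lt_div_iff₀ hn', mul_comm] at this

theorem exists_tendsto_eulerPath (hν : ∀ T : ℕ, ∃ S, IsPointSet ν K T S) (C : QMat)
    (F q : QMat → QMat) (ρ₀ : QMat) {n : ℕ} (hn : 1 ≤ n) {t : ℝ} (ht : 0 < t) :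
    ∃ l, Tendsto (eulerPath C F q K ρ₀ ν n) (𝓝[<] t) (𝓝 l) := by
  have hn' : (0 : ℝ) < n := by exact_mod_cast hn
  -- When t is a grid point, the left limit belongs to the preceding step; the ceiling minus one
  -- selects it.
  obtain ⟨k, hk⟩ : ∃ k : ℕ, ⌈(n : ℝ) * t⌉₊ = k + 1 :=
    Nat.exists_eq_succ_of_ne_zero (Nat.ceil_pos.2 (by positivity)).ne'
  have h1 : (k : ℝ) < n * t := Nat.lt_ceil.1 (by omega)
  have h2 : (n : ℝ) * t ≤ k + 1 := by exact_mod_cast hk ▸ Nat.le_ceil ((n : ℝ) * t)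
  obtain ⟨l, hl⟩ := exists_tendsto_eulerStep hν C F q (eulerScheme C F q K ρ₀ ν n k)
    (a := (k : ℝ) / n) (t := t) (by positivity)
  refine ⟨l, hl.congr' ?_⟩
  have h3 : (k : ℝ) / n < t := by rw [div_lt_iff₀ hn', mul_comm]; exact h1
  filter_upwards [Ioo_mem_nhdsLT h3] with s hs
  refine (eulerPath_eq_eulerStep C F q K ρ₀ ν ?_ (lt_of_lt_of_le ?_ h2)).symm
  · have := hs.1
    rw [div_lt_iff₀ hn', mul_comm] at this
    exact this.le
  · gcongr; exact hs.2

end EulerPath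

theorem isCadlag_restrict_Icc {E : Type*} [TopologicalSpace E] {x : ℝ → E} (T : ℝ)
    (hr : ∀ t, 0 ≤ t → ContinuousWithinAt x (Ici t) t)
    (hl : ∀ t, 0 < t → ∃ l, Tendsto x (𝓝[<] t) (𝓝 l)) :
    IsCadlag fun t : Icc (0 : ℝ) T => x t := by
  intro t
  constructor
  · have h2 : Tendsto (Subtype.val : Icc (0 : ℝ) T → ℝ) (𝓝[≥] t) (𝓝[≥] (t : ℝ)) :=
      tendsto_nhdsWithin_of_tendsto_nhds_of_eventually_within _
        ((continuous_subtype_val.tendsto t).mono_left nhdsWithin_le_nhds)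
        (eventually_mem_nhdsWithin.mono fun s hs => hs)
    exact Tendsto.comp (hr t t.2.1) h2
  · have h2 : Tendsto (Subtype.val : Icc (0 : ℝ) T → ℝ) (𝓝[<] t) (𝓝[<] (t : ℝ)) :=
      tendsto_nhdsWithin_of_tendsto_nhds_of_eventually_within _
        ((continuous_subtype_val.tendsto t).mono_left nhdsWithin_le_nhds)
        (eventually_mem_nhdsWithin.mono fun s hs => hs)
    rcases t.2.1.lt_or_eq with h0 | h0
    · obtain ⟨l, hl⟩ := hl t h0
      exact ⟨l, hl.comp h2⟩
    -- At time 0 there is nothing to the left inside [0,T], so any value serves as left limit.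
    · have : 𝓝[<] t = ⊥ := by
        rw [← empty_mem_iff_bot]
        filter_upwards [self_mem_nhdsWithin] with s hs
        have h1 : (s : ℝ) < t := hs
        exact absurd s.2.1 (not_le.2 (h1.trans_eq h0.symm))
      exact ⟨x t, this ▸ tendsto_bot⟩

theorem IsCadlag.restrict_Icc {E : Type*} [TopologicalSpace E] [T2Space E] {x : ℝ → E}
    (hx : IsCadlag fun t : ℝ≥0 => x t) (T : ℝ) : IsCadlag fun t : Icc (0 : ℝ) T => x t :=
  isCadlag_restrict_Icc T (fun _ ht => hx.continuousWithinAt_Ici ht)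
    fun _ ht => ⟨_, hx.tendsto_leftLim ht⟩

/-! ## Running suprema -/

/-- Right-continuity lets rationals to the right of t replace t. The endpoint u has no such
rationals inside the interval and is kept separately. This makes running suprema measurable. -/
theorem iSup_Icc_eq_iSup_rat {f : ℝ → ℝ≥0∞} {u : ℝ} (hu : 0 ≤ u)
    (hf : ∀ t, 0 ≤ t → ContinuousWithinAt f (Ici t) t) :
    ⨆ t ∈ Icc 0 u, f t = max (f u) (⨆ r : {r : ℚ // (r : ℝ) ∈ Icc 0 u}, f (r : ℚ)) := by
  refine le_antisymm (iSup₂_le fun t ht => ?_) (max_le ?_ (iSup_le fun r => ?_))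
  · rcases ht.2.lt_or_eq with h | h
    · refine le_max_of_le_right (le_of_not_gt fun hlt => ?_)
      have hev : ∀ᶠ s in 𝓝[>] t, (⨆ r : {r : ℚ // (r : ℝ) ∈ Icc 0 u}, f (r : ℚ)) < f s :=
        ((hf t ht.1).eventually (lt_mem_nhds hlt)).filter_mono
          (nhdsWithin_mono _ Ioi_subset_Ici_self)
      obtain ⟨d, hd, hd'⟩ := (mem_nhdsGT_iff_exists_Ioo_subset' h).1 hev
      obtain ⟨r, hr, hr'⟩ := exists_rat_btwn (lt_min hd h)
      have h1 : _ < f r := hd' ⟨hr, hr'.trans_le (min_le_left _ _)⟩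
      refine (lt_irrefl _ (lt_of_lt_of_le h1 ?_))
      exact le_iSup (fun r : {r : ℚ // (r : ℝ) ∈ Icc 0 u} => f (r : ℚ))
        ⟨r, ht.1.trans hr.le, hr'.le.trans (min_le_right _ _)⟩
    · rw [h]; exact le_max_left _ _
  · exact le_iSup₂ (f := fun t (_ : t ∈ Icc 0 u) => f t) u ⟨hu, le_rfl⟩
  · exact le_iSup₂ (f := fun t (_ : t ∈ Icc 0 u) => f t) (r : ℝ) r.2

theorem aemeasurable_iSup_Icc {Ω : Type*} [MeasurableSpace Ω] {P : Measure Ω}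
    {f : Ω → ℝ → ℝ≥0∞} {u : ℝ} (hu : 0 ≤ u) (hm : ∀ t, 0 ≤ t → AEMeasurable (fun ω => f ω t) P)
    (hf : ∀ᵐ ω ∂P, ∀ t, 0 ≤ t → ContinuousWithinAt (f ω) (Ici t) t) :
    AEMeasurable (fun ω => ⨆ t ∈ Icc 0 u, f ω t) P := by
  have h : AEMeasurable
      (fun ω => max (f ω u) (⨆ r : {r : ℚ // (r : ℝ) ∈ Icc 0 u}, f ω (r : ℚ))) P :=
    (hm u hu).sup (AEMeasurable.iSup fun r => hm _ r.2.1)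
  refine h.congr ?_
  filter_upwards [hf] with ω hω using (iSup_Icc_eq_iSup_rat hu hω).symm

/-! ## The strong error of the scheme -/

section StrongError

variable {Ω : Type*} [mΩ : MeasurableSpace Ω] {P : Measure Ω}
  {𝓕 : Filtration ℝ≥0 mΩ} {N : Ω → Measure (ℝ × ℝ)} {H C : QMat} {K : ℝ} {ρ₀ : QMat}
  {m : ℝ → Ω → QMat} {F q : QMat → QMat} {L : ℝ}

theorem aemeasurable_iSup_enorm_sub (hN : IsPoissonRandomMeasure P 𝓕 N)
    (hm : IsJumpBelavkinSolution P 𝓕 N H C K ρ₀ m) (hF : Continuous F) (hq : Continuous q)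
    {n : ℕ} (hn : 1 ≤ n) {u : ℝ} (hu : 0 ≤ u) :
    AEMeasurable (fun ω => ⨆ t ∈ Icc 0 u, ‖eulerPath C F q K ρ₀ (N ω) n t - m t ω‖ₑ) P := by
  refine aemeasurable_iSup_Icc (f := fun ω t => ‖eulerPath C F q K ρ₀ (N ω) n t - m t ω‖ₑ) hu
    (fun t ht => ?_) ?_
  · have h1 : StronglyMeasurable (m t) := by
      have := (hm.adapted ⟨t, ht⟩).mono (𝓕.le _)
      exact this
    exact ((hN.aestronglyMeasurable_eulerPath C hF hq K ρ₀ hn ht).sub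
      h1.aestronglyMeasurable).enorm
  · filter_upwards [hN.ae_exists_isPointSet K] with ω hω t ht
    exact ((continuousWithinAt_eulerPath hω C F q ρ₀ hn ht).sub
      ((hm.cadlag ω).continuousWithinAt_Ici (x := fun t => m t ω) ht)).enorm

variable [IsProbabilityMeasure P]

/-- The dominating process is the sum of the one-step increments; being nonnegative, they make it
increasing in k. Adding 1/n to its mean turns the affine recursion into a purely geometric one. -/
theorem exists_error_bound (hN : IsPoissonRandomMeasure P 𝓕 N)
    (hH : H.IsHermitian) (hρ₀ : IsState ρ₀) (hK : 0 ≤ K)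
    (hm : IsJumpBelavkinSolution P 𝓕 N H C K ρ₀ m)
    (hF : IsLipschitzDrift H C F) (hq : IsLipschitzJump C q)
    (hL : IsCoefBound H C F q L) {n : ℕ} (hn : 1 ≤ n) :
    ∃ U : ℕ → Ω → ℝ≥0∞, Monotone U ∧
      (∀ᵐ ω ∂P, ∀ t : ℝ, 0 ≤ t →
        ‖eulerPath C F q K ρ₀ (N ω) n t - m t ω‖ₑ ≤ U (⌊(n : ℝ) * t⌋₊ + 1) ω) ∧
      ∀ k, ∫⁻ ω, U k ω ∂P + ENNReal.ofReal (1 / n)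
        ≤ (1 + ENNReal.ofReal (errorRate L K) * ENNReal.ofReal (1 / n)) ^ k
          * ENNReal.ofReal (1 / n) := by
  have hn' : (0 : ℝ) < n := by exact_mod_cast hn
  have hFc : Continuous F := hF.1.choose_spec.continuous
  have hqc : Continuous q := hq.1.choose_spec.continuous
  have hlen : ∀ k : ℕ, (((((k + 1 : ℕ) : ℝ≥0) / n : ℝ≥0)) : ℝ) - (((k : ℝ≥0) / n : ℝ≥0) : ℝ)
      = 1 / n := fun k => by
    push_cast
    field_simp
    ring
  have hstep : ∀ k : ℕ, ∃ Q : Ω → ℝ≥0∞, AEMeasurable Q P ∧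
      (∀ᵐ ω ∂P, ∀ t ∈ Icc ((k : ℝ) / n) (((k + 1 : ℕ) : ℝ) / n),
        ‖eulerStep C F q K (N ω) ((k : ℝ) / n) t (eulerScheme C F q K ρ₀ (N ω) n k) - m t ω‖ₑ
        ≤ ‖eulerScheme C F q K ρ₀ (N ω) n k - m ((k : ℝ) / n) ω‖ₑ + Q ω) ∧
      ∫⁻ ω, Q ω ∂P ≤ ENNReal.ofReal (errorRate L K) * ENNReal.ofReal (1 / n)
        * (∫⁻ ω, ‖eulerScheme C F q K ρ₀ (N ω) n k - m ((k : ℝ) / n) ω‖ₑ ∂P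
          + ENNReal.ofReal (1 / n)) := fun k => by
    obtain ⟨η, hη, hη'⟩ := hN.exists_version_eulerScheme C hFc hqc K ρ₀ n k
    have := exists_stepError_bound hN hH hρ₀ hK hm hF hq hL
      (a := (k : ℝ≥0) / n) (b := ((k + 1 : ℕ) : ℝ≥0) / n) (by gcongr; simp) hη hη'
    rw [hlen] at this
    simpa only [NNReal.coe_div, NNReal.coe_natCast] using this
  choose Q hQm hQ hQi using hstep
  have hU : ∀ᵐ ω ∂P, ∀ k : ℕ,
      ‖eulerScheme C F q K ρ₀ (N ω) n k - m ((k : ℝ) / n) ω‖ₑ ≤ ∑ j ∈ Finset.range k, Q j ω := by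
    filter_upwards [ae_all_iff.2 hQ, hm.ae_isSolutionPath hN] with ω hω hx k
    induction k with
    | zero =>
      have h0 : m 0 ω = ρ₀ := hx.eq_zero
      simp [eulerScheme, h0]
    | succ k ih =>
      rw [Finset.sum_range_succ]
      refine (hω k (((k + 1 : ℕ) : ℝ) / n) ⟨?_, le_rfl⟩).trans (add_le_add ih le_rfl)
      gcongr
      simp
  refine ⟨fun k ω => ∑ j ∈ Finset.range k, Q j ω, ?_, ?_, fun k => ?_⟩
  · intro j k hjk ω
    exact Finset.sum_le_sum_of_subset (Finset.range_mono hjk)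
  · filter_upwards [ae_all_iff.2 hQ, hU] with ω hω hUω t ht
    have h1 : ((⌊(n : ℝ) * t⌋₊ : ℕ) : ℝ) ≤ n * t := Nat.floor_le (by positivity)
    have h2 : (n : ℝ) * t < (⌊(n : ℝ) * t⌋₊ : ℕ) + 1 := Nat.lt_floor_add_one _
    rw [Finset.sum_range_succ]
    -- A time inside step k needs the increments of all earlier steps and that of step k itself,
    -- hence the index k + 1.
    refine (hω ⌊(n : ℝ) * t⌋₊ t ⟨?_, ?_⟩).trans (add_le_add (hUω _) le_rfl)
    · rw [div_le_iff₀ hn']; linarith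
    · rw [le_div_iff₀ hn']; push_cast; linarith
  · induction k with
    | zero => simp
    | succ k ih =>
      have hsum : ∫⁻ ω, ∑ j ∈ Finset.range (k + 1), Q j ω ∂P
          = ∫⁻ ω, ∑ j ∈ Finset.range k, Q j ω ∂P + ∫⁻ ω, Q k ω ∂P := by
        simp only [Finset.sum_range_succ]
        exact lintegral_add_right' _ (hQm k)
      have he : ∫⁻ ω, ‖eulerScheme C F q K ρ₀ (N ω) n k - m ((k : ℝ) / n) ω‖ₑ ∂P
          ≤ ∫⁻ ω, ∑ j ∈ Finset.range k, Q j ω ∂P :=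
        lintegral_mono_ae (hU.mono fun ω hω => hω k)
      rw [hsum]
      calc _ ≤ ∫⁻ ω, ∑ j ∈ Finset.range k, Q j ω ∂P
            + ENNReal.ofReal (errorRate L K) * ENNReal.ofReal (1 / n)
              * (∫⁻ ω, ∑ j ∈ Finset.range k, Q j ω ∂P + ENNReal.ofReal (1 / n))
            + ENNReal.ofReal (1 / n) := by gcongr; exact (hQi k).trans (by gcongr)
        _ = (1 + ENNReal.ofReal (errorRate L K) * ENNReal.ofReal (1 / n))
              * (∫⁻ ω, ∑ j ∈ Finset.range k, Q j ω ∂P + ENNReal.ofReal (1 / n)) := by ring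
        _ ≤ (1 + ENNReal.ofReal (errorRate L K) * ENNReal.ofReal (1 / n))
              * ((1 + ENNReal.ofReal (errorRate L K) * ENNReal.ofReal (1 / n)) ^ k
                * ENNReal.ofReal (1 / n)) := by gcongr
        _ = _ := by ring

theorem errorRate_nonneg {L K : ℝ} (hL : 0 ≤ L) (hK : 0 ≤ K) : 0 ≤ errorRate L K := by
  unfold errorRate; positivity

/-- The strong error of the scheme is of order `1/n`. -/
theorem lintegral_iSup_enorm_sub_le (hN : IsPoissonRandomMeasure P 𝓕 N)
    (hH : H.IsHermitian) (hρ₀ : IsState ρ₀) (hK : 0 ≤ K)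
    (hm : IsJumpBelavkinSolution P 𝓕 N H C K ρ₀ m)
    (hF : IsLipschitzDrift H C F) (hq : IsLipschitzJump C q)
    (hL : IsCoefBound H C F q L) {n : ℕ} (hn : 1 ≤ n) {u T : ℝ} (hu : 0 ≤ u) (huT : u ≤ T) :
    ∫⁻ ω, ⨆ t ∈ Icc 0 u, ‖eulerPath C F q K ρ₀ (N ω) n t - m t ω‖ₑ ∂P
      ≤ ENNReal.ofReal (Real.exp (errorRate L K * (T + 1)) / n) := by
  have hn' : (0 : ℝ) < n := by exact_mod_cast hn
  have hc := errorRate_nonneg hL.nonneg hK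
  obtain ⟨U, hUm, hU, hUi⟩ := exists_error_bound hN hH hρ₀ hK hm hF hq hL hn
  set k := ⌊(n : ℝ) * u⌋₊ + 1 with hk
  calc ∫⁻ ω, ⨆ t ∈ Icc 0 u, ‖eulerPath C F q K ρ₀ (N ω) n t - m t ω‖ₑ ∂P
      ≤ ∫⁻ ω, U k ω ∂P := by
        refine lintegral_mono_ae (hU.mono fun ω hω => iSup₂_le fun t ht => ?_)
        refine (hω t ht.1).trans (hUm ?_ ω)
        have : ⌊(n : ℝ) * t⌋₊ ≤ ⌊(n : ℝ) * u⌋₊ := Nat.floor_mono (by gcongr; exact ht.2)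
        omega
    _ ≤ ∫⁻ ω, U k ω ∂P + ENNReal.ofReal (1 / n) := le_self_add
    _ ≤ _ := hUi k
    _ = ENNReal.ofReal ((1 + errorRate L K * (1 / n)) ^ k * (1 / n)) := by
        rw [ENNReal.ofReal_mul (by positivity), ENNReal.ofReal_pow (by positivity),
          ENNReal.ofReal_add zero_le_one (by positivity), ENNReal.ofReal_mul hc,
          ENNReal.ofReal_one]
    _ ≤ _ := by
        refine ENNReal.ofReal_le_ofReal ?_
        rw [div_eq_mul_one_div (Real.exp _)]
        gcongr
        have h1 : 1 + errorRate L K * (1 / n) ≤ Real.exp (errorRate L K * (1 / n)) := by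
          rw [add_comm]; exact Real.add_one_le_exp _
        refine (pow_le_pow_left₀ (by positivity) h1 k).trans ?_
        rw [← Real.exp_nat_mul, Real.exp_le_exp]
        -- The step containing u is counted in full; since n ≥ 1, its extra unit is absorbed by
        -- replacing T with T + 1.
        have h2 : (k : ℝ) ≤ n * (T + 1) := by
          rw [hk]; push_cast
          have h3 : ((⌊(n : ℝ) * u⌋₊ : ℕ) : ℝ) ≤ n * u := Nat.floor_le (by positivity)
          have h4 : (1 : ℝ) ≤ n := by exact_mod_cast hn
          nlinarith
        calc (k : ℝ) * (errorRate L K * (1 / n))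
            ≤ (n * (T + 1)) * (errorRate L K * (1 / n)) := by gcongr
          _ = _ := by field_simp

end StrongError

/-! ## Measurability of random càdlàg paths in the Skorokhod space -/

namespace Skorokhod

section TimeChange

/-- The tent function of half-width `η`. -/
noncomputable def tent (η t : ℝ) : ℝ := max (1 - |t| / η) 0

theorem tent_zero (η : ℝ) : tent η 0 = 1 := by simp [tent]

theorem tent_eq_zero {η t : ℝ} (hη : 0 < η) (h : η ≤ |t|) : tent η t = 0 := by
  rw [tent, max_eq_right]
  rw [sub_nonpos, le_div_iff₀ hη, one_mul]
  exact h

theorem abs_tent_le_one {η : ℝ} (hη : 0 < η) (t : ℝ) : |tent η t| ≤ 1 := by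
  rw [tent, abs_of_nonneg (le_max_right _ _)]
  have : 0 ≤ |t| / η := by positivity
  exact max_le (by linarith) zero_le_one

theorem abs_tent_sub_le {η : ℝ} (hη : 0 < η) (s t : ℝ) : |tent η s - tent η t| ≤ |s - t| / η := by
  unfold tent
  refine (abs_max_sub_max_le_abs _ _ _).trans ?_
  rw [sub_sub_sub_cancel_left, ← sub_div, abs_div, abs_of_pos hη]
  refine div_le_div_of_nonneg_right ?_ hη.le
  rw [abs_sub_comm s t]
  exact abs_abs_sub_abs_le _ _

theorem continuous_tent (η : ℝ) : Continuous (tent η) := by unfold tent; fun_prop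

theorem exists_pos_forall_le_abs_sub (S : Finset ℝ) :
    ∃ η > 0, ∀ x ∈ S, ∀ y ∈ S, x ≠ y → η ≤ |x - y| := by
  have h : ∀ᶠ η in 𝓝[>] (0 : ℝ), ∀ x ∈ S, ∀ y ∈ S, x ≠ y → η ≤ |x - y| := by
    rw [Filter.eventually_all_finset]
    intro x _
    rw [Filter.eventually_all_finset]
    intro y _
    by_cases hxy : x = y
    · exact Eventually.of_forall fun _ h => absurd hxy h
    · filter_upwards [Ioo_mem_nhdsGT (abs_pos.2 (sub_ne_zero.2 hxy))] with η hη _ using hη.2.le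
  obtain ⟨η, h1, h2⟩ := (h.and self_mem_nhdsWithin).exists
  exact ⟨η, h2, h1⟩

/-- Finitely many times in `(0,T)` can be moved slightly by a time change close to the identity. -/
theorem exists_orderIso {T : ℝ} (hT : 0 < T) (S : Finset ℝ) (hS : ∀ σ ∈ S, σ ∈ Ioo 0 T) :
    ∃ η > 0, ∀ (φ : ℝ → ℝ) (δ : ℝ), 0 ≤ δ → S.card * δ < η → (∀ σ ∈ S, |φ σ - σ| ≤ δ) →
      ∃ r : Icc (0 : ℝ) T ≃o Icc (0 : ℝ) T,
        (∀ t : Icc (0 : ℝ) T, (t : ℝ) ∈ S → (r t : ℝ) = φ t) ∧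
        ∀ t, |(r t : ℝ) - t| ≤ S.card * δ := by
  -- Including 0 and T in the gap makes the perturbation below vanish at both endpoints.
  obtain ⟨η, hη, hgap⟩ := exists_pos_forall_le_abs_sub (insert 0 (insert T S))
  refine ⟨η, hη, fun φ δ hδ hcard hφ => ?_⟩
  -- A tent of half-width η is 1 at its own point and 0 at all the others, so p interpolates the
  -- prescribed displacements.
  let p : ℝ → ℝ := fun t => ∑ σ ∈ S, (φ σ - σ) * tent η (t - σ)
  have hp : ∀ t, |p t| ≤ S.card * δ := fun t => by
    refine (Finset.abs_sum_le_sum_abs _ _).trans ?_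
    rw [← nsmul_eq_mul]
    refine Finset.sum_le_card_nsmul _ _ _ fun σ hσ => ?_
    rw [abs_mul]
    exact (mul_le_mul (hφ σ hσ) (abs_tent_le_one hη _) (abs_nonneg _) hδ).trans_eq (mul_one δ)
  have hpl : ∀ s t, |p s - p t| ≤ S.card * δ * (|s - t| / η) := fun s t => by
    simp only [p]
    rw [← Finset.sum_sub_distrib]
    refine (Finset.abs_sum_le_sum_abs _ _).trans ?_
    rw [mul_assoc, ← nsmul_eq_mul]
    refine Finset.sum_le_card_nsmul _ _ _ fun σ hσ => ?_
    rw [← mul_sub, abs_mul]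
    refine mul_le_mul (hφ σ hσ) ?_ (abs_nonneg _) hδ
    have := abs_tent_sub_le hη (s - σ) (t - σ)
    rwa [sub_sub_sub_cancel_right] at this
  have hend : ∀ u, u = 0 ∨ u = T → p u = 0 := fun u hu => by
    refine Finset.sum_eq_zero fun σ hσ => ?_
    rw [tent_eq_zero hη, mul_zero]
    refine hgap u ?_ σ (by simp [hσ]) ?_
    · rcases hu with rfl | rfl <;> simp
    · rcases hu with rfl | rfl
      · exact (hS σ hσ).1.ne
      · exact (hS σ hσ).2.ne'
  have hpS : ∀ t ∈ S, p t = φ t - t := fun t ht => by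
    simp only [p]
    rw [Finset.sum_eq_single t, sub_self, tent_zero, mul_one]
    · intro σ hσ hne
      rw [tent_eq_zero hη, mul_zero]
      exact hgap t (by simp [ht]) σ (by simp [hσ]) hne.symm
    · exact fun h => absurd ht h
  -- The perturbation has Lipschitz constant at most card · δ/η < 1, so adding it to the identity
  -- preserves strict monotonicity.
  have hmono : StrictMono fun t => t + p t := fun s t hst => by
    have h1 := hpl s t
    have h2 : S.card * δ * (|s - t| / η) < |s - t| := by
      have h3 : 0 < |s - t| := abs_pos.2 (sub_ne_zero.2 hst.ne)
      rw [mul_div_assoc', div_lt_iff₀ hη, mul_comm |s - t|]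
      gcongr
    have h3 := abs_lt.1 (h1.trans_lt h2)
    rw [abs_of_neg (sub_neg.2 hst)] at h3
    simp only
    linarith [h3.2]
  have hcont : Continuous fun t => t + p t := by
    have := continuous_tent η
    fun_prop
  have h0 : (0 : ℝ) + p 0 = 0 := by rw [hend 0 (Or.inl rfl), add_zero]
  have hT' : T + p T = T := by rw [hend T (Or.inr rfl), add_zero]
  let g : Icc (0 : ℝ) T → Icc (0 : ℝ) T := fun t => ⟨t + p t,
    h0.symm.le.trans (hmono.monotone t.2.1), (hmono.monotone t.2.2).trans hT'.le⟩
  have hgm : StrictMono g := fun s t hst => hmono hst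
  have hgs : Function.Surjective g := fun y => by
    have := intermediate_value_Icc hT.le hcont.continuousOn (f := fun t => t + p t)
    simp only [h0, hT'] at this
    obtain ⟨t, ht, hty⟩ := this y.2
    exact ⟨⟨t, ht⟩, Subtype.ext hty⟩
  refine ⟨hgm.orderIsoOfSurjective g hgs, fun t ht => ?_, fun t => ?_⟩
  · change (t : ℝ) + p t = φ t
    rw [hpS t ht]; ring
  · change |(t : ℝ) + p t - t| ≤ _
    rw [add_sub_cancel_left]
    exact hp t

end TimeChange

/-- A càdlàg path on `[0,T]` oscillates little on the intervals of some finite partition. -/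
theorem exists_partition {T : ℝ} {E : Type*} [PseudoEMetricSpace E] {x : Icc (0 : ℝ) T → E}
    (hx : IsCadlag x) {ε : ℝ≥0∞} (hε : 0 < ε) :
    ∃ S : Finset ℝ, (∀ σ ∈ S, σ ∈ Ioo 0 T) ∧ ∀ s t : Icc (0 : ℝ) T,
      ((s : ℝ) = T ↔ (t : ℝ) = T) → (∀ σ ∈ S, σ ≤ s ↔ σ ≤ t) → edist (x s) (x t) ≤ ε := by
  have hε2 : 0 < ε / 2 := ENNReal.half_pos hε.ne'
  have hloc : ∀ p : Icc (0 : ℝ) T, ∃ δ > 0, ∀ s t : Icc (0 : ℝ) T, dist s p < δ → dist t p < δ →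
      (p ≤ s ↔ p ≤ t) → edist (x s) (x t) ≤ ε := fun p => by
    obtain ⟨hr, l, hl⟩ := hx p
    obtain ⟨δ₁, hδ₁, h₁⟩ := Metric.mem_nhdsWithin_iff.1 (hr (Metric.eball_mem_nhds _ hε2))
    obtain ⟨δ₂, hδ₂, h₂⟩ := Metric.mem_nhdsWithin_iff.1 (hl (Metric.eball_mem_nhds _ hε2))
    refine ⟨min δ₁ δ₂, lt_min hδ₁ hδ₂, fun s t hs ht hst => ?_⟩
    rw [← ENNReal.add_halves ε]
    by_cases hps : p ≤ s
    · have h3 : edist (x s) (x p) < ε / 2 := h₁ ⟨hs.trans_le (min_le_left _ _), hps⟩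
      have h4 : edist (x t) (x p) < ε / 2 := h₁ ⟨ht.trans_le (min_le_left _ _), hst.1 hps⟩
      exact (edist_triangle_right _ _ _).trans (add_le_add h3.le h4.le)
    · have h3 : edist (x s) l < ε / 2 := h₂ ⟨hs.trans_le (min_le_right _ _), not_le.1 hps⟩
      have h4 : edist (x t) l < ε / 2 :=
        h₂ ⟨ht.trans_le (min_le_right _ _), not_le.1 fun h => hps (hst.2 h)⟩
      exact (edist_triangle_right _ _ _).trans (add_le_add h3.le h4.le)
  choose δ hδ hosc using hloc
  obtain ⟨F, hF⟩ := CompactSpace.elim_nhds_subcover (fun p => Metric.ball p (δ p / 2))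
    fun p => Metric.ball_mem_nhds p (half_pos (hδ p))
  classical
  -- The separating points are the centres and the ends of the half-balls of a finite cover. Lying
  -- on the same side of all of them keeps t within δ of the centre p of the ball containing s, and
  -- on the same side of p as s.
  refine ⟨(F.image (fun p : Icc (0 : ℝ) T => (p : ℝ) - δ p / 2) ∪ F.image (fun p : Icc (0 : ℝ) T => (p : ℝ)) ∪
    F.image (fun p : Icc (0 : ℝ) T => (p : ℝ) + δ p / 2)).filter (· ∈ Ioo 0 T),
    fun σ hσ => (Finset.mem_filter.1 hσ).2, fun s t hT hst => ?_⟩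
  have hs : s ∈ ⋃ p ∈ F, Metric.ball p (δ p / 2) := by rw [hF]; trivial
  simp only [mem_iUnion, Metric.mem_ball] at hs
  obtain ⟨p, hp, hsp⟩ := hs
  have hsep : ∀ σ, σ ∈ F.image (fun p : Icc (0 : ℝ) T => (p : ℝ) - δ p / 2) ∪ F.image (fun p : Icc (0 : ℝ) T => (p : ℝ)) ∪
      F.image (fun p : Icc (0 : ℝ) T => (p : ℝ) + δ p / 2) → (σ ≤ s ↔ σ ≤ t) := fun σ hσ => by
    by_cases h0 : σ ≤ 0
    · exact ⟨fun _ => h0.trans t.2.1, fun _ => h0.trans s.2.1⟩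
    by_cases h1 : σ < T
    · exact hst σ (Finset.mem_filter.2 ⟨hσ, not_le.1 h0, h1⟩)
    · have key : ∀ v : Icc (0 : ℝ) T, σ ≤ v ↔ (v : ℝ) = T ∧ σ = T := fun v =>
        ⟨fun h => ⟨le_antisymm v.2.2 ((not_lt.1 h1).trans h),
          le_antisymm (h.trans v.2.2) (not_lt.1 h1)⟩, fun h => by rw [h.1, h.2]⟩
      rw [key, key, hT]
  have m1 := hsep ((p : ℝ) - δ p / 2) (by
    simp only [Finset.mem_union, Finset.mem_image]; exact Or.inl (Or.inl ⟨p, hp, rfl⟩))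
  have m2 := hsep (p : ℝ) (by
    simp only [Finset.mem_union, Finset.mem_image]; exact Or.inl (Or.inr ⟨p, hp, rfl⟩))
  have m3 := hsep ((p : ℝ) + δ p / 2) (by
    simp only [Finset.mem_union, Finset.mem_image]; exact Or.inr ⟨p, hp, rfl⟩)
  have hsp' := hsp
  rw [Subtype.dist_eq, Real.dist_eq, abs_lt] at hsp'
  have a1 : (p : ℝ) - δ p / 2 ≤ t := m1.1 (by linarith [hsp'.1])
  have a2 : (t : ℝ) < p + δ p / 2 := not_le.1 fun h => absurd (m3.2 h) (by linarith [hsp'.2])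
  have hδp := hδ p
  refine hosc p s t (hsp.trans (half_lt_self hδp)) ?_ m2
  rw [Subtype.dist_eq, Real.dist_eq, abs_lt]
  constructor <;> linarith

/-! ### Approximation by step paths and Borel measurability -/

variable {E : Type*}

theorem isCadlag_comp_floor [TopologicalSpace E] (T : ℝ) {c : ℝ} (hc : 0 < c) (w : ℕ → E) :
    IsCadlag fun t : Icc (0 : ℝ) T => w ⌊c * t⌋₊ := by
  refine isCadlag_restrict_Icc (x := fun t => w ⌊c * t⌋₊) T (fun t ht => ?_) fun t ht => ?_
  · have h1 : ((⌊c * t⌋₊ : ℕ) : ℝ) ≤ c * t := Nat.floor_le (by positivity)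
    have h3 : t < ((⌊c * t⌋₊ : ℕ) + 1) / c := by
      rw [lt_div_iff₀ hc, mul_comm]; exact Nat.lt_floor_add_one _
    refine (continuousWithinAt_const (b := w ⌊c * t⌋₊)).congr_of_eventuallyEq ?_ rfl
    filter_upwards [Ico_mem_nhdsGE h3] with s hs
    have h4 := hs.2
    rw [lt_div_iff₀ hc, mul_comm] at h4
    have h5 : ((⌊c * t⌋₊ : ℕ) : ℝ) ≤ c * s := h1.trans (by gcongr; exact hs.1)
    rw [(Nat.floor_eq_iff ((Nat.cast_nonneg _).trans h5)).2 ⟨h5, h4⟩]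
  · obtain ⟨k, hk⟩ : ∃ k : ℕ, ⌈c * t⌉₊ = k + 1 :=
      Nat.exists_eq_succ_of_ne_zero (Nat.ceil_pos.2 (by positivity)).ne'
    have h1 : (k : ℝ) < c * t := Nat.lt_ceil.1 (by omega)
    have h2 : c * t ≤ k + 1 := by exact_mod_cast hk ▸ Nat.le_ceil (c * t)
    refine ⟨w k, (tendsto_const_nhds (x := w k)).congr' ?_⟩
    have h3 : (k : ℝ) / c < t := by rw [div_lt_iff₀ hc, mul_comm]; exact h1
    filter_upwards [Ioo_mem_nhdsLT h3] with s hs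
    have h4 := hs.1
    rw [div_lt_iff₀ hc, mul_comm] at h4
    have h5 : c * s < k + 1 := lt_of_lt_of_le (by gcongr; exact hs.2) h2
    rw [(Nat.floor_eq_iff ((Nat.cast_nonneg _).trans h4.le)).2 ⟨h4.le, h5⟩]

variable {T : ℝ} [PseudoEMetricSpace E]

/-- The step path with values `v 0, …, v (j+1)` on the grid of mesh `T/(j+1)`. -/
noncomputable def stepPath (hT : 0 < T) (j : ℕ) (v : Fin (j + 2) → E) : Skorokhod T E :=
  ⟨fun t => v (Fin.ofNat (j + 2) ⌊((j : ℝ) + 1) / T * t⌋₊),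
    isCadlag_comp_floor T (by positivity) fun i => v (Fin.ofNat (j + 2) i)⟩

theorem edist_le_iSup (x y : Skorokhod T E) : edist x y ≤ ⨆ t, edist (x.1 t) (y.1 t) := by
  refine (iInf_le _ (OrderIso.refl _)).trans (max_le ?_ le_rfl)
  simp

theorem continuous_stepPath (hT : 0 < T) (j : ℕ) :
    Continuous (stepPath hT j : (Fin (j + 2) → E) → Skorokhod T E) := by
  have : LipschitzWith 1 (stepPath hT j : (Fin (j + 2) → E) → Skorokhod T E) := fun v w => by
    rw [ENNReal.coe_one, one_mul]
    exact (edist_le_iSup _ _).trans (iSup_le fun t => edist_le_pi_edist _ _ _)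
  exact this.continuous

/-- Sampling on a grid fails uniformly near a jump but succeeds after a time change that moves each
partition point σ to the next grid point. The sampled time and t then lie on the same side of every
σ, where the path oscillates little. -/
theorem tendsto_stepPath (hT : 0 < T) {x : ℝ → E} (hx : IsCadlag fun t : Icc (0 : ℝ) T => x t) :
    Tendsto (fun j : ℕ => stepPath hT j fun i => x (i * (T / ((j : ℝ) + 1)))) atTop
      (𝓝 (⟨_, hx⟩ : Skorokhod T E)) := by
  refine EMetric.tendsto_atTop.2 fun ε hε => ?_
  obtain ⟨ε', hε', hε'ε⟩ := exists_between hε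
  obtain ⟨S, hS, hosc⟩ := exists_partition hx hε'
  obtain ⟨η, hη, hiso⟩ := exists_orderIso hT S hS
  have hmesh : Tendsto (fun j : ℕ => (S.card : ℝ) * (T / ((j : ℝ) + 1))) atTop (𝓝 0) := by
    have := (tendsto_one_div_add_atTop_nhds_zero_nat (𝕜 := ℝ)).const_mul ((S.card : ℝ) * T)
    rw [mul_zero] at this
    refine this.congr fun j => ?_
    rw [mul_one_div, mul_div_assoc]
  have hmesh' : Tendsto (fun j : ℕ => ENNReal.ofReal ((S.card : ℝ) * (T / ((j : ℝ) + 1)))) atTop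
      (𝓝 0) := by
    simpa using ENNReal.tendsto_ofReal hmesh
  obtain ⟨J, hJ⟩ := eventually_atTop.1
    ((hmesh.eventually (gt_mem_nhds hη)).and (hmesh'.eventually (gt_mem_nhds hε')))
  refine ⟨J, fun j hj => ?_⟩
  obtain ⟨h1, h2⟩ := hJ j hj
  set d := T / ((j : ℝ) + 1) with hd
  have hd0 : 0 < d := by positivity
  have hdinv : ((j : ℝ) + 1) / T = d⁻¹ := by rw [hd, inv_div]
  obtain ⟨r, hr, hrt⟩ := hiso (fun σ => ⌈d⁻¹ * σ⌉₊ * d) d hd0.le h1 fun σ hσ => by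
    have hσ0 : 0 ≤ d⁻¹ * σ := mul_nonneg (inv_nonneg.2 hd0.le) (hS σ hσ).1.le
    have e1 := Nat.le_ceil (d⁻¹ * σ)
    have e2 := Nat.ceil_lt_add_one hσ0
    have e3 : σ = d⁻¹ * σ * d := by field_simp
    rw [abs_of_nonneg]
    · nlinarith
    · nlinarith
  refine lt_of_le_of_lt (iInf_le _ r) (lt_of_le_of_lt (max_le ?_ (iSup_le fun t => ?_)) hε'ε)
  · refine iSup_le fun t => le_trans ?_ h2.le
    rw [Subtype.edist_eq, edist_dist, Real.dist_eq]
    exact ENNReal.ofReal_le_ofReal (hrt t)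
  · have hk0 : 0 ≤ d⁻¹ * (r t : ℝ) := mul_nonneg (inv_nonneg.2 hd0.le) (r t).2.1
    have hjd : ((j : ℝ) + 1) * d = T := by rw [hd]; field_simp
    set k := ⌊d⁻¹ * (r t : ℝ)⌋₊ with hk
    have hkd : (k : ℝ) * d ≤ r t := by
      have := Nat.floor_le hk0
      calc (k : ℝ) * d ≤ d⁻¹ * (r t : ℝ) * d := by gcongr
        _ = r t := by field_simp
    have hkj : k ≤ j + 1 := by
      have : (k : ℝ) * d ≤ ((j : ℝ) + 1) * d := hkd.trans ((r t).2.2.trans hjd.ge)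
      have := le_of_mul_le_mul_right this hd0
      exact_mod_cast this
    have hval : (stepPath hT j fun i => x (i * d)).1 (r t) = x (k * d) := by
      simp only [stepPath, hdinv]
      rw [← hk]
      congr 2
      simp [Fin.ofNat, Nat.mod_eq_of_lt (show k < j + 2 by omega)]
    rw [hval]
    have hmem : (k : ℝ) * d ∈ Icc 0 T := ⟨by positivity, hkd.trans (r t).2.2⟩
    -- The terminal time must be matched separately because the path may jump at T; the extra grid
    -- index j + 1 represents it.
    refine hosc ⟨k * d, hmem⟩ t ⟨fun h => ?_, fun h => ?_⟩ fun σ hσ => ?_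
    · have hrT : (r t : ℝ) = T := le_antisymm (r t).2.2 (h.symm.le.trans hkd)
      have htop : r t = r ⟨T, hT.le, le_rfl⟩ := by
        refine le_antisymm (r.monotone t.2.2) ?_
        rw [← Subtype.coe_le_coe, hrT]
        exact (r _).2.2
      exact congrArg Subtype.val (r.injective htop)
    · have htop : (r t : ℝ) = T := by
        refine le_antisymm (r t).2.2 ?_
        obtain ⟨s, hs⟩ := r.surjective ⟨T, hT.le, le_rfl⟩
        have : r s ≤ r t := r.monotone (by
          rw [← Subtype.coe_le_coe, h]; exact s.2.2)
        rw [hs] at this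
        exact this
      have : k = j + 1 := by
        rw [hk, htop]
        have : d⁻¹ * T = ((j + 1 : ℕ) : ℝ) := by rw [← hjd]; push_cast; field_simp
        rw [this, Nat.floor_natCast]
      simp only [this]
      push_cast
      exact hjd
    · have hσ' : σ ∈ Icc 0 T := ⟨(hS σ hσ).1.le, (hS σ hσ).2.le⟩
      have e1 : (r ⟨σ, hσ'⟩ : ℝ) = ⌈d⁻¹ * σ⌉₊ * d := hr ⟨σ, hσ'⟩ hσ
      have e2 : σ ≤ t ↔ (r ⟨σ, hσ'⟩ : ℝ) ≤ r t := by
        rw [Subtype.coe_le_coe, r.le_iff_le, ← Subtype.coe_le_coe]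
      rw [e2, e1]
      -- The adjunctions of ceiling and floor with the cast: the shifted σ precedes r t exactly when
      -- σ precedes the grid point below r t.
      have e3 : (⌈d⁻¹ * σ⌉₊ : ℝ) * d ≤ r t ↔ ⌈d⁻¹ * σ⌉₊ ≤ k := by
        rw [hk, Nat.le_floor_iff hk0, inv_mul_eq_div d (r t : ℝ), le_div_iff₀ hd0]
      rw [e3, Nat.ceil_le, ← div_eq_inv_mul, div_le_iff₀ hd0]

theorem ofPath_eq [Zero E] {x : ℝ → E} (hx : IsCadlag fun t : Icc (0 : ℝ) T => x t) :
    ofPath T x = ⟨_, hx⟩ := by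
  unfold ofPath
  exact dif_pos hx

/-- Step paths depend continuously on finitely many samples and converge to the path almost surely.
The Borel σ-algebra of the Skorokhod topology thus never has to be described by evaluations. -/
theorem aemeasurable_ofPath {Ω : Type*} [MeasurableSpace Ω] {P : Measure Ω} {T : ℝ} {E : Type*}
    [NormedAddCommGroup E] (hT : 0 < T)
    {X : ℝ → Ω → E} (hX : ∀ t ∈ Icc 0 T, AEStronglyMeasurable (X t) P)
    (hc : ∀ᵐ ω ∂P, IsCadlag fun t : Icc (0 : ℝ) T => X t ω) :
    AEMeasurable (fun ω => ofPath T fun t => X t ω) P := by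
  have hstep : ∀ j : ℕ, AEStronglyMeasurable
      (fun ω => stepPath hT j fun i => X (i * (T / ((j : ℝ) + 1))) ω) P := fun j => by
    refine (continuous_stepPath hT j).comp_aestronglyMeasurable ?_
    have hgrid : ∀ i : Fin (j + 2), (i : ℝ) * (T / ((j : ℝ) + 1)) ∈ Icc 0 T := fun i => by
      refine ⟨by positivity, ?_⟩
      have h1 : (i : ℝ) ≤ (j : ℝ) + 1 := by exact_mod_cast Nat.le_of_lt_succ i.2
      calc (i : ℝ) * (T / ((j : ℝ) + 1)) ≤ ((j : ℝ) + 1) * (T / ((j : ℝ) + 1)) := by gcongr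
        _ = T := by field_simp
    have hsum : (fun ω (i : Fin (j + 2)) => X (i * (T / ((j : ℝ) + 1))) ω)
        = fun ω => ∑ i : Fin (j + 2), Pi.single i (X (i * (T / ((j : ℝ) + 1))) ω) := by
      funext ω
      exact (Finset.univ_sum_single fun i : Fin (j + 2) => X (i * (T / ((j : ℝ) + 1))) ω).symm
    rw [hsum]
    exact Finset.aestronglyMeasurable_fun_sum _ fun i _ =>
      (continuous_single i).comp_aestronglyMeasurable (hX _ (hgrid i))
  refine AEStronglyMeasurable.aemeasurable
    (aestronglyMeasurable_of_tendsto_ae atTop hstep ?_)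
  filter_upwards [hc] with ω hω
  rw [ofPath_eq hω]
  exact tendsto_stepPath hT (x := fun t => X t ω) hω

end Skorokhod

/-! ## Convergence of the scheme -/

/-- Markov's inequality applied to the dominating function, so the distance itself need not be
measurable. -/
theorem tendstoInMeasure_of_lintegral_edist_le {Ω E : Type*} [MeasurableSpace Ω] {P : Measure Ω}
    [EDist E] {X : ℕ → Ω → E} {Z : Ω → E} {Y : ℕ → Ω → ℝ≥0∞}
    (hY : ∀ n, AEMeasurable (Y n) P) (hXY : ∀ n, ∀ᵐ ω ∂P, edist (X n ω) (Z ω) ≤ Y n ω)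
    (hlim : Tendsto (fun n => ∫⁻ ω, Y n ω ∂P) atTop (𝓝 0)) :
    TendstoInMeasure P X atTop Z := by
  refine tendstoInMeasure_of_ne_top fun ε hε hε' => ?_
  have h : Tendsto (fun n => (∫⁻ ω, Y n ω ∂P) / ε) atTop (𝓝 0) := by
    have := ENNReal.Tendsto.div_const hlim (Or.inr hε.ne')
    rwa [ENNReal.zero_div] at this
  refine tendsto_of_tendsto_of_tendsto_of_le_of_le tendsto_const_nhds h (fun n => bot_le)
    fun n => ?_
  refine le_trans (measure_mono_ae ?_) (meas_ge_le_lintegral_div (hY n) hε.ne' hε')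
  filter_upwards [hXY n] with ω hω h
  exact le_trans h hω

theorem theorem5 {Ω : Type*} [mΩ : MeasurableSpace Ω] (P : Measure Ω) [IsProbabilityMeasure P]
    (𝓕 : Filtration ℝ≥0 mΩ) (N : Ω → Measure (ℝ × ℝ)) (hN : IsPoissonRandomMeasure P 𝓕 N)
    (H C : QMat) (hH : H.IsHermitian)
    (K : ℝ) (hK : ∀ ρ, IsState ρ → (jumpOp C ρ).trace.re ≤ K)
    (ρ₀ : QMat) (hρ₀ : IsState ρ₀)
    (m : ℝ → Ω → QMat) (hm : IsJumpBelavkinSolution P 𝓕 N H C K ρ₀ m) :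
    (∃ F, IsLipschitzDrift H C F) ∧ (∃ q, IsLipschitzJump C q) ∧
    ∀ F q : QMat → QMat, IsLipschitzDrift H C F → IsLipschitzJump C q → ∀ T : ℝ, 0 < T →
      (∃ Γ : ℝ, ∀ n : ℕ, 1 ≤ n → ∀ u : ℝ, 0 ≤ u → u < T →
        AEMeasurable
          (fun ω => ⨆ t ∈ Icc 0 u, ‖eulerPath C F q K ρ₀ (N ω) n t - m t ω‖ₑ) P ∧
        ∫⁻ ω, ⨆ t ∈ Icc 0 u, ‖eulerPath C F q K ρ₀ (N ω) n t - m t ω‖ₑ ∂P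
          ≤ ENNReal.ofReal (Γ / n)) ∧
      (∀ n : ℕ, 1 ≤ n → ∀ᵐ ω ∂P,
        IsCadlag fun t : Icc (0 : ℝ) T => eulerPath C F q K ρ₀ (N ω) n t) ∧
      TendstoInDistribution
        (fun n ω => Skorokhod.ofPath T fun t => eulerPath C F q K ρ₀ (N ω) (n + 1) t)
        atTop (fun ω => Skorokhod.ofPath T fun t => m t ω) (fun _ => P) P := by
  refine ⟨exists_isLipschitzDrift H C, exists_isLipschitzJump C, fun F q hF hq T hT => ?_⟩
  obtain ⟨L, hL⟩ := exists_isCoefBound hF hq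
  -- The jump rate at ρ₀ is nonnegative and bounded by K.
  have hK0 : 0 ≤ K := (hρ₀.jumpRate_nonneg C).trans (hK ρ₀ hρ₀)
  have hFc : Continuous F := hF.1.choose_spec.continuous
  have hqc : Continuous q := hq.1.choose_spec.continuous
  have hcad : ∀ n : ℕ, 1 ≤ n → ∀ᵐ ω ∂P,
      IsCadlag fun t : Icc (0 : ℝ) T => eulerPath C F q K ρ₀ (N ω) n t := fun n hn => by
    filter_upwards [hN.ae_exists_isPointSet K] with ω hω
    exact isCadlag_restrict_Icc T
      (fun t ht => continuousWithinAt_eulerPath hω C F q ρ₀ hn ht)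
      fun t ht => exists_tendsto_eulerPath hω C F q ρ₀ hn ht
  have hmcad : ∀ ω, IsCadlag fun t : Icc (0 : ℝ) T => m t ω := fun ω =>
    (hm.cadlag ω).restrict_Icc (x := fun t => m t ω) T
  refine ⟨⟨Real.exp (errorRate L K * (T + 1)), fun n hn u hu huT =>
    ⟨aemeasurable_iSup_enorm_sub hN hm hFc hqc hn hu,
      lintegral_iSup_enorm_sub_le hN hH hρ₀ hK0 hm hF hq hL hn hu huT.le⟩⟩, hcad, ?_⟩
  refine TendstoInMeasure.tendstoInDistribution
    (tendstoInMeasure_of_lintegral_edist_le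
      (Y := fun n ω => ⨆ t ∈ Icc 0 T, ‖eulerPath C F q K ρ₀ (N ω) (n + 1) t - m t ω‖ₑ)
      (fun n => aemeasurable_iSup_enorm_sub hN hm hFc hqc n.succ_pos hT.le) (fun n => ?_) ?_)
    fun n => ?_
  · filter_upwards [hcad (n + 1) n.succ_pos] with ω hω
    rw [Skorokhod.ofPath_eq hω, Skorokhod.ofPath_eq (x := fun t => m t ω) (hmcad ω)]
    -- The identity time change bounds the Skorokhod distance by the uniform one, which the running
    -- supremum over [0,T] controls.
    refine (Skorokhod.edist_le_iSup _ _).trans (iSup_le fun t => ?_)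
    rw [edist_eq_enorm_sub]
    exact le_iSup₂ (f := fun t (_ : t ∈ Icc 0 T) =>
      ‖eulerPath C F q K ρ₀ (N ω) (n + 1) t - m t ω‖ₑ) (t : ℝ) t.2
  · have hlim : Tendsto (fun n : ℕ => ENNReal.ofReal
        (Real.exp (errorRate L K * (T + 1)) / ((n + 1 : ℕ) : ℝ))) atTop (𝓝 0) := by
      have := ((tendsto_const_div_atTop_nhds_zero_nat
        (Real.exp (errorRate L K * (T + 1)))).comp (tendsto_add_atTop_nat 1))
      simpa using ENNReal.tendsto_ofReal this
    exact tendsto_of_tendsto_of_tendsto_of_le_of_le tendsto_const_nhds hlim (fun n => bot_le)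
      fun n => lintegral_iSup_enorm_sub_le hN hH hρ₀ hK0 hm hF hq hL n.succ_pos hT.le le_rfl
  · exact Skorokhod.aemeasurable_ofPath hT
      (X := fun t ω => eulerPath C F q K ρ₀ (N ω) (n + 1) t)
      (fun t ht => hN.aestronglyMeasurable_eulerPath C hFc hqc K ρ₀ n.succ_pos ht.1)
      (hcad (n + 1) n.succ_pos)
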